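/- Let $R$ be a (unital, associative) ring and let $M$ be an $R$-$R$-bimodule which is finitely generated projective as a left $R$-module. We use the following notions. *Stabilization.* For a category $\mathcal{C}$ with an endofunctor $\Omega$, the stabilization $\mathcal{S}(\mathcal{C},\Omega)$ is the category whose objects are the pairs $(X,n)$ with $X\in\mathcal{C}$ and $n\in\mathbb{Z}$, whose morphism sets are $$\mathcal{S}((X,n),(Y,m))=\operatorname{colim}_{p\ge \max\{n,m\}}\ \mathcal{C}(\Omega^{p-n}X,\Omega^{p-m}Y)$$ with structure maps induced by $\Omega$, and whose composition is induced by that of $\mathcal{C}$. *Module categories.* $R\text{-mod}$ is the category of finitely presented left $R$-modules; $R\text{-}\underline{\mathrm{mod}}$ is its factor category modulo the morphisms that factor through a finitely generated projective module. The endofunctor $M\otimes_R-$ of $R\text{-mod}$ preserves finitely generated projective modules and so induces an endofunctor of $R\text{-}\underline{\mathrm{mod}}$, denoted in the same way. For a $\mathbb{Z}$-graded ring $\Gamma$, $\Gamma\text{-grmod}$ is the category of finitely presented graded left $\Gamma$-modules with degree-preserving homomorphisms, and $\Gamma\text{-}\underline{\mathrm{grmod}}$ is its factor category modulo the morphisms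 that factor through a finitely generated projective graded module. *Leavitt ring.* Let $M^*=\operatorname{Hom}_R({}_RM,{}_RR)$ with the bimodule structure $(af)(x)=f(xa)$, $(fb)(x)=f(x)b$. Choose a finite dual basis, i.e. $\alpha_j\in M$ and $\alpha_j^*\in M^*$ ($j\in J$, $J$ finite) with $x=\sum_j\alpha_j^*(x)\alpha_j$ for all $x\in M$, and let $c=\sum_j\alpha_j^*\otimes\alpha_j\in M^*\otimes_RM$; this element does not depend on the choice. The Leavitt ring is the quotient of the tensor ring $$L_R(M)=T_R(M^*\oplus M)/\bigl(x\otimes f-f(x),\ c-1\ \big|\ x\in M,\ f\in M^*\bigr),$$ which is $\mathbb{Z}$-graded by $\deg r=0$, $\deg x=-1$, $\deg f=1$ for $r\in R$, $x\in M$, $f\in M^*$. **Theorem.** There is an equivalence of categories $$E\colon\ \mathcal{S}(R\text{-mod},\,M\otimes_R-)\ \simeq\ L_R(M)\text{-grmod},$$ and it induces an equivalence $$\underline{E}\colon\ \mathcal{S}(R\text{-}\underline{\mathrm{mod}},\,M\otimes_R-)\ \simeq\ L_R(M)\text{-}\underline{\mathrm{grmod}},$$ in the sense that $\underline{E}\circ\pi\cong\pi'\circ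 E$, where $\pi\colon\mathcal{S}(R\text{-mod},M\otimes_R-)\to\mathcal{S}(R\text{-}\underline{\mathrm{mod}},M\otimes_R-)$ and $\pi'\colon L_R(M)\text{-grmod}\to L_R(M)\text{-}\underline{\mathrm{grmod}}$ are the canonical functors. -/

import Mathlib

open CategoryTheory MulOpposite
open scoped TensorProduct DirectSum

universe w₁ w₂ w₃ v u v' u'

/-! ### Stabilization of a looped category -/

section Stabilization

variable {C : Type u} [Category.{v} C]

/-- The iterates `Ω^k` of an endofunctor, with `Ω^(k+1) X = Ω (Ω^k X)`. -/
def iterFunctor (Ω : C ⥤ C) : ℕ → (C ⥤ C)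
  | 0 => 𝟭 C
  | k + 1 => iterFunctor Ω k ⋙ Ω

/-- The objects `(X, n)` of the stabilization of the looped category `(C, Ω)`. -/
structure Stabilization (Ω : C ⥤ C) where
  /-- the object `X` of `C` -/
  obj : C
  /-- the integer `n` -/
  deg : ℤ

namespace Stabilization

variable {Ω : C ⥤ C}

/-- A representative of a morphism `(X, n) ⟶ (Y, m)`: a morphism `f : Ω^(p-n) X ⟶ Ω^(p-m) Y`
for some integer `p ≥ max n m`. We record the natural numbers `a = p - n` and `b = p - m`; the
integer `p` is the common value of `n + a` and `m + b`. -/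
structure Rep (A B : Stabilization Ω) where
  a : ℕ
  b : ℕ
  deg_eq : A.deg + a = B.deg + b
  f : (iterFunctor Ω a).obj A.obj ⟶ (iterFunctor Ω b).obj B.obj

namespace Rep

variable {A B D E : Stabilization Ω}

/-- The structure map of the colimit: `f` at level `p` goes to `Ω f` at level `p + 1`. -/
def succ (r : Rep A B) : Rep A B where
  a := r.a + 1
  b := r.b + 1
  deg_eq := by have := r.deg_eq; push_cast; omega
  f := Ω.map r.f

/-- The `k`-fold structure map: `f` at level `p` goes to `Ω^k f` at level `p + k`. -/
def shift (r : Rep A B) : ℕ → Rep A B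
  | 0 => r
  | k + 1 => (r.shift k).succ

@[simp] lemma shift_a (r : Rep A B) (k : ℕ) : (r.shift k).a = r.a + k := by
  induction k with
  | zero => rfl
  | succ k ih => simp [shift, succ, ih, add_assoc]

@[simp] lemma shift_b (r : Rep A B) (k : ℕ) : (r.shift k).b = r.b + k := by
  induction k with
  | zero => rfl
  | succ k ih => simp [shift, succ, ih, add_assoc]

lemma succ_shift (r : Rep A B) (k : ℕ) : r.succ.shift k = r.shift (k + 1) := by
  induction k with
  | zero => rfl
  | succ k ih => rw [shift, ih]; rfl

/-- The composite of two representatives at the same level. -/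
def comp (r : Rep A B) (s : Rep B D) (h : r.b = s.a) : Rep A D where
  a := r.a
  b := s.b
  deg_eq := by rw [r.deg_eq, h, s.deg_eq]
  f := r.f ≫ eqToHom (by rw [h]) ≫ s.f

lemma succ_comp_succ (r : Rep A B) (s : Rep B D) (h : r.b = s.a) :
    r.succ.comp s.succ (congrArg (· + 1) h) = (r.comp s h).succ := by
  obtain ⟨a, b, h1, f⟩ := r
  obtain ⟨c, d, h2, g⟩ := s
  obtain rfl : b = c := h
  refine congrArg (Rep.mk (a + 1) (d + 1) _) ?_
  change Ω.map f ≫ 𝟙 (Ω.obj _) ≫ Ω.map g = Ω.map (f ≫ 𝟙 _ ≫ g)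
  simp

lemma comp_assoc (r : Rep A B) (s : Rep B D) (t : Rep D E) (h : r.b = s.a) (h' : s.b = t.a) :
    (r.comp s h).comp t h' = r.comp (s.comp t h') h := by
  simp [comp]

/-- The identity of `(X, n)`, at level `n`. -/
def id (A : Stabilization Ω) : Rep A A := ⟨0, 0, rfl, 𝟙 _⟩

lemma id_shift (k : ℕ) : (id A).shift k = ⟨k, k, rfl, 𝟙 _⟩ := by
  induction k with
  | zero => rfl
  | succ k ih => rw [shift, ih]; exact congrArg (Rep.mk (k + 1) (k + 1) rfl) (Ω.map_id _)

end Rep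

/-- The set of morphisms `(X, n) ⟶ (Y, m)` in the stabilization: the colimit of the sets
`C(Ω^(p-n) X, Ω^(p-m) Y)` over `p ≥ max n m` along the maps induced by `Ω`. -/
def Hom (A B : Stabilization Ω) : Type v := Quot fun r s : Rep A B => s = r.succ

namespace Hom

variable {A B D E : Stabilization Ω}

/-- The morphism `[f; p]` of the stabilization. -/
def mk (r : Rep A B) : Hom A B := Quot.mk _ r

lemma mk_succ (r : Rep A B) : mk r.succ = mk r :=
  (Quot.sound (r := fun r s : Rep A B => s = r.succ) rfl).symm

lemma mk_shift (r : Rep A B) (k : ℕ) : mk (r.shift k) = mk r := by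
  induction k with
  | zero => rfl
  | succ k ih => rw [Rep.shift, mk_succ, ih]

lemma comp_index (b c : ℕ) : b + (c - b) = c + (b - c) := by omega

/-- Composition of representatives: raise the one of lower level to the level of the other, and
compose in `C`. -/
def compRep (r : Rep A B) (s : Rep B D) : Hom A D :=
  mk ((r.shift (s.a - r.b)).comp (s.shift (r.b - s.a)) (by simp [comp_index]))

lemma compRep_eq (r : Rep A B) (s : Rep B D) (k l : ℕ) (h : (r.shift k).b = (s.shift l).a) :
    compRep r s = mk ((r.shift k).comp (s.shift l) h) := by
  have h' : r.b + k = s.a + l := by simpa using h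
  obtain ⟨j, rfl, rfl⟩ : ∃ j, k = (s.a - r.b) + j ∧ l = (r.b - s.a) + j :=
    ⟨k - (s.a - r.b), by omega, by omega⟩
  clear h'
  induction j with
  | zero => rfl
  | succ j ih =>
    have h1 : (r.shift (s.a - r.b + j)).b = (s.shift (r.b - s.a + j)).a := by
      simp; omega
    rw [ih h1, ← mk_succ, ← Rep.succ_comp_succ]
    rfl

/-- Composition in the stabilization. -/
def comp (x : Hom A B) (y : Hom B D) : Hom A D :=
  Quot.liftOn₂ x y compRep
    (by
      rintro r s _ rfl
      rw [compRep_eq r s (s.a + 1) (r.b + 1) (by simp; omega),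
        compRep_eq r s.succ (s.a + 1) r.b (by simp [Rep.succ]; omega)]
      simp only [Rep.succ_shift])
    (by
      rintro r _ s rfl
      rw [compRep_eq r s (s.a + 1) (r.b + 1) (by simp; omega),
        compRep_eq r.succ s s.a (r.b + 1) (by simp [Rep.succ]; omega)]
      simp only [Rep.succ_shift])

lemma mk_comp_mk (r : Rep A B) (s : Rep B D) (h : r.b = s.a) :
    comp (mk r) (mk s) = mk (r.comp s h) :=
  compRep_eq r s 0 0 h

end Hom

instance : Category.{v} (Stabilization Ω) where
  Hom := Hom
  id A := Hom.mk (Rep.id A)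
  comp := Hom.comp
  id_comp := by
    rintro A B ⟨r⟩
    change Hom.comp (Hom.mk _) (Hom.mk r) = Hom.mk r
    rw [← Hom.mk_shift (Rep.id A) r.a, Rep.id_shift, Hom.mk_comp_mk _ _ rfl]
    simp [Rep.comp]
  comp_id := by
    rintro A B ⟨r⟩
    change Hom.comp (Hom.mk r) (Hom.mk _) = Hom.mk r
    rw [← Hom.mk_shift (Rep.id B) r.b, Rep.id_shift, Hom.mk_comp_mk _ _ rfl]
    simp [Rep.comp]
  assoc := by
    rintro A B D E ⟨r⟩ ⟨s⟩ ⟨t⟩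
    change Hom.comp (Hom.comp (Hom.mk r) (Hom.mk s)) (Hom.mk t) =
      Hom.comp (Hom.mk r) (Hom.comp (Hom.mk s) (Hom.mk t))
    rw [← Hom.mk_shift r (s.a + t.a), ← Hom.mk_shift s (r.b + t.a),
      ← Hom.mk_shift t (r.b + s.b),
      Hom.mk_comp_mk _ _ (by simp; omega), Hom.mk_comp_mk _ _ (by simp [Rep.comp]; omega),
      Hom.mk_comp_mk _ _ (by simp; omega), Hom.mk_comp_mk _ _ (by simp [Rep.comp]; omega)]
    exact congrArg Hom.mk (Rep.comp_assoc _ _ _ _ _)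

lemma mk_comp_mk {A B D : Stabilization Ω} (r : Rep A B) (s : Rep B D) (h : r.b = s.a) :
    (show A ⟶ B from Hom.mk r) ≫ (show B ⟶ D from Hom.mk s) = Hom.mk (r.comp s h) :=
  Hom.mk_comp_mk r s h

section map

variable {D : Type u'} [Category.{v'} D] {Δ : D ⥤ D} (F : C ⥤ D) (δ : Ω ⋙ F ≅ F ⋙ Δ)

/-- The isomorphisms `F (Ω^k X) ≅ Δ^k (F X)` obtained by iterating `δ : F Ω ≅ Δ F`. -/
def iterIso : (k : ℕ) → (X : C) →
    (F.obj ((iterFunctor Ω k).obj X) ≅ (iterFunctor Δ k).obj (F.obj X))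
  | 0, _ => Iso.refl _
  | k + 1, X => δ.app ((iterFunctor Ω k).obj X) ≪≫ Δ.mapIso (iterIso k X)

/-- The action of a looped functor on representatives. -/
def Rep.map {A B : Stabilization Ω} (r : Rep A B) :
    Rep (Ω := Δ) ⟨F.obj A.obj, A.deg⟩ ⟨F.obj B.obj, B.deg⟩ where
  a := r.a
  b := r.b
  deg_eq := r.deg_eq
  f := (iterIso F δ r.a A.obj).inv ≫ F.map r.f ≫ (iterIso F δ r.b B.obj).hom

lemma Rep.map_succ {A B : Stabilization Ω} (r : Rep A B) :
    r.succ.map F δ = (r.map F δ).succ := by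
  have h := δ.hom.naturality r.f
  simp only [Functor.comp_map] at h
  refine congrArg (Rep.mk (r.a + 1) (r.b + 1) _) ?_
  change (δ.app _ ≪≫ Δ.mapIso (iterIso F δ r.a A.obj)).inv ≫ F.map (Ω.map r.f) ≫
    (δ.app _ ≪≫ Δ.mapIso (iterIso F δ r.b B.obj)).hom = Δ.map (_ ≫ _ ≫ _)
  simp [reassoc_of% h]

lemma Rep.map_shift {A B : Stabilization Ω} (r : Rep A B) (k : ℕ) :
    (r.shift k).map F δ = (r.map F δ).shift k := by
  induction k with
  | zero => rfl
  | succ k ih => rw [Rep.shift, Rep.map_succ, ih]; rfl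

lemma Rep.map_comp {A B E : Stabilization Ω} (r : Rep A B) (s : Rep B E) (h : r.b = s.a) :
    (r.comp s h).map F δ = (r.map F δ).comp (s.map F δ) h := by
  obtain ⟨a, b, h1, f⟩ := r
  obtain ⟨c, d, h2, g⟩ := s
  obtain rfl : b = c := h
  simp [Rep.comp, Rep.map]

/-- The functor between stabilizations induced by a looped functor `(F, δ)`; it sends `(X, n)` to
`(F X, n)` and `[f; p]` to `[F f; p]`, up to the identifications given by `δ`. -/
def mapFunctor : Stabilization Ω ⥤ Stabilization Δ where
  obj A := ⟨F.obj A.obj, A.deg⟩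
  map x := Quot.liftOn x (fun r => Hom.mk (r.map F δ)) (by
    rintro r _ rfl
    rw [Rep.map_succ, Hom.mk_succ])
  map_id A := congrArg Hom.mk (by simp [Rep.map, Rep.id, iterIso, iterFunctor])
  map_comp := by
    rintro A B E ⟨r⟩ ⟨s⟩
    have h : (r.shift s.a).b = (s.shift r.b).a := by simp [add_comm]
    change Quot.liftOn (Hom.comp (Hom.mk r) (Hom.mk s)) _ _ =
      Hom.comp (Hom.mk (r.map F δ)) (Hom.mk (s.map F δ))
    rw [← Hom.mk_shift r s.a, ← Hom.mk_shift s r.b, Hom.mk_comp_mk _ _ h,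
      ← Hom.mk_shift (r.map F δ) s.a, ← Hom.mk_shift (s.map F δ) r.b, ← Rep.map_shift,
      ← Rep.map_shift,
      Hom.mk_comp_mk ((r.shift s.a).map F δ) ((s.shift r.b).map F δ) h, ← Rep.map_comp]
    rfl

end map

end Stabilization
end Stabilization

/-! ### The tensor functor of a bimodule -/
section Tensor

variable (R : Type u) [Ring R] (M : Type u) [AddCommGroup M] [Module R M] [Module Rᵐᵒᵖ M]

/-- The subgroup of `M ⊗_ℤ X` generated by the elements `m r ⊗ x - m ⊗ r x`. It is stable under the
left action of `R` when `M` is a bimodule, so that it may be described as the `R`-submodule they generate. -/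
def balancedSubmodule (X : Type w₁) [AddCommGroup X] [Module R X] : Submodule R (M ⊗[ℤ] X) :=
  Submodule.span R {t | ∃ (m : M) (r : R) (x : X), t = (op r • m) ⊗ₜ[ℤ] x - m ⊗ₜ[ℤ] (r • x)}

/-- The tensor product `M ⊗_R X` of an `R`-`R`-bimodule `M` and a left `R`-module `X`, as a left
`R`-module. -/
abbrev BimoduleTensor (X : Type w₁) [AddCommGroup X] [Module R X] : Type (max u w₁) :=
  (M ⊗[ℤ] X) ⧸ balancedSubmodule R M X

namespace BimoduleTensor

variable {X : Type w₁} {Y : Type w₂} {Z : Type w₃} [AddCommGroup X] [Module R X] [AddCommGroup Y] [Module R Y]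
  [AddCommGroup Z] [Module R Z]

variable {M} in
/-- The tensor `m ⊗ x` in `M ⊗_R X`. -/
def tmul (m : M) (x : X) : BimoduleTensor R M X := (balancedSubmodule R M X).mkQ (m ⊗ₜ[ℤ] x)

/-- The map `M ⊗_R g`. -/
def map (g : X →ₗ[R] Y) : BimoduleTensor R M X →ₗ[R] BimoduleTensor R M Y :=
  Submodule.mapQ _ _
    (TensorProduct.AlgebraTensorModule.map (LinearMap.id : M →ₗ[R] M) (g.restrictScalars ℤ)) (by
      rw [balancedSubmodule, Submodule.span_le]
      rintro _ ⟨m, r, x, rfl⟩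
      exact Submodule.subset_span ⟨m, r, g x, by simp⟩)

variable {R M}

@[simp] lemma map_tmul (g : X →ₗ[R] Y) (m : M) (x : X) :
    map R M g (tmul R m x) = tmul R m (g x) := rfl

lemma smul_tmul (r : R) (m : M) (x : X) : r • tmul R m x = tmul R (r • m) x := rfl

lemma add_tmul (m m' : M) (x : X) : tmul R (m + m') x = tmul R m x + tmul R m' x := by
  simp [tmul, TensorProduct.add_tmul]

lemma tmul_add (m : M) (x x' : X) : tmul R m (x + x') = tmul R m x + tmul R m x' := by
  simp [tmul, TensorProduct.tmul_add]

lemma tmul_zero (m : M) : tmul R m (0 : X) = 0 := by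
  simp [tmul]

lemma tmul_smul (m : M) (r : R) (x : X) : tmul R m (r • x) = tmul R (op r • m) x := by
  refine ((Submodule.Quotient.eq _).2 ?_).symm
  exact Submodule.subset_span ⟨m, r, x, rfl⟩

lemma tmul_sum {ι : Type*} (s : Finset ι) (m : M) (x : ι → X) :
    tmul R m (∑ i ∈ s, x i) = ∑ i ∈ s, tmul R m (x i) := by
  simp [tmul, TensorProduct.tmul_sum]

lemma induction {p : BimoduleTensor R M X → Prop} (h0 : p 0) (ht : ∀ m x, p (tmul R m x))
    (ha : ∀ s t, p s → p t → p (s + t)) (t : BimoduleTensor R M X) : p t := by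
  obtain ⟨t, rfl⟩ := Submodule.mkQ_surjective _ t
  induction t using TensorProduct.induction_on with
  | zero => simpa using h0
  | tmul m x => exact ht m x
  | add s t hs ht => rw [_root_.map_add]; exact ha _ _ hs ht

lemma hom_ext {N : Type*} [AddCommGroup N] [Module R N] {f g : BimoduleTensor R M X →ₗ[R] N}
    (h : ∀ m x, f (tmul R m x) = g (tmul R m x)) : f = g := by
  refine LinearMap.ext fun t => ?_
  induction t using induction with
  | h0 => simp
  | ht m x => exact h m x
  | ha s t hs ht => rw [_root_.map_add, _root_.map_add, hs, ht]

lemma map_id : map R M (LinearMap.id : X →ₗ[R] X) = LinearMap.id := hom_ext fun _ _ => rfl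

lemma map_comp (g : Y →ₗ[R] Z) (f : X →ₗ[R] Y) :
    map R M (g ∘ₗ f) = map R M g ∘ₗ map R M f := hom_ext fun _ _ => rfl

lemma map_add (g f : X →ₗ[R] Y) : map R M (g + f) = map R M g + map R M f :=
  hom_ext fun m x => tmul_add m (g x) (f x)

/-- A biadditive balanced map which is `R`-linear in the first variable induces an `R`-linear map
on the tensor product. -/
def lift {N : Type*} [AddCommGroup N] [Module R N] (φ : M →ₗ[R] (X →+ N))
    (hφ : ∀ m (r : R) x, φ (op r • m) x = φ m (r • x)) : BimoduleTensor R M X →ₗ[R] N :=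
  Submodule.liftQ _ (TensorProduct.AlgebraTensorModule.lift (R := ℤ) (A := R)
      { toFun := fun m => (φ m).toIntLinearMap
        map_add' := fun m m' => by ext x; simp
        map_smul' := fun r m => by ext x; simp }) (by
    rw [balancedSubmodule, Submodule.span_le]
    rintro _ ⟨m, r, x, rfl⟩
    simp [hφ])

@[simp] lemma lift_tmul {N : Type*} [AddCommGroup N] [Module R N] (φ : M →ₗ[R] (X →+ N))
    (hφ : ∀ m (r : R) x, φ (op r • m) x = φ m (r • x)) (m : M) (x : X) :
    lift φ hφ (tmul R m x) = φ m x := rfl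

lemma map_surjective {f : X →ₗ[R] Y} (hf : Function.Surjective f) :
    Function.Surjective (map R M f) := by
  intro t
  induction t using induction with
  | h0 => exact ⟨0, _root_.map_zero _⟩
  | ht m y =>
    obtain ⟨x, rfl⟩ := hf y
    exact ⟨tmul R m x, rfl⟩
  | ha s t hs ht =>
    obtain ⟨s, rfl⟩ := hs
    obtain ⟨t, rfl⟩ := ht
    exact ⟨s + t, _root_.map_add _ _ _⟩

/-- Right exactness of the tensor product. -/
lemma ker_map_le_range {g : X →ₗ[R] Y} {f : Y →ₗ[R] Z} (hf : Function.Surjective f)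
    (hgf : Function.Exact g f) : LinearMap.ker (map R M f) ≤ LinearMap.range (map R M g) := by
  have key : ∀ (m : M) (y y' : Y), f y = f y' →
      (LinearMap.range (map R M g)).mkQ (tmul R m y) =
        (LinearMap.range (map R M g)).mkQ (tmul R m y') := by
    intro m y y' h
    obtain ⟨x, hx⟩ := (hgf (y - y')).1 (by rw [_root_.map_sub, h, sub_self])
    refine (Submodule.Quotient.eq _).2 ⟨tmul R m x, ?_⟩
    rw [map_tmul, hx, eq_sub_iff_add_eq, ← tmul_add, sub_add_cancel]
  let σ := Function.surjInv hf
  have hσ : ∀ z, f (σ z) = z := Function.surjInv_eq hf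
  let h : BimoduleTensor R M Z →ₗ[R] (BimoduleTensor R M Y ⧸ LinearMap.range (map R M g)) :=
    lift
      { toFun := fun m => AddMonoidHom.mk'
          (fun z => (LinearMap.range (map R M g)).mkQ (tmul R m (σ z))) (fun z z' => by
            rw [← _root_.map_add, ← tmul_add]
            exact key _ _ _ (by simp [hσ]))
        map_add' := fun m m' => by
          ext z
          simp only [AddMonoidHom.mk'_apply, AddMonoidHom.add_apply, add_tmul, _root_.map_add]
        map_smul' := fun r m => by
          ext z
          exact _root_.map_smul (LinearMap.range (map R M g)).mkQ r (tmul R m (σ z)) }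
      (fun m r z => by
        change (LinearMap.range (map R M g)).mkQ (tmul R (op r • m) (σ z)) =
          (LinearMap.range (map R M g)).mkQ (tmul R m (σ (r • z)))
        rw [← tmul_smul]
        exact key _ _ _ (by simp [hσ]))
  have hh : h ∘ₗ map R M f = (LinearMap.range (map R M g)).mkQ :=
    hom_ext fun m y => key _ _ _ (hσ _)
  intro t ht
  have := LinearMap.congr_fun hh t
  rw [LinearMap.comp_apply, LinearMap.mem_ker.1 ht, _root_.map_zero] at this
  exact (Submodule.Quotient.mk_eq_zero _).1 this.symm

section Bimodule

variable [SMulCommClass R Rᵐᵒᵖ M]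

/-- `M ⊗_R R^n` is `M^n`. -/
def piEquiv (n : ℕ) : BimoduleTensor R M (Fin n → R) ≃ₗ[R] (Fin n → M) :=
  LinearEquiv.ofLinearMap
    (lift
      { toFun := fun m =>
          { toFun := fun v i => op (v i) • m
            map_zero' := by ext i; simp
            map_add' := fun v w => by ext i; simp [add_smul] }
        map_add' := fun m m' => by ext v i; simp
        map_smul' := fun r m => by ext v i; simp [smul_comm r] }
      (fun m r v => by ext i; simp [mul_smul]))
    { toFun := fun y => ∑ i, tmul R (y i) (Pi.single i 1)
      map_add' := fun y z => by simp [add_tmul, Finset.sum_add_distrib]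
      map_smul' := fun r y => by simp [Finset.smul_sum, smul_tmul] }
    (by
      refine LinearMap.ext fun y => funext fun i => ?_
      simp [map_sum, Finset.sum_apply, Pi.single_apply, apply_ite op, ite_smul])
    (hom_ext fun m v => by
      simp only [LinearMap.comp_apply, lift_tmul, LinearMap.id_apply]
      change ∑ i, tmul R (op (v i) • m) (Pi.single i (1 : R)) = tmul R m v
      simp only [← tmul_smul, ← tmul_sum]
      congr 1
      ext j
      simp [Finset.sum_apply, Pi.single_apply])

lemma projective [Module.Projective R M] [Module.Finite R X] [Module.Projective R X] :
    Module.Projective R (BimoduleTensor R M X) := by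
  obtain ⟨n, f, g, -, -, hfg⟩ := Module.Finite.exists_comp_eq_id_of_projective R X
  have : Module.Projective R (BimoduleTensor R M (Fin n → R)) :=
    .of_equiv ((DFinsupp.linearEquivFunOnFintype (R := R) (M := fun _ : Fin n => M)).trans
      (piEquiv n).symm)
  refine Module.Projective.of_split (map R M g) (map R M f) ?_
  rw [← map_comp, hfg, map_id]

variable [Module.Finite R M] [Module.Projective R M]

instance finitePresentation [Module.FinitePresentation R X] :
    Module.FinitePresentation R (BimoduleTensor R M X) := by
  obtain ⟨n, m, f, g, hf, hgf⟩ := Module.FinitePresentation.exists_fin' R X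
  have : Module.FinitePresentation R M := Module.finitePresentation_of_projective R M
  have : Module.FinitePresentation R (BimoduleTensor R M (Fin n → R)) :=
    .of_equiv (piEquiv n).symm
  have : Module.Finite R (BimoduleTensor R M (Fin m → R)) := .equiv (piEquiv m).symm
  refine Module.finitePresentation_of_surjective (map R M f) (map_surjective hf) ?_
  have : LinearMap.ker (map R M f) = LinearMap.range (map R M g) := by
    refine le_antisymm (ker_map_le_range hf hgf) ?_
    rintro _ ⟨t, rfl⟩
    rw [LinearMap.mem_ker, ← LinearMap.comp_apply, ← map_comp, hgf.linearMap_comp_eq_zero]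
    induction t using induction with
    | h0 => simp
    | ht m x => exact (map_tmul _ _ _).trans (tmul_zero m)
    | ha s t hs ht => rw [_root_.map_add, hs, ht, add_zero]
  rw [this]
  exact Module.Finite.iff_fg.1 inferInstance

end Bimodule

end BimoduleTensor
end Tensor

/-! ### Tensor rings and Leavitt rings -/
section Leavitt

/-- The relations which define the tensor ring `T_R(N)` on the generators `r ∈ R` and `y ∈ N`: the
generators `r` multiply and add up as in `R`, and the generators `y` form an `R`-`R`-bimodule
as in `N`. -/
inductive TensorRing.Rel (R : Type u) [Ring R] (N : Type u) [AddCommGroup N] [Module R N]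
    [Module Rᵐᵒᵖ N] : FreeAlgebra ℤ (R ⊕ N) → FreeAlgebra ℤ (R ⊕ N) → Prop
  | one : Rel R N (FreeAlgebra.ι ℤ (Sum.inl 1)) 1
  | mul (r s : R) : Rel R N (FreeAlgebra.ι ℤ (Sum.inl (r * s)))
      (FreeAlgebra.ι ℤ (Sum.inl r) * FreeAlgebra.ι ℤ (Sum.inl s))
  | add (r s : R) : Rel R N (FreeAlgebra.ι ℤ (Sum.inl (r + s)))
      (FreeAlgebra.ι ℤ (Sum.inl r) + FreeAlgebra.ι ℤ (Sum.inl s))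
  | add_vec (y z : N) : Rel R N (FreeAlgebra.ι ℤ (Sum.inr (y + z)))
      (FreeAlgebra.ι ℤ (Sum.inr y) + FreeAlgebra.ι ℤ (Sum.inr z))
  | left (r : R) (y : N) : Rel R N (FreeAlgebra.ι ℤ (Sum.inr (r • y)))
      (FreeAlgebra.ι ℤ (Sum.inl r) * FreeAlgebra.ι ℤ (Sum.inr y))
  | right (r : R) (y : N) : Rel R N (FreeAlgebra.ι ℤ (Sum.inr (op r • y)))
      (FreeAlgebra.ι ℤ (Sum.inr y) * FreeAlgebra.ι ℤ (Sum.inl r))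

/-- The tensor ring `T_R(N)` of an `R`-`R`-bimodule `N`, that is, the ring freely generated by
the ring `R` and the `R`-`R`-bimodule `N`. -/
def TensorRing (R : Type u) [Ring R] (N : Type u) [AddCommGroup N] [Module R N]
    [Module Rᵐᵒᵖ N] : Type u :=
  RingQuot (TensorRing.Rel R N)

namespace TensorRing

variable (R : Type u) [Ring R] (N : Type u) [AddCommGroup N] [Module R N] [Module Rᵐᵒᵖ N]

instance : Ring (TensorRing R N) := inferInstanceAs (Ring (RingQuot (TensorRing.Rel R N)))

/-- The quotient map from the free ring on `R` and `N`. -/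
def proj : FreeAlgebra ℤ (R ⊕ N) →+* TensorRing R N := RingQuot.mkRingHom _

lemma proj_eq {a b : FreeAlgebra ℤ (R ⊕ N)} (h : Rel R N a b) : proj R N a = proj R N b :=
  RingQuot.mkRingHom_rel h

/-- The ring homomorphism `R → T_R(N)`. -/
def of : R →+* TensorRing R N where
  toFun r := proj R N (FreeAlgebra.ι ℤ (Sum.inl r))
  map_one' := by rw [proj_eq R N .one, map_one]
  map_mul' r s := by rw [proj_eq R N (.mul r s), map_mul]
  map_add' r s := by rw [proj_eq R N (.add r s), map_add]
  map_zero' := by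
    have h := proj_eq R N (.add 0 0)
    rw [add_zero, map_add] at h
    exact left_eq_add.1 h

/-- The additive map `N → T_R(N)`. -/
def ι : N →+ TensorRing R N :=
  AddMonoidHom.mk' (fun y => proj R N (FreeAlgebra.ι ℤ (Sum.inr y)))
    (fun y z => by rw [proj_eq R N (.add_vec y z), map_add])

variable {R N}

lemma ι_smul (r : R) (y : N) : ι R N (r • y) = of R N r * ι R N y :=
  (proj_eq R N (.left r y)).trans (map_mul _ _ _)

lemma ι_op_smul (r : R) (y : N) : ι R N (op r • y) = ι R N y * of R N r :=
  (proj_eq R N (.right r y)).trans (map_mul _ _ _)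

/-- The universal property of the tensor ring: existence. -/
def lift {S : Type*} [Ring S] (φ : R →+* S) (ψ : N →+ S) (h₁ : ∀ r y, ψ (r • y) = φ r * ψ y)
    (h₂ : ∀ (r : R) y, ψ (op r • y) = ψ y * φ r) : TensorRing R N →+* S :=
  RingQuot.lift ⟨(FreeAlgebra.lift ℤ (Sum.elim φ ψ)).toRingHom, by
    rintro _ _ (_ | _ | _ | _ | _ | _) <;> simp [h₁, h₂]⟩

@[simp] lemma lift_of {S : Type*} [Ring S] (φ : R →+* S) (ψ : N →+ S)
    (h₁ : ∀ r y, ψ (r • y) = φ r * ψ y) (h₂ : ∀ (r : R) y, ψ (op r • y) = ψ y * φ r) (r : R) :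
    lift φ ψ h₁ h₂ (of R N r) = φ r :=
  (RingQuot.lift_mkRingHom_apply _ _ _).trans (by simp)

@[simp] lemma lift_ι {S : Type*} [Ring S] (φ : R →+* S) (ψ : N →+ S)
    (h₁ : ∀ r y, ψ (r • y) = φ r * ψ y) (h₂ : ∀ (r : R) y, ψ (op r • y) = ψ y * φ r) (y : N) :
    lift φ ψ h₁ h₂ (ι R N y) = ψ y :=
  (RingQuot.lift_mkRingHom_apply _ _ _).trans (by simp)

/-- The universal property of the tensor ring: uniqueness. -/
lemma hom_ext {S : Type*} [Ring S] {f g : TensorRing R N →+* S}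
    (h₁ : ∀ r, f (of R N r) = g (of R N r)) (h₂ : ∀ y, f (ι R N y) = g (ι R N y)) : f = g := by
  refine RingQuot.ringQuot_ext f g ?_
  have : (f.comp (proj R N)).toIntAlgHom = (g.comp (proj R N)).toIntAlgHom := by
    refine FreeAlgebra.hom_ext ?_
    ext (r | y)
    · exact h₁ r
    · exact h₂ y
  exact congrArg AlgHom.toRingHom this

end TensorRing

variable (R : Type u) [Ring R] (M : Type u) [AddCommGroup M] [Module R M]

/-- The left-dual bimodule `M^* = Hom_R(M, R)` of left `R`-linear maps. -/
def LeftDual : Type u := M →ₗ[R] R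

namespace LeftDual

instance : AddCommGroup (LeftDual R M) := inferInstanceAs (AddCommGroup (M →ₗ[R] R))

instance : FunLike (LeftDual R M) M R := inferInstanceAs (FunLike (M →ₗ[R] R) M R)

instance : LinearMapClass (LeftDual R M) R M R :=
  inferInstanceAs (LinearMapClass (M →ₗ[R] R) R M R)

variable {R M}

@[ext] lemma ext {f g : LeftDual R M} (h : ∀ x, f x = g x) : f = g := LinearMap.ext h

@[simp] lemma add_apply (f g : LeftDual R M) (x : M) : (f + g) x = f x + g x := rfl

@[simp] lemma zero_apply (x : M) : (0 : LeftDual R M) x = 0 := rfl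

/-- The right action of `R` on `M^*`: `(f b) x = (f x) b`. -/
instance : Module Rᵐᵒᵖ (LeftDual R M) where
  smul b f :=
    ({ toFun := fun x => f x * unop b
       map_add' := fun x y => by rw [map_add, add_mul]
       map_smul' := fun r x => by simp [mul_assoc] } : M →ₗ[R] R)
  one_smul f := ext fun x => mul_one (f x)
  mul_smul b c f := ext fun x => (mul_assoc (f x) _ _).symm
  smul_zero b := ext fun x => zero_mul _
  smul_add b f g := ext fun x => add_mul _ _ _
  add_smul b c f := ext fun x => mul_add _ _ _
  zero_smul f := ext fun x => mul_zero _

@[simp] lemma op_smul_apply (b : Rᵐᵒᵖ) (f : LeftDual R M) (x : M) : (b • f) x = f x * unop b := rfl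

variable [Module Rᵐᵒᵖ M] [SMulCommClass R Rᵐᵒᵖ M]

/-- The left action of `R` on `M^*`: `(a f) x = f (x a)`. -/
instance : Module R (LeftDual R M) where
  smul a f :=
    ({ toFun := fun x => f (op a • x)
       map_add' := fun x y => by rw [smul_add, map_add]
       map_smul' := fun r x => by rw [← smul_comm r, map_smul]; rfl } : M →ₗ[R] R)
  one_smul f := ext fun x => congrArg f (one_smul _ x)
  mul_smul a b f := ext fun x => congrArg f (mul_smul (op b) (op a) x)
  smul_zero a := ext fun x => rfl
  smul_add a f g := ext fun x => rfl
  add_smul a b f := ext fun x => (congrArg f (add_smul (op a) (op b) x)).trans (map_add f _ _)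
  zero_smul f := ext fun x => (congrArg f (zero_smul _ x)).trans (map_zero f)

@[simp] lemma smul_apply (a : R) (f : LeftDual R M) (x : M) : (a • f) x = f (op a • x) := rfl

instance : SMulCommClass R Rᵐᵒᵖ (LeftDual R M) where
  smul_comm _ _ _ := rfl

end LeftDual

variable [Module Rᵐᵒᵖ M] [SMulCommClass R Rᵐᵒᵖ M]

/-- The generators of the ideal which defines the Leavitt ring: `x ⊗ f - f x` for `x ∈ M` and
`f ∈ M^*`, and `c - 1`, where `c = ∑ j, α_j^* ⊗ α_j` is the Casimir element of a (any) finite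
dual basis of the left module `M`. -/
inductive LeavittRing.Rel :
    TensorRing R (LeftDual R M × M) → TensorRing R (LeftDual R M × M) → Prop
  | eval (x : M) (f : LeftDual R M) :
      Rel (TensorRing.ι R _ (0, x) * TensorRing.ι R _ (f, 0)) (TensorRing.of R _ (f x))
  | casimir (n : ℕ) (α : Fin n → M) (α' : Fin n → LeftDual R M)
      (h : ∀ x : M, ∑ j, α' j x • α j = x) :
      Rel (∑ j, TensorRing.ι R _ (α' j, 0) * TensorRing.ι R _ (0, α j)) 1

/-- The Leavitt ring `L_R(M) = T_R(M^* ⊕ M) / (x ⊗ f - f x, c - 1)`. -/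
def LeavittRing : Type u := RingQuot (LeavittRing.Rel R M)

namespace LeavittRing

instance : Ring (LeavittRing R M) := inferInstanceAs (Ring (RingQuot (LeavittRing.Rel R M)))

/-- The quotient map from the tensor ring. -/
def proj : TensorRing R (LeftDual R M × M) →+* LeavittRing R M := RingQuot.mkRingHom _

/-- The ring homomorphism `R → L_R(M)`. -/
def of : R →+* LeavittRing R M := (proj R M).comp (TensorRing.of R _)

/-- The map `M → L_R(M)`. -/
def ofVec : M →+ LeavittRing R M :=
  ((proj R M).toAddMonoidHom.comp (TensorRing.ι R _)).comp (AddMonoidHom.inr _ _)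

/-- The map `M^* → L_R(M)`. -/
def ofDual : LeftDual R M →+ LeavittRing R M :=
  ((proj R M).toAddMonoidHom.comp (TensorRing.ι R _)).comp (AddMonoidHom.inl _ _)

variable {R M}

lemma ofVec_smul (r : R) (x : M) : ofVec R M (r • x) = of R M r * ofVec R M x := by
  have h := congrArg (proj R M) (TensorRing.ι_smul r ((0, x) : LeftDual R M × M))
  rwa [map_mul, Prod.smul_mk, smul_zero] at h

lemma ofVec_op_smul (r : R) (x : M) : ofVec R M (op r • x) = ofVec R M x * of R M r := by
  have h := congrArg (proj R M) (TensorRing.ι_op_smul r ((0, x) : LeftDual R M × M))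
  rwa [map_mul, Prod.smul_mk, smul_zero] at h

lemma ofDual_smul (r : R) (f : LeftDual R M) :
    ofDual R M (r • f) = of R M r * ofDual R M f := by
  have h := congrArg (proj R M) (TensorRing.ι_smul r ((f, 0) : LeftDual R M × M))
  rwa [map_mul, Prod.smul_mk, smul_zero] at h

lemma ofDual_op_smul (r : R) (f : LeftDual R M) :
    ofDual R M (op r • f) = ofDual R M f * of R M r := by
  have h := congrArg (proj R M) (TensorRing.ι_op_smul r ((f, 0) : LeftDual R M × M))
  rwa [map_mul, Prod.smul_mk, smul_zero] at h

lemma ofVec_mul_ofDual (x : M) (f : LeftDual R M) :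
    ofVec R M x * ofDual R M f = of R M (f x) := by
  have h := RingQuot.mkRingHom_rel (LeavittRing.Rel.eval x f)
  rwa [map_mul] at h

lemma sum_ofDual_mul_ofVec {n : ℕ} (α : Fin n → M) (α' : Fin n → LeftDual R M)
    (h : ∀ x : M, ∑ j, α' j x • α j = x) : ∑ j, ofDual R M (α' j) * ofVec R M (α j) = 1 := by
  have h : proj R M _ = proj R M _ := RingQuot.mkRingHom_rel (LeavittRing.Rel.casimir n α α' h)
  rw [map_sum, map_one] at h
  rw [← h]
  exact Finset.sum_congr rfl fun j _ => (map_mul (proj R M) _ _).symm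

/-- The universal property of the Leavitt ring: existence. -/
def lift {S : Type*} [Ring S] (φ : R →+* S) (ψ : M →+ S) (χ : LeftDual R M →+ S)
    (h₁ : ∀ r x, ψ (r • x) = φ r * ψ x) (h₂ : ∀ (r : R) x, ψ (op r • x) = ψ x * φ r)
    (h₃ : ∀ (r : R) f, χ (r • f) = φ r * χ f) (h₄ : ∀ (r : R) f, χ (op r • f) = χ f * φ r)
    (h₅ : ∀ x f, ψ x * χ f = φ (f x))
    (h₆ : ∀ (n : ℕ) (α : Fin n → M) (α' : Fin n → LeftDual R M),
      (∀ x : M, ∑ j, α' j x • α j = x) → ∑ j, χ (α' j) * ψ (α j) = 1) : LeavittRing R M →+* S :=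
  RingQuot.lift ⟨TensorRing.lift φ (χ.coprod ψ) (by simp [h₁, h₃, mul_add])
    (by simp [h₂, h₄, add_mul]), by
      rintro _ _ (⟨x, f⟩ | ⟨n, α, α', h⟩)
      · simp [h₅]
      · simp [map_sum, h₆ n α α' h]⟩

section lift

variable {S : Type*} [Ring S] (φ : R →+* S) (ψ : M →+ S) (χ : LeftDual R M →+ S)
    (h₁ : ∀ r x, ψ (r • x) = φ r * ψ x) (h₂ : ∀ (r : R) x, ψ (op r • x) = ψ x * φ r)
    (h₃ : ∀ (r : R) f, χ (r • f) = φ r * χ f) (h₄ : ∀ (r : R) f, χ (op r • f) = χ f * φ r)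
    (h₅ : ∀ x f, ψ x * χ f = φ (f x))
    (h₆ : ∀ (n : ℕ) (α : Fin n → M) (α' : Fin n → LeftDual R M),
      (∀ x : M, ∑ j, α' j x • α j = x) → ∑ j, χ (α' j) * ψ (α j) = 1)

@[simp] lemma lift_of (r : R) : lift φ ψ χ h₁ h₂ h₃ h₄ h₅ h₆ (of R M r) = φ r :=
  (RingQuot.lift_mkRingHom_apply _ _ _).trans (by simp)

@[simp] lemma lift_ofVec (x : M) : lift φ ψ χ h₁ h₂ h₃ h₄ h₅ h₆ (ofVec R M x) = ψ x :=
  (RingQuot.lift_mkRingHom_apply _ _ _).trans (by simp)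

@[simp] lemma lift_ofDual (f : LeftDual R M) :
    lift φ ψ χ h₁ h₂ h₃ h₄ h₅ h₆ (ofDual R M f) = χ f :=
  (RingQuot.lift_mkRingHom_apply _ _ _).trans (by simp)

end lift

/-- The universal property of the Leavitt ring: uniqueness. -/
lemma hom_ext {S : Type*} [Ring S] {f g : LeavittRing R M →+* S}
    (h₁ : ∀ r, f (of R M r) = g (of R M r)) (h₂ : ∀ x, f (ofVec R M x) = g (ofVec R M x))
    (h₃ : ∀ x, f (ofDual R M x) = g (ofDual R M x)) : f = g := by
  refine RingQuot.ringQuot_ext f g (TensorRing.hom_ext h₁ ?_)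
  rintro ⟨y, x⟩
  have : ((y, x) : LeftDual R M × M) = (y, 0) + (0, x) := by simp
  rw [this, map_add, map_add, map_add]
  exact congrArg₂ (· + ·) (h₃ y) (h₂ x)

variable (R M)

/-- Products of generators, with their degrees: elements of `R` have degree `0`, elements of `M`
degree `-1`, and elements of `M^*` degree `1`. -/
inductive IsMonomial : ℤ → LeavittRing R M → Prop
  | of (r : R) : IsMonomial 0 (of R M r)
  | ofVec (x : M) : IsMonomial (-1) (ofVec R M x)
  | ofDual (f : LeftDual R M) : IsMonomial 1 (ofDual R M f)
  | mul {i j : ℤ} {a b : LeavittRing R M} (ha : IsMonomial i a) (hb : IsMonomial j b) :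
      IsMonomial (i + j) (a * b)

/-- The homogeneous component of degree `i` of the Leavitt ring. -/
def component (i : ℤ) : AddSubgroup (LeavittRing R M) :=
  AddSubgroup.closure {a | IsMonomial R M i a}

variable {R M}

lemma IsMonomial.mem {i : ℤ} {a : LeavittRing R M} (h : IsMonomial R M i a) :
    a ∈ component R M i :=
  AddSubgroup.subset_closure h

instance : SetLike.GradedMonoid (component R M) where
  one_mem := by
    rw [← map_one (of R M)]
    exact (IsMonomial.of 1).mem
  mul_mem i j a b ha hb := by
    induction ha using AddSubgroup.closure_induction with
    | zero => rw [zero_mul]; exact zero_mem _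
    | add x y _ _ hx hy => rw [add_mul]; exact add_mem hx hy
    | neg x _ hx => rw [neg_mul]; exact neg_mem hx
    | mem a ha =>
      induction hb using AddSubgroup.closure_induction with
      | zero => rw [mul_zero]; exact zero_mem _
      | add x y _ _ hx hy => rw [mul_add]; exact add_mem hx hy
      | neg x _ hx => rw [mul_neg]; exact neg_mem hx
      | mem b hb => exact (IsMonomial.mul ha hb).mem

lemma of_congr {i j : ℤ} (h : i = j) {a b : LeavittRing R M} (hab : a = b)
    (ha : a ∈ component R M i) (hb : b ∈ component R M j) :
    DirectSum.of (fun i => component R M i) i ⟨a, ha⟩ =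
      DirectSum.of (fun i => component R M i) j ⟨b, hb⟩ := by
  subst h hab
  rfl

variable (R M)

/-- The decomposition of the elements of the Leavitt ring into homogeneous components. -/
def decomposeHom : LeavittRing R M →+* ⨁ i, component R M i :=
  lift
    { toFun := fun r => DirectSum.of (fun i => component R M i) 0 ⟨of R M r, (IsMonomial.of r).mem⟩
      map_one' := of_congr rfl (map_one _) _ _
      map_mul' := fun r s => by
        rw [DirectSum.of_mul_of]
        exact of_congr (zero_add _).symm (map_mul _ _ _) _ _
      map_zero' := by
        rw [← map_zero (DirectSum.of (fun i => component R M i) 0)]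
        exact of_congr rfl (map_zero _) _ _
      map_add' := fun r s => by
        rw [← map_add]
        exact of_congr rfl (map_add _ _ _) _ _ }
    (AddMonoidHom.mk' (fun x => DirectSum.of (fun i => component R M i) (-1)
        ⟨ofVec R M x, (IsMonomial.ofVec x).mem⟩) (fun x y => by
      rw [← map_add]
      exact of_congr rfl (map_add _ _ _) _ _))
    (AddMonoidHom.mk' (fun x => DirectSum.of (fun i => component R M i) 1
        ⟨ofDual R M x, (IsMonomial.ofDual x).mem⟩) (fun x y => by
      rw [← map_add]
      exact of_congr rfl (map_add _ _ _) _ _))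
    (fun r x => by
      refine Eq.trans ?_ (DirectSum.of_mul_of _ _).symm
      exact of_congr rfl (ofVec_smul r x) _ _)
    (fun r x => by
      refine Eq.trans ?_ (DirectSum.of_mul_of _ _).symm
      exact of_congr rfl (ofVec_op_smul r x) _ _)
    (fun r x => by
      refine Eq.trans ?_ (DirectSum.of_mul_of _ _).symm
      exact of_congr rfl (ofDual_smul r x) _ _)
    (fun r x => by
      refine Eq.trans ?_ (DirectSum.of_mul_of _ _).symm
      exact of_congr rfl (ofDual_op_smul r x) _ _)
    (fun x f => by
      refine (DirectSum.of_mul_of _ _).trans ?_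
      exact of_congr rfl (ofVec_mul_ofDual x f) _ _)
    (fun n α α' h => by
      have : ∀ j, (DirectSum.of (fun i => component R M i) 1
            ⟨ofDual R M (α' j), (IsMonomial.ofDual (α' j)).mem⟩) *
          (DirectSum.of (fun i => component R M i) (-1)
            ⟨ofVec R M (α j), (IsMonomial.ofVec (α j)).mem⟩) =
          DirectSum.of (fun i => component R M i) 0 ⟨ofDual R M (α' j) * ofVec R M (α j),
            (IsMonomial.mul (.ofDual _) (.ofVec _)).mem⟩ := fun j =>
        (DirectSum.of_mul_of _ _).trans (of_congr rfl rfl _ _)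
      refine (Finset.sum_congr rfl fun j _ => this j).trans ?_
      rw [← map_sum]
      refine congrArg (DirectSum.of (fun i => component R M i) 0)
        (a₂ := ⟨1, SetLike.GradedOne.one_mem⟩) (Subtype.ext ?_)
      rw [AddSubgroup.val_finsetSum]
      exact sum_ofDual_mul_ofVec α α' h)

lemma decomposeHom_of (r : R) : decomposeHom R M (of R M r) =
    DirectSum.of (fun i => component R M i) 0 ⟨of R M r, (IsMonomial.of r).mem⟩ :=
  lift_of _ _ _ _ _ _ _ _ _ _

lemma decomposeHom_ofVec (x : M) : decomposeHom R M (ofVec R M x) =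
    DirectSum.of (fun i => component R M i) (-1) ⟨ofVec R M x, (IsMonomial.ofVec x).mem⟩ :=
  lift_ofVec _ _ _ _ _ _ _ _ _ _

lemma decomposeHom_ofDual (f : LeftDual R M) : decomposeHom R M (ofDual R M f) =
    DirectSum.of (fun i => component R M i) 1 ⟨ofDual R M f, (IsMonomial.ofDual f).mem⟩ :=
  lift_ofDual _ _ _ _ _ _ _ _ _ _

/-- The Leavitt ring is `ℤ`-graded. -/
instance gradedRing : GradedRing (component R M) where
  decompose' := decomposeHom R M
  left_inv := by
    have : (DirectSum.coeRingHom (component R M)).comp (decomposeHom R M) = RingHom.id _ := by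
      refine hom_ext (fun r => ?_) (fun x => ?_) (fun f => ?_) <;>
        simp [decomposeHom_of, decomposeHom_ofVec, decomposeHom_ofDual]
    exact fun a => congrArg (fun f => f a) this
  right_inv := by
    have key : ∀ (i : ℤ) (a : LeavittRing R M) (ha : a ∈ component R M i),
        decomposeHom R M a = DirectSum.of (fun i => component R M i) i ⟨a, ha⟩ := by
      intro i a ha
      induction ha using AddSubgroup.closure_induction with
      | zero => exact (map_zero _).trans (map_zero _).symm
      | add x y hx hy ihx ihy => rw [map_add, ihx, ihy, ← map_add]; rfl
      | neg x hx ihx => rw [map_neg, ihx, ← map_neg]; rfl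
      | mem a ha =>
        induction ha with
        | of r => exact decomposeHom_of R M r
        | ofVec x => exact decomposeHom_ofVec R M x
        | ofDual f => exact decomposeHom_ofDual R M f
        | mul ha hb iha ihb =>
          rw [map_mul, iha, ihb, DirectSum.of_mul_of]
          rfl
    intro x
    induction x using DirectSum.induction_on with
    | zero => simp
    | of i a => simpa using key i a a.2
    | add x y hx hy => rw [map_add, map_add, hx, hy]

end LeavittRing

end Leavitt

/-! ### Factor categories -/
section Factor

variable {C : Type u} [Category.{v} C] [Preadditive C]

/-- Two morphisms are identified in the factor category if their difference factors through an
object with the property `P`. -/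
def factorRel (P : ObjectProperty C) : HomRel C := fun X Y f g =>
  ∃ (Z : C) (_ : P Z) (b : X ⟶ Z) (a : Z ⟶ Y), f - g = b ≫ a

/-- The factor category of `C` by the full subcategory of objects with the property `P`. -/
abbrev FactorCategory (P : ObjectProperty C) := CategoryTheory.Quotient (factorRel P)

/-- The canonical functor from `C` to the factor category. -/
abbrev toFactor (P : ObjectProperty C) : C ⥤ FactorCategory P :=
  CategoryTheory.Quotient.functor (factorRel P)

variable {P : ObjectProperty C} (Ω : C ⥤ C) [Ω.Additive] (hΩ : ∀ X, P X → P (Ω.obj X))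

/-- An additive endofunctor which preserves the property `P` induces an endofunctor of the
factor category. -/
def factorEndofunctor : FactorCategory P ⥤ FactorCategory P :=
  CategoryTheory.Quotient.lift (factorRel P) (Ω ⋙ toFactor P) (by
    rintro X Y f g ⟨Z, hZ, b, a, h⟩
    refine CategoryTheory.Quotient.sound (factorRel P)
      ⟨Ω.obj Z, hΩ Z hZ, Ω.map b, Ω.map a, ?_⟩
    rw [← Functor.map_sub, h, Functor.map_comp])

/-- The canonical functor to the factor category is a looped functor. -/
def factorLoopIso : Ω ⋙ toFactor P ≅ toFactor P ⋙ factorEndofunctor Ω hΩ :=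
  Iso.refl _

end Factor

/-! ### Finitely presented modules -/
section Modules

/-- The category `R-mod` of finitely presented left `R`-modules. -/
abbrev FPModuleCat (R : Type u) [Ring R] :=
  ObjectProperty.FullSubcategory fun X : ModuleCat.{u} R => Module.FinitePresentation R X

/-- The projective objects of `R-mod`, that is, the finitely generated projective modules. -/
def isProjectiveModule (R : Type u) [Ring R] : ObjectProperty (FPModuleCat R) :=
  fun X => Module.Projective R X.obj

/-- The stable module category of `R`. -/
abbrev StableModuleCat (R : Type u) [Ring R] := FactorCategory (isProjectiveModule R)

variable (R : Type u) [Ring R] (M : Type u) [AddCommGroup M] [Module R M] [Module Rᵐᵒᵖ M]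
  [SMulCommClass R Rᵐᵒᵖ M] [Module.Finite R M] [Module.Projective R M]

/-- The endofunctor `M ⊗_R -` of `R-mod`. -/
def tensorEndofunctor : FPModuleCat R ⥤ FPModuleCat R where
  obj X :=
    { obj := ModuleCat.of R (BimoduleTensor R M X.obj)
      property := by
        have := X.property
        exact BimoduleTensor.finitePresentation }
  map f := ObjectProperty.homMk (ModuleCat.ofHom (BimoduleTensor.map R M f.hom.hom))
  map_id X := by
    ext : 2
    exact BimoduleTensor.map_id
  map_comp f g := by
    ext : 2
    exact BimoduleTensor.map_comp g.hom.hom f.hom.hom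

instance : (tensorEndofunctor R M).Additive where
  map_add {X Y f g} := by
    ext : 2
    exact BimoduleTensor.map_add f.hom.hom g.hom.hom

lemma tensorEndofunctor_projective (X : FPModuleCat R) (hX : isProjectiveModule R X) :
    isProjectiveModule R ((tensorEndofunctor R M).obj X) := by
  have := X.property
  have : Module.Projective R X.obj := hX
  exact BimoduleTensor.projective

/-- The endofunctor of the stable module category induced by `M ⊗_R -`. -/
def stableTensorEndofunctor : StableModuleCat R ⥤ StableModuleCat R :=
  factorEndofunctor (tensorEndofunctor R M) (tensorEndofunctor_projective R M)

/-- The canonical functor `S(R-mod, M ⊗_R -) ⥤ S(R-mod/R-proj, M ⊗_R -)`. -/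
def stabilizationToStable :
    Stabilization (tensorEndofunctor R M) ⥤ Stabilization (stableTensorEndofunctor R M) :=
  Stabilization.mapFunctor (toFactor (isProjectiveModule R))
    (factorLoopIso (tensorEndofunctor R M) (tensorEndofunctor_projective R M))

end Modules

/-! ### Finitely presented graded modules -/
section Graded

/-- A graded left module over a `ℤ`-graded ring `A = ⨁ 𝒜 i`. -/
structure GradedModuleCat {A : Type u} [Ring A] (𝒜 : ℤ → AddSubgroup A) [GradedRing 𝒜] where
  /-- the underlying module -/
  carrier : Type u
  [addCommGroup : AddCommGroup carrier]
  [module : Module A carrier]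
  /-- the homogeneous components -/
  component : ℤ → AddSubgroup carrier
  isInternal : DirectSum.IsInternal component
  smul_mem : ∀ {i j : ℤ} {a : A} {x : carrier}, a ∈ 𝒜 i → x ∈ component j →
    a • x ∈ component (i + j)

namespace GradedModuleCat

attribute [instance] addCommGroup module

variable {A : Type u} [Ring A] {𝒜 : ℤ → AddSubgroup A} [GradedRing 𝒜]

instance : CoeSort (GradedModuleCat 𝒜) (Type u) := ⟨carrier⟩

/-- Morphisms of graded modules are the linear maps which preserve the degrees. -/
@[ext]
structure Hom (X Y : GradedModuleCat 𝒜) where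
  toLinearMap : X →ₗ[A] Y
  map_mem : ∀ (i : ℤ) (x : X), x ∈ X.component i → toLinearMap x ∈ Y.component i

instance : Category.{u} (GradedModuleCat 𝒜) where
  Hom := Hom
  id X := ⟨LinearMap.id, fun _ _ h => h⟩
  comp f g := ⟨g.toLinearMap ∘ₗ f.toLinearMap, fun i x h => g.map_mem i _ (f.map_mem i x h)⟩

@[ext] lemma hom_ext {X Y : GradedModuleCat 𝒜} {f g : X ⟶ Y}
    (h : f.toLinearMap = g.toLinearMap) : f = g := Hom.ext h

variable {X Y : GradedModuleCat 𝒜}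

instance : Zero (X ⟶ Y) := ⟨⟨0, fun _ _ _ => zero_mem _⟩⟩
instance : Add (X ⟶ Y) :=
  ⟨fun f g => ⟨f.toLinearMap + g.toLinearMap,
    fun i x h => add_mem (f.map_mem i x h) (g.map_mem i x h)⟩⟩
instance : Neg (X ⟶ Y) := ⟨fun f => ⟨-f.toLinearMap, fun i x h => neg_mem (f.map_mem i x h)⟩⟩
instance : Sub (X ⟶ Y) :=
  ⟨fun f g => ⟨f.toLinearMap - g.toLinearMap,
    fun i x h => sub_mem (f.map_mem i x h) (g.map_mem i x h)⟩⟩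
instance : SMul ℕ (X ⟶ Y) :=
  ⟨fun n f => ⟨n • f.toLinearMap, fun i x h => nsmul_mem (f.map_mem i x h) n⟩⟩
instance : SMul ℤ (X ⟶ Y) :=
  ⟨fun n f => ⟨n • f.toLinearMap, fun i x h => zsmul_mem (f.map_mem i x h) n⟩⟩

instance : AddCommGroup (X ⟶ Y) :=
  Function.Injective.addCommGroup (fun f : X ⟶ Y => f.toLinearMap) (fun _ _ => hom_ext)
    rfl (fun _ _ => rfl) (fun _ => rfl) (fun _ _ => rfl) (fun _ _ => rfl) (fun _ _ => rfl)

instance : Preadditive (GradedModuleCat 𝒜) where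
  add_comp _ _ _ f f' g := hom_ext (LinearMap.comp_add f.toLinearMap f'.toLinearMap g.toLinearMap)
  comp_add _ _ _ f g g' := hom_ext (LinearMap.add_comp f.toLinearMap g'.toLinearMap g.toLinearMap)

end GradedModuleCat

variable {A : Type u} [Ring A] (𝒜 : ℤ → AddSubgroup A) [GradedRing 𝒜]

/-- The category `A-grmod` of finitely presented graded left `A`-modules. -/
abbrev FPGradedModuleCat :=
  ObjectProperty.FullSubcategory fun X : GradedModuleCat 𝒜 => Module.FinitePresentation A X

/-- The finitely generated projective graded modules. -/
def isProjectiveGradedModule : ObjectProperty (FPGradedModuleCat 𝒜) :=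
  fun X => Module.Projective A X.obj

/-- The stable category of finitely presented graded modules. -/
abbrev StableGradedModuleCat := FactorCategory (isProjectiveGradedModule 𝒜)

end Graded

/-! ### Functors on a stabilization -/

namespace Stabilization

section basic

variable {C : Type u} [Category.{v} C] {Ω : C ⥤ C}

/-! Write `L` for the Leavitt ring. Its relations say that `M` becomes invertible over `L`: the map
`L ⊗_R M → L`, `a ⊗ m ↦ a m`, is bijective with inverse `a ↦ ∑ a α_j^* ⊗ α_j`. Hence the functors
`F_n = L ⊗_R -`, with generators placed in degree `-n`, satisfy `F_n ≅ F_{n+1} (M ⊗_R -)` (`absorb`,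
`indLoopIso`), and they glue to the functor `(X, n) ↦ F_n X` on the stabilization. It is an
equivalence because finiteness conditions turn statements about `L` into statements after finitely
many loops.

Faithful: the kernel of `X → L ⊗_R X` consists of the `x` with `m₁ ⊗ ⋯ ⊗ mₖ ⊗ x = 0` for some `k`
and all `mᵢ` (`exists_mem_vanishing_of_ι_eq_zero`). To see that no other element dies, an `L`-module
is built from germs of sequences in the iterates of `Hom_R(M, -)`.

Full: multiplication by a long path `m₁ ⋯ mₖ` carries an element of degree `i` of `L` to a sum of
paths of length `k - i` (`exists_paths_mul_mem`). So after enough loops a graded morphism carries `1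
⊗ X` into `1 ⊗ Y`. Finite presentation of `X` and the description of the kernel then give an honest
morphism after further loops (`exists_map_eq_of_quotient`).

Essentially surjective: since `c = 1`, every element `z` is recovered from the products of long
paths with `z`. Thus a finitely presented graded module has generators in one degree, and its
relations can be pushed into the span of paths of one length. Looping shortens these paths until the
relations come from `R`-modules (`exists_iso_of_ker_le_span`).

Stable version: a finitely generated projective graded module is a retract of some `F_n P` with `P`
finitely generated projective. A factorization through it can be replaced by one through `F_n P` and
pulled back by full faithfulness, and it becomes a factorization of a representative after finitely
many loops (`toFactorStabilization_map_eq`). -/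

lemma Rep.shift_add {A B : Stabilization Ω} (r : Rep A B) (k l : ℕ) :
    r.shift (k + l) = (r.shift k).shift l := by
  induction l with
  | zero => rfl
  | succ l ih => exact congrArg Rep.succ ih

lemma Rep.comp_shift {A B D : Stabilization Ω} (r : Rep A B) (s : Rep B D) (h : r.b = s.a)
    (k : ℕ) :
    (r.comp s h).shift k = (r.shift k).comp (s.shift k) (by simp [h]) := by
  induction k with
  | zero => rfl
  | succ k ih => exact (congrArg Rep.succ ih).trans (Rep.succ_comp_succ _ _ _).symm

/-- Two representatives define the same morphism if and only if they agree at some level. -/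
lemma Hom.exists_shift_eq {A B : Stabilization Ω} {r s : Rep A B} (h : Hom.mk r = Hom.mk s) :
    ∃ k l, r.shift k = s.shift l := by
  have := Quot.eqvGen_exact h
  induction this with
  | rel r s hrs => exact ⟨1, 0, hrs.symm⟩
  | refl r => exact ⟨0, 0, rfl⟩
  | symm r s _ ih =>
    obtain ⟨k, l, h⟩ := ih (Quot.eqvGen_sound ‹_›)
    exact ⟨l, k, h.symm⟩
  | trans r s t _ _ ih ih' =>
    obtain ⟨k, l, h⟩ := ih (Quot.eqvGen_sound ‹_›)
    obtain ⟨k', l', h'⟩ := ih' (Quot.eqvGen_sound ‹_›)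
    refine ⟨k + k', l' + l, ?_⟩
    rw [Rep.shift_add, Rep.shift_add, h, ← h', ← Rep.shift_add, ← Rep.shift_add, add_comm]

/-- The morphism `(X, n) ⟶ (Y, n)` given by a morphism `X ⟶ Y`. -/
def single (n : ℤ) {X Y : C} (f : X ⟶ Y) : (⟨X, n⟩ : Stabilization Ω) ⟶ ⟨Y, n⟩ :=
  Hom.mk ⟨0, 0, rfl, f⟩

/-- The isomorphism `(X, n) ≅ (Ω^a X, n + a)`. -/
def iterShiftIso (X : C) (a : ℕ) (n p : ℤ) (h : n + a = p) :
    (⟨X, n⟩ : Stabilization Ω) ≅ ⟨(iterFunctor Ω a).obj X, p⟩ where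
  hom := Hom.mk ⟨a, 0, by simpa using h, 𝟙 _⟩
  inv := Hom.mk ⟨0, a, by simpa using h.symm, 𝟙 _⟩
  hom_inv_id := by
    refine (mk_comp_mk _ _ rfl).trans (Eq.trans ?_ (Hom.mk_shift (Rep.id _) a))
    rw [Rep.id_shift]
    refine congrArg (fun f => Hom.mk (Rep.mk a a _ f)) ?_
    change 𝟙 ((iterFunctor Ω a).obj X) ≫ 𝟙 ((iterFunctor Ω a).obj X) ≫
      𝟙 ((iterFunctor Ω a).obj X) = _
    simp
  inv_hom_id := by
    refine (mk_comp_mk _ _ rfl).trans ?_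
    refine congrArg (fun f => Hom.mk (Rep.mk 0 0 _ f)) ?_
    simp [iterFunctor]

/-- The isomorphism `(X, n) ≅ (Ω X, n + 1)`. -/
def shiftIso (X : C) (n p : ℤ) (h : n + 1 = p) :
    (⟨X, n⟩ : Stabilization Ω) ≅ ⟨Ω.obj X, p⟩ :=
  iterShiftIso X 1 n p h

/-- Raising both ends to the level of a representative brings every morphism to the form `single`,
which reduces questions about the stabilization to morphisms of `C`. -/
lemma mk_eq_conj {A B : Stabilization Ω} (r : Rep A B) (p : ℤ) (h : A.deg + r.a = p) :
    (show A ⟶ B from Hom.mk r) = (iterShiftIso A.obj r.a A.deg p h).hom ≫ single p r.f ≫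
      (iterShiftIso B.obj r.b B.deg p (r.deg_eq ▸ h)).inv := by
  symm
  refine (congrArg _ (mk_comp_mk _ _ rfl)).trans ((mk_comp_mk _ _ rfl).trans ?_)
  refine congrArg (fun f => Hom.mk (Rep.mk r.a r.b _ f)) ?_
  simp [Rep.comp, iterFunctor]

/-- In the colimit `f` and `Ω f` are the same class; this is the inductive step whenever one more
loop improves `f`. -/
lemma single_conj {X Y : C} (f : X ⟶ Y) (n p : ℤ) (h : n + 1 = p) :
    single n f = (shiftIso X n p h).hom ≫ single p (Ω.map f) ≫ (shiftIso Y n p h).inv := by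
  refine (Hom.mk_succ _).symm.trans ?_
  exact mk_eq_conj (A := ⟨X, n⟩) (B := ⟨Y, n⟩) (Rep.mk 1 1 rfl (Ω.map f)) p h

end basic

/-! ### Functors out of the stabilization given by compatible families on `C` -/

section lift

variable {C : Type u} [Category.{v} C] {Ω : C ⥤ C} {D : Type u'} [Category.{v'} D]
  (F : ℤ → C ⥤ D) (θ : ∀ n p : ℤ, n + 1 = p → (F n ≅ Ω ⋙ F p))

/-- The isomorphisms `F n X ≅ F (n + a) (Ω^a X)` obtained by iterating `F n ≅ F (n + 1) Ω`. -/
def iterLoopIso : (a : ℕ) → (n p : ℤ) → n + a = p → (X : C) →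
    ((F n).obj X ≅ (F p).obj ((iterFunctor Ω a).obj X))
  | 0, n, p, h, X => eqToIso (by
      obtain rfl : n = p := by simpa using h
      rfl)
  | a + 1, n, p, h, X => iterLoopIso a n (n + a) rfl X ≪≫
      (θ (n + a) p (by push_cast at h; omega)).app ((iterFunctor Ω a).obj X)

lemma iterLoopIso_zero (n : ℤ) (h : n + (0 : ℕ) = n) (X : C) :
    iterLoopIso F θ 0 n n h X = Iso.refl _ := rfl

/-- The degrees are variables tied by equations because `n + (a + 1)` and `(n + a) + 1` agree only
propositionally, while the functors depend on the degree. -/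
lemma iterLoopIso_succ (a : ℕ) (n p q : ℤ) (h : n + a = p) (h' : n + (a + 1 : ℕ) = q)
    (h'' : p + 1 = q) (X : C) :
    iterLoopIso F θ (a + 1) n q h' X =
      iterLoopIso F θ a n p h X ≪≫ (θ p q h'').app ((iterFunctor Ω a).obj X) := by
  subst h
  rfl

lemma comp_comp_inv_comp_of_comm {X Y Y' Z Z' W : D} (i : X ⟶ Y) (t : Y ≅ Y') (f : Y ⟶ Z)
    (f' : Y' ⟶ Z') (s : Z ≅ Z') (j : Z ⟶ W) (h : f ≫ s.hom = t.hom ≫ f') :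
    (i ≫ t.hom) ≫ f' ≫ s.inv ≫ j = i ≫ f ≫ j := by
  rw [Category.assoc, ← reassoc_of% h, Iso.hom_inv_id_assoc]

/-- The action of `Stabilization.lift` on representatives. -/
def liftRep {A B : Stabilization Ω} (r : Rep A B) (p : ℤ) (h : A.deg + r.a = p) :
    (F A.deg).obj A.obj ⟶ (F B.deg).obj B.obj :=
  (iterLoopIso F θ r.a A.deg p h A.obj).hom ≫ (F p).map r.f ≫
    (iterLoopIso F θ r.b B.deg p (r.deg_eq ▸ h) B.obj).inv

/-- Naturality of `θ` at `r.f` cancels the extra loop on both sides; this makes the action well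
defined on the colimit. -/
lemma liftRep_succ {A B : Stabilization Ω} (r : Rep A B) (p q : ℤ) (h : A.deg + r.a = p)
    (h' : A.deg + r.succ.a = q) : liftRep F θ r.succ q h' = liftRep F θ r p h := by
  have hq : p + 1 = q := by
    rw [← h, ← h']
    simp [Rep.succ, add_assoc]
  have nat := (θ p q hq).hom.naturality r.f
  dsimp at nat
  have hb : B.deg + r.b = p := r.deg_eq ▸ h
  dsimp only [liftRep, Rep.succ]
  rw [iterLoopIso_succ F θ r.a A.deg p q h h' hq,
    iterLoopIso_succ F θ r.b B.deg p q hb _ hq]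
  exact comp_comp_inv_comp_of_comm _ ((θ p q hq).app _) _ _ ((θ p q hq).app _) _ nat

lemma liftRep_shift {A B : Stabilization Ω} (r : Rep A B) (k : ℕ) (p q : ℤ)
    (h : A.deg + r.a = p) (h' : A.deg + (r.shift k).a = q) :
    liftRep F θ (r.shift k) q h' = liftRep F θ r p h := by
  induction k generalizing q with
  | zero => obtain rfl : p = q := h.symm.trans h'; rfl
  | succ k ih => exact (liftRep_succ F θ _ _ _ rfl h').trans (ih _ rfl)

lemma liftRep_comp {A B E : Stabilization Ω} (r : Rep A B) (s : Rep B E) (e : r.b = s.a)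
    (p : ℤ) (h : A.deg + r.a = p) (h' : B.deg + s.a = p) :
    liftRep F θ (r.comp s e) p h = liftRep F θ r p h ≫ liftRep F θ s p h' := by
  obtain ⟨a, b, h1, f⟩ := r
  obtain ⟨c, d, h2, g⟩ := s
  obtain rfl : b = c := e
  simp [Rep.comp, liftRep]

/-- The functor on the stabilization induced by functors `F n` on `C` with `F n ≅ F (n + 1) Ω`;
it sends `(X, n)` to `F n X`. -/
def lift : Stabilization Ω ⥤ D where
  obj A := (F A.deg).obj A.obj
  map x := Quot.liftOn x (fun r => liftRep F θ r _ rfl) (by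
    rintro r _ rfl
    exact (liftRep_succ F θ r _ _ rfl rfl).symm)
  map_id A := by
    change liftRep F θ (Rep.id A) (A.deg + 0) rfl = 𝟙 _
    have : ∀ p (h : A.deg + (0 : ℕ) = p), liftRep F θ (Rep.id A) p h = 𝟙 _ := by
      intro p h
      obtain rfl : A.deg = p := by simpa using h
      change 𝟙 _ ≫ (F A.deg).map (𝟙 A.obj) ≫ 𝟙 _ = _
      simp
    exact this _ _
  map_comp := by
    rintro A B E ⟨r⟩ ⟨s⟩
    have h : (r.shift s.a).b = (s.shift r.b).a := by simp [add_comm]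
    change Quot.liftOn (Hom.comp (Hom.mk r) (Hom.mk s)) _ _ =
      liftRep F θ r _ rfl ≫ liftRep F θ s _ rfl
    rw [← Hom.mk_shift r s.a, ← Hom.mk_shift s r.b, Hom.mk_comp_mk _ _ h,
      ← liftRep_shift F θ r s.a _ _ rfl rfl]
    have h' : B.deg + (s.shift r.b).a = A.deg + (r.shift s.a).a := by
      rw [← h, (r.shift s.a).deg_eq]
    rw [← liftRep_shift F θ s r.b _ _ rfl h']
    exact liftRep_comp F θ _ _ h _ rfl h'

lemma lift_map_mk {A B : Stabilization Ω} (r : Rep A B) (p : ℤ) (h : A.deg + r.a = p) :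
    (lift F θ).map (show A ⟶ B from Hom.mk r) = liftRep F θ r p h := by
  subst h
  rfl

lemma lift_map_single (n : ℤ) {X Y : C} (f : X ⟶ Y) :
    (lift F θ).map (single n f) = (F n).map f := by
  refine (lift_map_mk F θ _ n (by simp)).trans ?_
  change 𝟙 _ ≫ (F n).map f ≫ 𝟙 _ = _
  simp

lemma lift_map_iterShiftIso_hom (X : C) (a : ℕ) (n p : ℤ) (h : n + a = p) :
    (lift F θ).map (iterShiftIso (Ω := Ω) X a n p h).hom = (iterLoopIso F θ a n p h X).hom := by
  refine (lift_map_mk F θ _ p h).trans ?_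
  change _ ≫ (F p).map (𝟙 _) ≫ 𝟙 _ = _
  simp

lemma lift_map_shiftIso_hom (X : C) (n p : ℤ) (h : n + 1 = p) :
    (lift F θ).map (shiftIso (Ω := Ω) X n p h).hom = (θ n p h).hom.app X := by
  refine (lift_map_iterShiftIso_hom F θ X 1 n p h).trans ?_
  rw [iterLoopIso_succ F θ 0 n n p (by simp) h h, iterLoopIso_zero]
  exact Category.id_comp _

lemma lift_map_shiftIso_inv (X : C) (n p : ℤ) (h : n + 1 = p) :
    (lift F θ).map (shiftIso (Ω := Ω) X n p h).inv = (θ n p h).inv.app X :=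
  congrArg Iso.inv (show (lift F θ).mapIso (shiftIso (Ω := Ω) X n p h) = (θ n p h).app X from
    Iso.ext (lift_map_shiftIso_hom F θ X n p h))

variable {F θ}

/-- Parallel morphisms can be represented by parallel morphisms of `C`, where `H` applies. The
conclusion of `H` is an equality in the stabilization and not `f = g`, since `F n` may identify
morphisms that only become equal after some loops. -/
lemma lift_faithful (H : ∀ (n : ℤ) {X Y : C} (f g : X ⟶ Y), (F n).map f = (F n).map g →
    (single n f : (⟨X, n⟩ : Stabilization Ω) ⟶ ⟨Y, n⟩) = single n g) :
    (lift F θ).Faithful where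
  map_injective := by
    rintro A B ⟨r⟩ ⟨s⟩ h
    change (lift F θ).map (show A ⟶ B from Hom.mk r) =
      (lift F θ).map (show A ⟶ B from Hom.mk s) at h
    change (show A ⟶ B from Hom.mk r) = (show A ⟶ B from Hom.mk s)
    -- Shifting each representative by the other's `a` equalizes the sources; the degrees then force
    -- the targets to agree as well.
    rw [← Hom.mk_shift r s.a, ← Hom.mk_shift s r.a] at h ⊢
    have ha : (r.shift s.a).a = (s.shift r.a).a := by simp [add_comm]
    have hb : (r.shift s.a).b = (s.shift r.a).b := by
      have h1 := (r.shift s.a).deg_eq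
      have h2 := (s.shift r.a).deg_eq
      rw [ha] at h1
      omega
    revert h
    generalize r.shift s.a = r' at *
    generalize s.shift r.a = s' at *
    intro h
    obtain ⟨a, b, h1, f⟩ := r'
    obtain ⟨c, d, h2, g⟩ := s'
    obtain rfl : a = c := ha
    obtain rfl : b = d := hb
    rw [lift_map_mk F θ _ _ rfl, lift_map_mk F θ _ _ rfl] at h
    have h' : (F (A.deg + a)).map f = (F (A.deg + a)).map g :=
      (cancel_mono _).1 ((cancel_epi _).1 h)
    rw [mk_eq_conj _ _ rfl, mk_eq_conj _ _ rfl]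
    dsimp only
    rw [H _ f g h']

/-- A morphism between values of `lift F θ` is in the image of `lift F θ` if it is so after
composing with isomorphisms in the image. -/
lemma exists_lift_map_eq {A B A' B' : Stabilization Ω} (i : A ≅ A') (j : B ≅ B')
    (φ : (lift F θ).obj A ⟶ (lift F θ).obj B)
    (H : ∃ ψ, (lift F θ).map ψ =
      (lift F θ).map i.inv ≫ φ ≫ (lift F θ).map j.hom) :
    ∃ ψ, (lift F θ).map ψ = φ := by
  obtain ⟨ψ, h⟩ := H
  refine ⟨i.hom ≫ ψ ≫ j.inv, ?_⟩
  simp only [Functor.map_comp, h, Category.assoc]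
  simp only [← Functor.map_comp_assoc, ← Functor.map_comp, Iso.hom_inv_id]
  simp

/-- Any two objects are isomorphic to objects of a common degree, so fullness needs to be checked
only there. -/
lemma lift_full (H : ∀ (n : ℤ) {X Y : C} (φ : (F n).obj X ⟶ (F n).obj Y),
    ∃ ψ : (⟨X, n⟩ : Stabilization Ω) ⟶ ⟨Y, n⟩, (lift F θ).map ψ = φ) :
    (lift F θ).Full where
  map_surjective := by
    intro A B φ
    -- The truncated differences raise both degrees to their maximum.
    have hp : A.deg + (B.deg - A.deg).toNat = B.deg + (A.deg - B.deg).toNat := by omega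
    exact exists_lift_map_eq (iterShiftIso A.obj _ A.deg _ rfl)
      (iterShiftIso B.obj _ B.deg _ hp.symm) φ (H _ _)

end lift

end Stabilization

/-! ### Extension of scalars along a ring homomorphism -/

section ScalarExt

variable {R : Type u} [Ring R] {S : Type u} [Ring S] (φ : R →+* S)
  (X : Type u) [AddCommGroup X] [Module R X]

/-- The relations `a φ(r) ⊗ x = a ⊗ r x`; the additive group they generate is an
`S`-submodule. -/
def ScalarExt.rel : Submodule S (S ⊗[ℤ] X) where
  __ := AddSubgroup.closure
    {t | ∃ (a : S) (r : R) (x : X), t = (a * φ r) ⊗ₜ[ℤ] x - a ⊗ₜ[ℤ] (r • x)}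
  smul_mem' b t ht := by
    change b • t ∈ AddSubgroup.closure _
    induction ht using AddSubgroup.closure_induction with
    | mem t ht =>
      obtain ⟨a, r, x, rfl⟩ := ht
      refine AddSubgroup.subset_closure ⟨b * a, r, x, ?_⟩
      simp [smul_sub, TensorProduct.smul_tmul', mul_assoc]
    | zero => rw [smul_zero]; exact zero_mem _
    | add s t _ _ hs ht => rw [smul_add]; exact add_mem hs ht
    | neg t _ ht => rw [smul_neg]; exact neg_mem ht

/-- The extension of scalars `S ⊗_R X` of a left `R`-module along `φ : R → S`. -/
def ScalarExt : Type u := (S ⊗[ℤ] X) ⧸ ScalarExt.rel φ X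

namespace ScalarExt

instance : AddCommGroup (ScalarExt φ X) :=
  inferInstanceAs (AddCommGroup ((S ⊗[ℤ] X) ⧸ ScalarExt.rel φ X))

instance : Module S (ScalarExt φ X) :=
  inferInstanceAs (Module S ((S ⊗[ℤ] X) ⧸ ScalarExt.rel φ X))

variable {X}

/-- The tensor `a ⊗ x`. -/
def tmul (a : S) (x : X) : ScalarExt φ X := (rel φ X).mkQ (a ⊗ₜ[ℤ] x)

lemma tmul_add (a : S) (x y : X) : tmul φ a (x + y) = tmul φ a x + tmul φ a y := by
  rw [tmul, TensorProduct.tmul_add]; rfl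

lemma mul_tmul (a : S) (r : R) (x : X) : tmul φ (a * φ r) x = tmul φ a (r • x) :=
  (Submodule.Quotient.eq _).2 (AddSubgroup.subset_closure ⟨a, r, x, rfl⟩)

lemma smul_tmul (a b : S) (x : X) : a • tmul φ b x = tmul φ (a * b) x := rfl

/-- The canonical map `x ↦ 1 ⊗ x`. -/
def ι : X →ₛₗ[φ] ScalarExt φ X where
  toFun x := tmul φ 1 x
  map_add' := tmul_add φ 1
  map_smul' r x := by rw [smul_tmul, mul_one, ← mul_tmul, one_mul]

lemma tmul_eq (a : S) (x : X) : tmul φ a x = a • ι φ x :=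
  congrArg (fun b => tmul φ b x) (mul_one a).symm

variable {φ}

@[elab_as_elim]
lemma induction {p : ScalarExt φ X → Prop} (h0 : p 0) (ht : ∀ (a : S) (x : X), p (a • ι φ x))
    (ha : ∀ s t, p s → p t → p (s + t)) (t : ScalarExt φ X) : p t := by
  obtain ⟨t, rfl⟩ := Submodule.mkQ_surjective _ t
  induction t using TensorProduct.induction_on with
  | zero => exact h0
  | tmul a x => 
    have := ht a x
    rwa [← tmul_eq] at this
  | add s t hs ht => exact ha _ _ hs ht

lemma hom_ext {N : Type*} [AddCommGroup N] [Module S N] {f g : ScalarExt φ X →ₗ[S] N}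
    (h : ∀ x, f (ι φ x) = g (ι φ x)) : f = g := by
  refine LinearMap.ext fun t => ?_
  induction t using induction with
  | h0 => simp
  | ht a x => rw [map_smul, map_smul, h]
  | ha s t hs ht => rw [map_add, map_add, hs, ht]

/-- Balanced biadditive maps induce additive maps on the tensor product. -/
def liftAdd {N : Type*} [AddCommGroup N] (b : S →+ X →+ N)
    (hb : ∀ a (r : R) x, b (a * φ r) x = b a (r • x)) : ScalarExt φ X →+ N :=
  ((Submodule.liftQ ((rel φ X).restrictScalars ℤ)
      (TensorProduct.liftAddHom b (by intro r a x; rw [map_zsmul]; simp)).toIntLinearMap (by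
        intro t ht
        change t ∈ AddSubgroup.closure _ at ht
        rw [LinearMap.mem_ker]
        induction ht using AddSubgroup.closure_induction with
        | mem t ht =>
          obtain ⟨a, r, x, rfl⟩ := ht
          simp [hb]
        | zero => simp
        | add s t _ _ hs ht => rw [map_add, hs, ht, add_zero]
        | neg t _ ht => rw [map_neg, ht, neg_zero])).comp
    (Submodule.Quotient.restrictScalarsEquiv ℤ (rel φ X)).symm.toLinearMap).toAddMonoidHom

lemma liftAdd_tmul {N : Type*} [AddCommGroup N] (b : S →+ X →+ N)
    (hb : ∀ a (r : R) x, b (a * φ r) x = b a (r • x)) (a : S) (x : X) :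
    liftAdd b hb (tmul φ a x) = b a x := rfl

/-- The map `a • x ↦ a • g x` on `S × X`. -/
def smulHom {N : Type*} [AddCommGroup N] [Module S N] (g : X →ₛₗ[φ] N) : S →+ X →+ N :=
  AddMonoidHom.mk' (fun a => AddMonoidHom.mk' (fun x => a • g x) (fun x y => by
    rw [_root_.map_add, smul_add])) (fun a b => by ext x; exact add_smul a b (g x))

lemma smulHom_mul {N : Type*} [AddCommGroup N] [Module S N] (g : X →ₛₗ[φ] N) (a : S) (r : R)
    (x : X) : smulHom g (a * φ r) x = smulHom g a (r • x) := by
  change (a * φ r) • g x = a • g (r • x)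
  rw [map_smulₛₗ, mul_smul]

lemma liftAdd_smulHom_smul {N : Type*} [AddCommGroup N] [Module S N] (g : X →ₛₗ[φ] N) (a : S)
    (t : ScalarExt φ X) : liftAdd (smulHom g) (smulHom_mul g) (a • t) =
      a • liftAdd (smulHom g) (smulHom_mul g) t := by
  induction t using induction with
  | h0 => rw [smul_zero, _root_.map_zero, smul_zero]
  | ht b x =>
    rw [smul_smul, ← tmul_eq, ← tmul_eq, liftAdd_tmul, liftAdd_tmul]
    exact mul_smul a b (g x)
  | ha s t hs ht => rw [smul_add, _root_.map_add, hs, ht, _root_.map_add, smul_add]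

/-- The universal property of the extension of scalars. -/
def lift {N : Type*} [AddCommGroup N] [Module S N] (g : X →ₛₗ[φ] N) :
    ScalarExt φ X →ₗ[S] N where
  toFun := liftAdd (smulHom g) (smulHom_mul g)
  map_add' := _root_.map_add _
  map_smul' := liftAdd_smulHom_smul g

@[simp] lemma lift_ι {N : Type*} [AddCommGroup N] [Module S N] (g : X →ₛₗ[φ] N) (x : X) :
    lift g (ι φ x) = g x :=
  one_smul S (g x)

variable {Y : Type u} [AddCommGroup Y] [Module R Y] {Z : Type u} [AddCommGroup Z] [Module R Z]

variable (φ) in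
/-- The functoriality of the extension of scalars. -/
def map (f : X →ₗ[R] Y) : ScalarExt φ X →ₗ[S] ScalarExt φ Y := lift ((ι φ).comp f)

@[simp] lemma map_ι (f : X →ₗ[R] Y) (x : X) : map φ f (ι φ x) = ι φ (f x) := lift_ι _ _

lemma map_id : map φ (LinearMap.id : X →ₗ[R] X) = LinearMap.id := hom_ext fun x => by simp

lemma map_comp (g : Y →ₗ[R] Z) (f : X →ₗ[R] Y) :
    map φ (g ∘ₗ f) = map φ g ∘ₗ map φ f := hom_ext fun x => by simp

lemma map_add (f g : X →ₗ[R] Y) : map φ (f + g) = map φ f + map φ g :=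
  hom_ext fun x => by simp

lemma map_surjective {f : X →ₗ[R] Y} (hf : Function.Surjective f) :
    Function.Surjective (map φ f) := by
  intro t
  induction t using induction with
  | h0 => exact ⟨0, _root_.map_zero _⟩
  | ht a y =>
    obtain ⟨x, rfl⟩ := hf y
    exact ⟨a • ι φ x, by simp⟩
  | ha s t hs ht =>
    obtain ⟨s, rfl⟩ := hs
    obtain ⟨t, rfl⟩ := ht
    exact ⟨s + t, _root_.map_add _ _ _⟩

/-- Modulo the span, `ι φ x` depends only on `f x`, so a set-theoretic section of `f` yields a
semilinear map on `Y`. Its extension composed with `map φ f` is the quotient map, which therefore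
kills the kernel. -/
lemma ker_map_le_span {f : X →ₗ[R] Y} (hf : Function.Surjective f) :
    LinearMap.ker (map φ f) ≤ Submodule.span S (ι φ '' (LinearMap.ker f : Set X)) := by
  set K := Submodule.span S (ι φ '' (LinearMap.ker f : Set X))
  have key : ∀ x x', f x = f x' → K.mkQ (ι φ x) = K.mkQ (ι φ x') := by
    intro x x' h
    refine (Submodule.Quotient.eq _).2 (Submodule.subset_span ⟨x - x', ?_, _root_.map_sub _ _ _⟩)
    rw [SetLike.mem_coe, LinearMap.mem_ker, _root_.map_sub, h, sub_self]
  let σ := Function.surjInv hf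
  have hσ : ∀ y, f (σ y) = y := Function.surjInv_eq hf
  let g : Y →ₛₗ[φ] (ScalarExt φ X ⧸ K) :=
    { toFun := fun y => K.mkQ (ι φ (σ y))
      map_add' := fun y y' => by
        rw [← _root_.map_add, ← _root_.map_add]
        exact key _ _ (by simp [hσ])
      map_smul' := fun r y => by
        rw [← _root_.map_smul, ← map_smulₛₗ]
        exact key _ _ (by simp [hσ]) }
  have hg : lift g ∘ₗ map φ f = K.mkQ := hom_ext fun x => by
    rw [LinearMap.comp_apply, map_ι, lift_ι]
    exact key _ _ (hσ (f x))
  intro t ht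
  have := LinearMap.congr_fun hg t
  rw [LinearMap.comp_apply, LinearMap.mem_ker.1 ht, _root_.map_zero] at this
  exact (Submodule.Quotient.mk_eq_zero _).1 this.symm

variable (φ) in
/-- `S ⊗_R R^n` is `S^n`. -/
def piEquiv (n : ℕ) : ScalarExt φ (Fin n → R) ≃ₗ[S] (Fin n → S) :=
  LinearEquiv.ofLinearMap
    (lift
      { toFun := fun v i => φ (v i)
        map_add' := fun v w => by ext i; simp
        map_smul' := fun r v => by ext i; simp })
    (Fintype.linearCombination S (fun i => ι φ (Pi.single i 1)))
    (by
      ext i j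
      simp [Pi.single_apply, apply_ite φ])
    (hom_ext fun v => by
      simp only [LinearMap.comp_apply, lift_ι, LinearMap.id_apply]
      change Fintype.linearCombination S _ (fun i => φ (v i)) = _
      simp only [Fintype.linearCombination_apply, ← map_smulₛₗ, ← map_sum]
      congr 1
      ext j
      simp [Finset.sum_apply, Pi.single_apply])

lemma projective [Module.Finite R X] [Module.Projective R X] :
    Module.Projective S (ScalarExt φ X) := by
  obtain ⟨n, f, g, -, -, hfg⟩ := Module.Finite.exists_comp_eq_id_of_projective R X
  have : Module.Projective S (ScalarExt φ (Fin n → R)) := .of_equiv (piEquiv φ n).symm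
  refine Module.Projective.of_split (map φ g) (map φ f) ?_
  rw [← map_comp, hfg, map_id]

/-- By right exactness, a presentation of `X` by `n` generators and relations `s` gives one of `S
⊗_R X` by `n` generators and the relations `ι φ` of `s`. -/
instance finitePresentation [Module.FinitePresentation R X] :
    Module.FinitePresentation S (ScalarExt φ X) := by
  obtain ⟨n, K, e, s, hs⟩ := Module.FinitePresentation.exists_fin R X
  have : Module.FinitePresentation S (ScalarExt φ (Fin n → R)) := .of_equiv (piEquiv φ n).symm
  have hf : Function.Surjective (e.symm.toLinearMap ∘ₗ K.mkQ) :=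
    e.symm.surjective.comp K.mkQ_surjective
  refine Module.finitePresentation_of_surjective _ (map_surjective hf) ?_
  classical
  refine ⟨s.image (ι φ), le_antisymm ?_ ((ker_map_le_span hf).trans ?_)⟩
  · rw [Submodule.span_le]
    intro t ht
    obtain ⟨x, hx, rfl⟩ := Finset.mem_image.1 (Finset.mem_coe.1 ht)
    have : K.mkQ x = 0 := (Submodule.Quotient.mk_eq_zero _).2 (hs ▸ Submodule.subset_span hx)
    rw [SetLike.mem_coe, LinearMap.mem_ker, map_ι, LinearMap.comp_apply, this]
    simp
  · rw [Submodule.span_le]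
    rintro _ ⟨x, hx, rfl⟩
    replace hx : x ∈ Submodule.span R (s : Set (Fin n → R)) := by simpa [hs] using hx
    rw [SetLike.mem_coe, Finset.coe_image]
    induction hx using Submodule.span_induction with
    | mem x hx => exact Submodule.subset_span ⟨x, hx, rfl⟩
    | zero => rw [_root_.map_zero]; exact zero_mem _
    | add x y _ _ hx hy => rw [_root_.map_add]; exact add_mem hx hy
    | smul r x _ hx => rw [map_smulₛₗ]; exact Submodule.smul_mem _ _ hx

end ScalarExt
end ScalarExt

/-! ### Graded modules -/

lemma DirectSum.of_congr {G : Type*} [AddCommGroup G] (c : ℤ → AddSubgroup G) {i j : ℤ}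
    (h : i = j) {a b : G} (hab : a = b) (ha : a ∈ c i) (hb : b ∈ c j) :
    DirectSum.of (fun i => c i) i ⟨a, ha⟩ = DirectSum.of (fun i => c i) j ⟨b, hb⟩ := by
  subst h hab
  rfl

namespace GradedModuleCat

variable {A : Type u} [Ring A] {𝒜 : ℤ → AddSubgroup A} [GradedRing 𝒜]

noncomputable instance (X : GradedModuleCat 𝒜) : DirectSum.Decomposition X.component :=
  X.isInternal.chooseDecomposition

/-- The projection onto the component of degree `i`. -/
noncomputable def proj (X : GradedModuleCat 𝒜) (i : ℤ) : X →+ X :=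
  (X.component i).subtype.comp ((DFinsupp.evalAddMonoidHom i).comp
    (DirectSum.decomposeAddEquiv X.component).toAddMonoidHom)

lemma proj_mem (X : GradedModuleCat 𝒜) (i : ℤ) (x : X) : X.proj i x ∈ X.component i :=
  (DirectSum.decompose X.component x i).2

lemma proj_of_mem {X : GradedModuleCat 𝒜} {i : ℤ} {x : X} (h : x ∈ X.component i) :
    X.proj i x = x :=
  DirectSum.decompose_of_mem_same X.component h

lemma proj_of_mem_ne {X : GradedModuleCat 𝒜} {i j : ℤ} {x : X} (h : x ∈ X.component i)
    (hij : i ≠ j) : X.proj j x = 0 :=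
  DirectSum.decompose_of_mem_ne X.component h hij

lemma sum_proj (X : GradedModuleCat 𝒜) (x : X) : ∃ s : Finset ℤ, ∑ i ∈ s, X.proj i x = x := by
  classical
  exact ⟨_, DirectSum.sum_support_decompose X.component x⟩

@[elab_as_elim]
lemma induction_homogeneous {X : GradedModuleCat 𝒜} {p : X → Prop} (h0 : p 0)
    (hx : ∀ i, ∀ x ∈ X.component i, p x) (ha : ∀ x y, p x → p y → p (x + y)) (x : X) : p x :=
  DirectSum.Decomposition.inductionOn X.component h0 (fun {i} x => hx i x x.2) ha x

lemma map_proj {X Y : GradedModuleCat 𝒜} (f : X ⟶ Y) (i : ℤ) (x : X) :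
    f.toLinearMap (X.proj i x) = Y.proj i (f.toLinearMap x) := by
  induction x using induction_homogeneous with
  | h0 => simp
  | hx j x hx =>
    obtain rfl | h := eq_or_ne j i
    · rw [proj_of_mem hx, proj_of_mem (f.map_mem _ _ hx)]
    · rw [proj_of_mem_ne hx h, proj_of_mem_ne (f.map_mem _ _ hx) h, map_zero]
  | ha x y hx hy => simp only [map_add, hx, hy]

lemma proj_smul {X : GradedModuleCat 𝒜} {i j k : ℤ} {a : A} (ha : a ∈ 𝒜 i) (h : k = i + j)
    (x : X) : X.proj k (a • x) = a • X.proj j x := by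
  subst h
  induction x using induction_homogeneous with
  | h0 => simp
  | hx l x hx =>
    obtain rfl | h := eq_or_ne l j
    · rw [proj_of_mem hx, proj_of_mem (X.smul_mem ha hx)]
    · rw [proj_of_mem_ne hx h, proj_of_mem_ne (X.smul_mem ha hx) (by simpa using h), smul_zero]
  | ha x y hx hy => simp only [smul_add, map_add, hx, hy]

/-- A bijective morphism of graded modules is an isomorphism. -/
noncomputable def isoOfBijective {X Y : GradedModuleCat 𝒜} (f : X ⟶ Y)
    (hf : Function.Bijective f.toLinearMap) : X ≅ Y where
  hom := f
  inv :=
    { toLinearMap := (LinearEquiv.ofBijective f.toLinearMap hf).symm.toLinearMap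
      map_mem := fun i y hy => by
        obtain ⟨x, rfl⟩ := hf.2 y
        -- Injectivity detects homogeneity: `x` and its projection to degree `i` have the same
        -- image.
        have : X.proj i x = x := hf.1 (by rw [map_proj, proj_of_mem hy])
        have e : (LinearEquiv.ofBijective f.toLinearMap hf).symm (f.toLinearMap x) = x :=
          (LinearEquiv.ofBijective f.toLinearMap hf).symm_apply_apply x
        rw [LinearEquiv.coe_coe, e, ← this]
        exact X.proj_mem i x }
  hom_inv_id := by
    ext x
    exact (LinearEquiv.ofBijective f.toLinearMap hf).symm_apply_apply x
  inv_hom_id := by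
    ext x
    exact (LinearEquiv.ofBijective f.toLinearMap hf).apply_symm_apply x

/-- The degree-preserving part of an additive map. -/
noncomputable def homogeneousPart {X Y : GradedModuleCat 𝒜} (s : X →+ Y) : X →+ Y :=
  (DirectSum.toAddMonoid fun i => ((Y.proj i).comp s).comp (X.component i).subtype).comp
    (DirectSum.decomposeAddEquiv X.component).toAddMonoidHom

lemma homogeneousPart_of_mem {X Y : GradedModuleCat 𝒜} (s : X →+ Y) {i : ℤ} {x : X}
    (h : x ∈ X.component i) : homogeneousPart s x = Y.proj i (s x) := by
  change DirectSum.toAddMonoid _ (DirectSum.decompose X.component x) = _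
  rw [DirectSum.decompose_of_mem X.component h, DirectSum.toAddMonoid_of]
  rfl

/-- An epimorphism onto a projective graded module splits in degree-preserving manner. -/
lemma exists_section {X Y : GradedModuleCat 𝒜} (f : X ⟶ Y)
    (hf : Function.Surjective f.toLinearMap) [Module.Projective A Y] :
    ∃ s : Y ⟶ X, s ≫ f = 𝟙 Y := by
  obtain ⟨s, hs⟩ := Module.projective_lifting_property f.toLinearMap LinearMap.id hf
  -- The section `s` need not respect degrees. Keeping from `s y` only the part in the degree of `y`
  -- preserves linearity, as is checked on homogeneous `a` and `y`.
  have key : ∀ (a : A) (y : Y), homogeneousPart s.toAddMonoidHom (a • y) =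
      a • homogeneousPart s.toAddMonoidHom y := by
    intro a y
    induction y using induction_homogeneous with
    | h0 => simp
    | hx i y hy =>
      induction a using DirectSum.Decomposition.inductionOn 𝒜 with
      | zero => simp
      | @homogeneous j a =>
        rw [homogeneousPart_of_mem _ hy, homogeneousPart_of_mem _ (Y.smul_mem a.2 hy)]
        refine Eq.trans ?_ (proj_smul a.2 rfl (s y))
        exact congrArg (X.proj _) (map_smul s _ _)
      | add a b ha hb => simp only [add_smul, map_add, ha, hb]
    | ha x y hx hy => simp only [smul_add, map_add, hx, hy]
  refine ⟨⟨{ homogeneousPart s.toAddMonoidHom with map_smul' := key }, fun i y hy => ?_⟩, ?_⟩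
  · exact (homogeneousPart_of_mem _ hy) ▸ X.proj_mem _ _
  · ext y
    change f.toLinearMap (homogeneousPart s.toAddMonoidHom y) = y
    induction y using induction_homogeneous with
    | h0 => simp
    | hx i y hy =>
      rw [homogeneousPart_of_mem _ hy, map_proj]
      have : f.toLinearMap (s y) = y := LinearMap.congr_fun hs y
      exact (congrArg (Y.proj i) this).trans (proj_of_mem hy)
    | ha x y hx hy => simp only [map_add, hx, hy]

end GradedModuleCat

/-! ### Induced graded modules -/

namespace ScalarExt

variable {R : Type u} [Ring R] {S : Type u} [Ring S] {φ : R →+* S}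
  (𝒜 : ℤ → AddSubgroup S) (hφ : ∀ r, φ r ∈ 𝒜 0) (n : ℤ)
  (X : Type u) [AddCommGroup X] [Module R X]

variable (φ) in
/-- The homogeneous components of `S ⊗_R X`, with `X` in degree `-n`. -/
def component (i : ℤ) : AddSubgroup (ScalarExt φ X) :=
  AddSubgroup.closure {t | ∃ a ∈ 𝒜 (i + n), ∃ x : X, t = a • ι φ x}

variable {𝒜 n X}

lemma smul_ι_mem {i j : ℤ} {a : S} (ha : a ∈ 𝒜 j) (h : j = i + n) (x : X) :
    a • ι φ x ∈ component φ 𝒜 n X i :=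
  AddSubgroup.subset_closure ⟨a, h ▸ ha, x, rfl⟩

variable [GradedRing 𝒜]

lemma smul_mem_component {i j : ℤ} {a : S} {t : ScalarExt φ X} (ha : a ∈ 𝒜 i)
    (ht : t ∈ component φ 𝒜 n X j) : a • t ∈ component φ 𝒜 n X (i + j) := by
  induction ht using AddSubgroup.closure_induction with
  | mem t ht =>
    obtain ⟨b, hb, x, rfl⟩ := ht
    rw [smul_smul]
    exact smul_ι_mem (SetLike.mul_mem_graded ha hb) (add_assoc _ _ _).symm x
  | zero => rw [smul_zero]; exact zero_mem _
  | add s t _ _ hs ht => rw [smul_add]; exact add_mem hs ht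
  | neg t _ ht => rw [smul_neg]; exact neg_mem ht

lemma ι_mem_component (x : X) : ι φ x ∈ component φ 𝒜 n X (-n) := by
  rw [← one_smul S (ι φ x)]
  exact smul_ι_mem (SetLike.GradedOne.one_mem (A := 𝒜)) (by simp) x

variable (𝒜 n)

/-- The map `a ↦ a ⊗ x` followed by the decomposition into homogeneous components. -/
def decomposeTmul (x : X) : S →+ ⨁ i, component φ 𝒜 n X i :=
  (DirectSum.toAddMonoid fun j => (DirectSum.of (fun i => component φ 𝒜 n X i) (j - n)).comp
    (AddMonoidHom.mk' (fun a : 𝒜 j => ⟨(a : S) • ι φ x, smul_ι_mem a.2 (by simp) x⟩)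
      (fun a b => Subtype.ext (add_smul (a : S) (b : S) _)))).comp
    (DirectSum.decomposeAddEquiv 𝒜).toAddMonoidHom

lemma decomposeTmul_of_mem {j : ℤ} {a : S} (ha : a ∈ 𝒜 j) (x : X) :
    decomposeTmul (φ := φ) 𝒜 n x a = DirectSum.of (fun i => component φ 𝒜 n X i) (j - n)
      ⟨a • ι φ x, smul_ι_mem ha (by simp) x⟩ := by
  change DirectSum.toAddMonoid _ (DirectSum.decompose 𝒜 a) = _
  rw [DirectSum.decompose_of_mem 𝒜 ha, DirectSum.toAddMonoid_of]
  rfl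

variable {𝒜} in
-- Here the assumption that `φ` lands in degree zero enters: moving `φ r` across the tensor sign
-- does not affect the degree read off from the left factor.
lemma decomposeTmul_mul (hφ : ∀ r, φ r ∈ 𝒜 0) (a : S) (r : R) (x : X) :
    decomposeTmul (φ := φ) 𝒜 n x (a * φ r) = decomposeTmul 𝒜 n (r • x) a := by
  induction a using DirectSum.Decomposition.inductionOn 𝒜 with
  | zero => simp
  | @homogeneous j a =>
    rw [decomposeTmul_of_mem 𝒜 n (SetLike.mul_mem_graded a.2 (hφ r)),
      decomposeTmul_of_mem 𝒜 n a.2]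
    refine DirectSum.of_congr _ (by simp) ?_ _ _
    rw [map_smulₛₗ, mul_smul]
  | add a b ha hb => simp only [add_mul, _root_.map_add, ha, hb]

/-- The decomposition of the elements of `S ⊗_R X` into homogeneous components. -/
def decomposeHom : ScalarExt φ X →+ ⨁ i, component φ 𝒜 n X i :=
  liftAdd (AddMonoidHom.flip (AddMonoidHom.mk' (decomposeTmul 𝒜 n) (fun x y => by
    refine AddMonoidHom.ext fun a => ?_
    induction a using DirectSum.Decomposition.inductionOn 𝒜 with
    | zero => simp
    | @homogeneous j a =>
      rw [AddMonoidHom.add_apply, decomposeTmul_of_mem 𝒜 n a.2, decomposeTmul_of_mem 𝒜 n a.2,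
        decomposeTmul_of_mem 𝒜 n a.2, ← _root_.map_add]
      refine congrArg _ (Subtype.ext ?_)
      exact (congrArg ((a : S) • ·) (_root_.map_add (ι φ) x y)).trans (smul_add _ _ _)
    | add a b ha hb => simp only [_root_.map_add, ha, hb])))
  (fun a r x => decomposeTmul_mul n hφ a r x)

lemma decomposeHom_of_mem {i j : ℤ} {a : S} (ha : a ∈ 𝒜 j) (h : j = i + n) (x : X) :
    decomposeHom 𝒜 hφ n (a • ι φ x) = DirectSum.of (fun i => component φ 𝒜 n X i) i
      ⟨a • ι φ x, smul_ι_mem ha h x⟩ := by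
  refine (congrArg _ (tmul_eq φ a x)).symm.trans ((decomposeTmul_of_mem 𝒜 n ha x).trans ?_)
  exact DirectSum.of_congr _ (by simp [h]) rfl _ _

/-- Decomposing `a` decomposes `a ⊗ x`, and this is inverse to summation, as is seen on tensors with
homogeneous `a`. -/
lemma isInternal_component (hφ : ∀ r, φ r ∈ 𝒜 0) : DirectSum.IsInternal (component φ 𝒜 n X) := by
  let : DirectSum.Decomposition (component φ 𝒜 n X) :=
    DirectSum.Decomposition.ofAddHom _ (decomposeHom 𝒜 hφ n)
      (by
        refine AddMonoidHom.ext fun t => ?_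
        induction t using induction with
        | h0 => simp
        | ht a x =>
          induction a using DirectSum.Decomposition.inductionOn 𝒜 with
          | zero => simp
          | @homogeneous j a =>
            rw [AddMonoidHom.comp_apply,
              decomposeHom_of_mem 𝒜 hφ n a.2 (sub_add_cancel j n).symm]
            simp
          | add a b ha hb => rw [add_smul, _root_.map_add, ha, hb, _root_.map_add]
        | ha s t hs ht => rw [_root_.map_add, hs, ht, _root_.map_add])
      (by
        ext i ⟨t, ht⟩ : 2
        simp only [AddMonoidHom.comp_apply, DirectSum.coeAddMonoidHom_of, AddMonoidHom.id_apply]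
        induction ht using AddSubgroup.closure_induction with
        | mem t ht =>
          obtain ⟨a, ha, x, rfl⟩ := ht
          exact decomposeHom_of_mem 𝒜 hφ n ha rfl x
        | zero => exact (_root_.map_zero _).trans (_root_.map_zero _).symm
        | add s t _ _ hs ht =>
          refine (_root_.map_add _ _ _).trans ((congrArg₂ (· + ·) hs ht).trans ?_)
          exact (_root_.map_add _ _ _).symm
        | neg t _ ht =>
          refine (_root_.map_neg _ _).trans ((congrArg Neg.neg ht).trans ?_)
          exact (_root_.map_neg _ _).symm)
  exact DirectSum.Decomposition.isInternal _

variable (X)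

/-- The graded module `S ⊗_R X`, with `X` in degree `-n`. -/
abbrev graded : GradedModuleCat 𝒜 where
  carrier := ScalarExt φ X
  component := component φ 𝒜 n X
  isInternal := isInternal_component 𝒜 n hφ
  smul_mem := smul_mem_component

variable {X 𝒜 n}

lemma lift_mem_component {Z : GradedModuleCat 𝒜} (g : X →ₛₗ[φ] Z)
    (hg : ∀ x, g x ∈ Z.component (-n)) {i : ℤ} {t : ScalarExt φ X}
    (ht : t ∈ component φ 𝒜 n X i) : lift g t ∈ Z.component i := by
  induction ht using AddSubgroup.closure_induction with
  | mem t ht =>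
    obtain ⟨a, ha, x, rfl⟩ := ht
    have := Z.smul_mem ha (hg x)
    rwa [map_smul, lift_ι, ← add_neg_cancel_right i n]
  | zero => rw [_root_.map_zero]; exact zero_mem _
  | add s t _ _ hs ht => rw [_root_.map_add]; exact add_mem hs ht
  | neg t _ ht => rw [_root_.map_neg]; exact neg_mem ht

/-- The universal property of the induced graded module. -/
def gradedLift {Z : GradedModuleCat 𝒜} (g : X →ₛₗ[φ] Z) (hg : ∀ x, g x ∈ Z.component (-n)) :
    graded 𝒜 hφ n X ⟶ Z where
  toLinearMap := lift g
  map_mem _ _ ht := lift_mem_component g hg ht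

variable {hφ} in
lemma graded_hom_ext {Z : GradedModuleCat 𝒜} {f g : graded 𝒜 hφ n X ⟶ Z}
    (h : ∀ x : X, f.toLinearMap (ι φ x) = g.toLinearMap (ι φ x)) : f = g :=
  GradedModuleCat.hom_ext (hom_ext h)

variable (𝒜 n)

/-- The functor `S ⊗_R -` from finitely presented modules to finitely presented graded modules,
with the generators `1 ⊗ x` in degree `-n`. -/
def functor : FPModuleCat R ⥤ FPGradedModuleCat 𝒜 where
  obj X :=
    { obj := graded 𝒜 hφ n X.obj
      property := by
        have := X.property
        exact finitePresentation (φ := φ) }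
  map {X Y} f := ObjectProperty.homMk (gradedLift hφ ((ι φ).comp f.hom.hom)
    (fun x => ι_mem_component (f.hom.hom x)))
  map_id X := by
    ext : 2
    exact map_id
  map_comp f g := by
    ext : 2
    exact map_comp g.hom.hom f.hom.hom

instance : (functor 𝒜 hφ n).Additive where
  map_add {X Y f g} := by
    ext : 2
    exact map_add f.hom.hom g.hom.hom

lemma functor_map_ι {X Y : FPModuleCat R} (f : X ⟶ Y) (x : X.obj) :
    ((functor 𝒜 hφ n).map f).hom.toLinearMap (ι φ x) = ι φ (f.hom.hom x) :=
  lift_ι _ _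

lemma functor_projective (X : FPModuleCat R) (hX : isProjectiveModule R X) :
    isProjectiveGradedModule 𝒜 ((functor 𝒜 hφ n).obj X) := by
  have := X.property
  have : Module.Projective R X.obj := hX
  exact projective (φ := φ)

end ScalarExt

/-! ### Modules over the Leavitt ring -/

namespace LeavittRing

/-- The dual basis is read off from the coordinates of a splitting of a surjection from a finite
free module. -/
lemma exists_dualBasis (R : Type u) [Ring R] (M : Type u) [AddCommGroup M] [Module R M]
    [Module.Finite R M] [Module.Projective R M] :
    ∃ (n : ℕ) (α : Fin n → M) (α' : Fin n → LeftDual R M), ∀ x : M, ∑ j, α' j x • α j = x := by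
  obtain ⟨n, f, g, -, -, hfg⟩ := Module.Finite.exists_comp_eq_id_of_projective R M
  refine ⟨n, fun j => f (Pi.single j 1),
    fun j => show M →ₗ[R] R from LinearMap.proj j ∘ₗ g, fun x => ?_⟩
  have h : f (g x) = x := LinearMap.congr_fun hfg x
  rw [← Finset.univ_sum_single (g x), map_sum] at h
  refine Eq.trans (Finset.sum_congr rfl fun j _ => ?_) h
  rw [← map_smul]
  congr 1
  ext i
  simp only [Pi.smul_apply, Pi.single_apply, smul_eq_mul, mul_ite, mul_one, mul_zero]
  rfl

section

variable {R : Type u} [Ring R] {M : Type u} [AddCommGroup M] [Module R M]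
  [Module Rᵐᵒᵖ M] [SMulCommClass R Rᵐᵒᵖ M]

lemma of_mem_component (r : R) : of R M r ∈ component R M 0 := (IsMonomial.of r).mem

variable {X : Type u} [AddCommGroup X] [Module R X]
variable {N : Type*} [AddCommGroup N] [Module (LeavittRing R M) N]

/-- An element `y` of a module over the Leavitt ring is determined by the elements `m y` with
`m ∈ M`. -/
lemma ext_ofVec_smul [Module.Finite R M] [Module.Projective R M] {y z : N}
    (h : ∀ m : M, ofVec R M m • y = ofVec R M m • z) : y = z := by
  obtain ⟨n, α, α', hα⟩ := exists_dualBasis R M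
  -- Inserting `1 = ∑ α_j^* α_j` leaves only the elements `α_j y` and `α_j z`.
  rw [← one_smul (LeavittRing R M) y, ← one_smul (LeavittRing R M) z,
    ← sum_ofDual_mul_ofVec α α' hα, Finset.sum_smul, Finset.sum_smul]
  refine Finset.sum_congr rfl fun j _ => ?_
  rw [mul_smul, mul_smul, h]

/-- The map `M ⊗_R X → N`, `m ⊗ x ↦ m g(x)`. -/
def tensorLift (g : X →ₛₗ[of R M] N) : BimoduleTensor R M X →ₛₗ[of R M] N :=
  letI : Module R N := Module.compHom N (of R M)
  let b : M →ₗ[R] X →+ N :=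
    { toFun := fun m => AddMonoidHom.mk' (fun x => ofVec R M m • g x) (fun x y => by
        rw [map_add, smul_add])
      map_add' := fun m m' => by
        ext x
        exact (congrArg (· • g x) (map_add _ _ _)).trans (add_smul _ _ _)
      map_smul' := fun r m => by
        ext x
        exact (congrArg (· • g x) (ofVec_smul r m)).trans (mul_smul _ _ _) }
  let l := BimoduleTensor.lift b (fun m r x => by
    change ofVec R M (op r • m) • g x = ofVec R M m • g (r • x)
    rw [ofVec_op_smul, map_smulₛₗ, mul_smul])
  { toFun := l
    map_add' := map_add l
    map_smul' := map_smul l }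

@[simp] lemma tensorLift_tmul (g : X →ₛₗ[of R M] N) (m : M) (x : X) :
    tensorLift g (BimoduleTensor.tmul R m x) = ofVec R M m • g x := rfl

section Transpose

variable [Module.Finite R M] [Module.Projective R M]

/-- The Casimir element dictates `h x = ∑ α_j^* g (α_j ⊗ x)`. The first clause already determines
`h`; the second remembers the shape of the formula, from which `transpose_mem` reads off degrees. -/
lemma exists_transpose (g : BimoduleTensor R M X →ₛₗ[of R M] N) : ∃ h : X → N,
    (∀ m x, ofVec R M m • h x = g (BimoduleTensor.tmul R m x)) ∧
    ∃ (n : ℕ) (α' : Fin n → LeftDual R M) (t : X → Fin n → BimoduleTensor R M X),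
      ∀ x, h x = ∑ j, ofDual R M (α' j) • g (t x j) := by
  obtain ⟨n, α, α', hα⟩ := exists_dualBasis R M
  refine ⟨fun x => ∑ j, ofDual R M (α' j) • g (BimoduleTensor.tmul R (α j) x), fun m x => ?_,
    n, α', fun x j => BimoduleTensor.tmul R (α j) x, fun x => rfl⟩
  simp only [Finset.smul_sum, smul_smul, ofVec_mul_ofDual, ← map_smulₛₗ,
    BimoduleTensor.smul_tmul, ← map_sum]
  congr 1
  conv_rhs => rw [← hα m]
  exact (map_sum (AddMonoidHom.mk' (fun m => BimoduleTensor.tmul R m x)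
    (fun m m' => BimoduleTensor.add_tmul m m' x)) _ _).symm

/-- The map `X → N` with `m (transpose g x) = g (m ⊗ x)`. -/
noncomputable def transpose (g : BimoduleTensor R M X →ₛₗ[of R M] N) : X →ₛₗ[of R M] N where
  toFun := (exists_transpose g).choose
  map_add' x y := ext_ofVec_smul (R := R) (M := M) fun m => by
    rw [smul_add]
    simp only [(exists_transpose g).choose_spec.1]
    rw [BimoduleTensor.tmul_add, map_add]
  map_smul' r x := ext_ofVec_smul (R := R) (M := M) fun m => by
    rw [smul_smul, ← ofVec_op_smul]
    simp only [(exists_transpose g).choose_spec.1]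
    rw [BimoduleTensor.tmul_smul]

@[simp] lemma ofVec_smul_transpose (g : BimoduleTensor R M X →ₛₗ[of R M] N) (m : M) (x : X) :
    ofVec R M m • transpose g x = g (BimoduleTensor.tmul R m x) :=
  (exists_transpose g).choose_spec.1 m x

lemma transpose_mem {Z : GradedModuleCat (component R M)}
    (g : BimoduleTensor R M X →ₛₗ[of R M] Z) {i j : ℤ} (hij : 1 + i = j)
    (hg : ∀ t, g t ∈ Z.component i) (x : X) : transpose g x ∈ Z.component j := by
  obtain ⟨n, α', t, h⟩ := (exists_transpose g).choose_spec.2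
  change (exists_transpose g).choose x ∈ Z.component j
  rw [h, ← hij]
  exact sum_mem fun k _ => Z.smul_mem (IsMonomial.ofDual _).mem (hg _)

end Transpose

end

/-! ### Induced graded modules and their loop isomorphisms -/

section

variable (R : Type u) [Ring R] (M : Type u) [AddCommGroup M] [Module R M]
  [Module Rᵐᵒᵖ M] [SMulCommClass R Rᵐᵒᵖ M]

/-- The functor `L_R(M) ⊗_R -`, with the generators `1 ⊗ x` in degree `-n`. -/
abbrev ind (n : ℤ) : FPModuleCat R ⥤ FPGradedModuleCat (component R M) :=
  ScalarExt.functor (component R M) of_mem_component n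

open ScalarExt

variable {R M} in
lemma tensorLift_ι_mem {X : Type u} [AddCommGroup X] [Module R X] {n p : ℤ} (h : n + 1 = p)
    (t : BimoduleTensor R M X) :
    tensorLift (ι (of R M)) t ∈ ScalarExt.component (of R M) (component R M) n X (-p) := by
  induction t using BimoduleTensor.induction with
  | h0 => rw [_root_.map_zero]; exact zero_mem _
  | ht m x =>
    rw [tensorLift_tmul]
    exact smul_ι_mem (IsMonomial.ofVec m).mem (by omega) x
  | ha s t hs ht => rw [_root_.map_add]; exact add_mem hs ht

variable [Module.Finite R M] [Module.Projective R M]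

/-- The isomorphism `L_R(M) ⊗_R M ⊗_R X ≅ L_R(M) ⊗_R X`, `a ⊗ m ⊗ x ↦ a m ⊗ x`. -/
noncomputable def absorb (X : Type u) [AddCommGroup X] [Module R X] :
    ScalarExt (of R M) (BimoduleTensor R M X) ≃ₗ[LeavittRing R M] ScalarExt (of R M) X :=
  LinearEquiv.ofLinearMap (ScalarExt.lift (tensorLift (ι (of R M))))
    (ScalarExt.lift (transpose (ι (of R M))))
    (ScalarExt.hom_ext fun x => ext_ofVec_smul (R := R) (M := M) fun m => by
      rw [← map_smul, LinearMap.comp_apply, map_smul, lift_ι, ofVec_smul_transpose, lift_ι,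
        tensorLift_tmul]
      rfl)
    (ScalarExt.hom_ext fun t => by
      induction t using BimoduleTensor.induction with
      | h0 => simp
      | ht m x =>
        rw [LinearMap.comp_apply, lift_ι, tensorLift_tmul, map_smul, lift_ι,
          ofVec_smul_transpose]
        rfl
      | ha s t hs ht => rw [_root_.map_add, _root_.map_add, _root_.map_add, hs, ht])

variable {R M} in
@[simp] lemma absorb_ι {X : Type u} [AddCommGroup X] [Module R X] (m : M) (x : X) :
    absorb R M X (ι (of R M) (BimoduleTensor.tmul R m x)) = ofVec R M m • ι (of R M) x :=
  (lift_ι _ _).trans (tensorLift_tmul _ _ _)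

/-- The isomorphism `L_R(M) ⊗_R X ≅ L_R(M) ⊗_R M ⊗_R X` which raises the index by one. -/
noncomputable def indLoopIsoApp (n p : ℤ) (h : n + 1 = p) (X : FPModuleCat R) :
    (ind R M n).obj X ≅ (ind R M p).obj ((tensorEndofunctor R M).obj X) where
  hom := ObjectProperty.homMk (gradedLift of_mem_component
    (transpose (X := X.obj) (ι (X := BimoduleTensor R M X.obj) (of R M)))
    (transpose_mem (Z := graded (component R M) of_mem_component p (BimoduleTensor R M X.obj))
      _ (by omega) fun t => ι_mem_component t))
  inv := ObjectProperty.homMk (gradedLift (X := BimoduleTensor R M X.obj)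
    (Z := graded (component R M) of_mem_component n X.obj) of_mem_component
    (tensorLift (ι (of R M))) (tensorLift_ι_mem h))
  hom_inv_id := by
    ext : 3
    exact (absorb R M X.obj).apply_symm_apply _
  inv_hom_id := by
    ext : 3
    exact (absorb R M X.obj).symm_apply_apply _

/-- The natural isomorphisms `L_R(M) ⊗_R - ≅ L_R(M) ⊗_R M ⊗_R -`. -/
noncomputable def indLoopIso (n p : ℤ) (h : n + 1 = p) :
    ind R M n ≅ tensorEndofunctor R M ⋙ ind R M p :=
  NatIso.ofComponents (indLoopIsoApp R M n p h) (fun {X Y} f => by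
    -- Naturality is checked for the inverses, because `absorb` has the explicit form `m ⊗ x ↦ m x`
    -- whereas its inverse involves a dual basis.
    rw [← Iso.inv_comp_eq, ← Category.assoc, ← Iso.eq_comp_inv]
    ext : 1
    refine GradedModuleCat.hom_ext (ScalarExt.hom_ext fun t => ?_)
    change (ScalarExt.map (of R M) f.hom.hom) (absorb R M X.obj (ι (of R M) t)) =
      absorb R M Y.obj (ScalarExt.map (of R M) (BimoduleTensor.map R M f.hom.hom) (ι (of R M) t))
    induction t using BimoduleTensor.induction with
    | h0 => simp
    | ht m x =>
      rw [map_ι, BimoduleTensor.map_tmul, absorb_ι, absorb_ι, map_smul, map_ι]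
    | ha s t hs ht => simp only [_root_.map_add, hs, ht])

/-- The functor from the stabilization to graded modules, `(X, n) ↦ L_R(M) ⊗_R X`. -/
noncomputable abbrev stabilizationInd :
    Stabilization (tensorEndofunctor R M) ⥤ FPGradedModuleCat (component R M) :=
  Stabilization.lift (ind R M) (indLoopIso R M)

end

end LeavittRing

/-! ### The kernel of `X → L_R(M) ⊗_R X` -/

section Vanishing

variable (R : Type u) [Ring R] (M : Type u) [AddCommGroup M] [Module R M] [Module Rᵐᵒᵖ M]

/-- The elements `x` with `m₁ ⊗ ⋯ ⊗ mₖ ⊗ x = 0` for all `m₁, …, mₖ ∈ M`. -/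
def vanishing : (k : ℕ) → (X : Type u) → [AddCommGroup X] → [Module R X] → Submodule R X
  | 0, _, _, _ => ⊥
  | k + 1, X, _, _ =>
    { carrier := {x | ∀ m : M,
        BimoduleTensor.tmul R m x ∈ vanishing k (BimoduleTensor R M X)}
      zero_mem' := fun m => by
        rw [BimoduleTensor.tmul_zero]
        exact zero_mem _
      add_mem' := fun hx hy m => by
        rw [BimoduleTensor.tmul_add]
        exact add_mem (hx m) (hy m)
      smul_mem' := fun r x hx m => by
        rw [BimoduleTensor.tmul_smul]
        exact hx _ }

variable {R M} {X : Type u} [AddCommGroup X] [Module R X]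

lemma mem_vanishing_zero {x : X} : x ∈ vanishing R M 0 X ↔ x = 0 := Iff.rfl

lemma mem_vanishing_succ {k : ℕ} {x : X} : x ∈ vanishing R M (k + 1) X ↔
    ∀ m : M, BimoduleTensor.tmul R m x ∈ vanishing R M k (BimoduleTensor R M X) := Iff.rfl

lemma vanishing_le_succ (k : ℕ) {X : Type u} [AddCommGroup X] [Module R X] :
    vanishing R M k X ≤ vanishing R M (k + 1) X := by
  induction k generalizing X with
  | zero =>
    rintro x rfl m
    rw [BimoduleTensor.tmul_zero]
    exact zero_mem _
  | succ k ih => exact fun x hx m => ih (hx m)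

lemma vanishing_mono {k l : ℕ} (h : k ≤ l) : vanishing R M k X ≤ vanishing R M l X :=
  monotone_nat_of_le_succ (f := fun k => vanishing R M k X) (fun k => vanishing_le_succ k) h

end Vanishing

/-! ### Germs of sequences in the iterates of `Hom_R(M, -)` -/

section Coinduced

variable (R : Type u) [Ring R] (M : Type u) [AddCommGroup M] [Module R M]

/-- The left `R`-module `Hom_R(M, V)`, with `(r z) m = z (m r)`. -/
def LeftHom (V : Type u) [AddCommGroup V] [Module R V] : Type u := M →ₗ[R] V

namespace LeftHom

variable {R M} {V : Type u} [AddCommGroup V] [Module R V]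

instance : AddCommGroup (LeftHom R M V) := inferInstanceAs (AddCommGroup (M →ₗ[R] V))

instance : FunLike (LeftHom R M V) M V := inferInstanceAs (FunLike (M →ₗ[R] V) M V)

instance : LinearMapClass (LeftHom R M V) R M V :=
  inferInstanceAs (LinearMapClass (M →ₗ[R] V) R M V)

lemma ext {f g : LeftHom R M V} (h : ∀ x, f x = g x) : f = g := LinearMap.ext h

variable [Module Rᵐᵒᵖ M] [SMulCommClass R Rᵐᵒᵖ M]

instance : Module R (LeftHom R M V) where
  smul a f :=
    ({ toFun := fun x => f (op a • x)
       map_add' := fun x y => by rw [smul_add, map_add]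
       map_smul' := fun r x => by rw [← smul_comm r, map_smul]; rfl } : M →ₗ[R] V)
  one_smul f := ext fun x => congrArg f (one_smul _ x)
  mul_smul a b f := ext fun x => congrArg f (mul_smul (op b) (op a) x)
  smul_zero a := ext fun x => rfl
  smul_add a f g := ext fun x => rfl
  add_smul a b f := ext fun x => (congrArg f (add_smul (op a) (op b) x)).trans (map_add f _ _)
  zero_smul f := ext fun x => (congrArg f (zero_smul _ x)).trans (map_zero f)

/-- Currying `Hom_R(M ⊗_R X, V) → Hom_R(X, Hom_R(M, V))`. -/
def curry {X : Type u} [AddCommGroup X] [Module R X] (g : BimoduleTensor R M X →ₗ[R] V) :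
    X →ₗ[R] LeftHom R M V where
  toFun x :=
    ({ toFun := fun m => g (BimoduleTensor.tmul R m x)
       map_add' := fun m m' => by rw [BimoduleTensor.add_tmul, map_add]
       map_smul' := fun r m => by
        rw [← BimoduleTensor.smul_tmul, map_smul, RingHom.id_apply] } : M →ₗ[R] V)
  map_add' x y := ext fun m => (congrArg g (BimoduleTensor.tmul_add m x y)).trans (map_add g _ _)
  map_smul' r x := ext fun m => congrArg g (BimoduleTensor.tmul_smul m r x)

end LeftHom

variable [Module Rᵐᵒᵖ M] [SMulCommClass R Rᵐᵒᵖ M]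

/-- The iterates of `Hom_R(M, -)`. -/
def iterLeftHom (V : ModuleCat.{u} R) : ℕ → ModuleCat.{u} R
  | 0 => V
  | k + 1 => ModuleCat.of R (LeftHom R M (iterLeftHom V k))

/-- The iterates of `M ⊗_R -`. -/
def iterTensor : ℕ → ModuleCat.{u} R → ModuleCat.{u} R
  | 0, X => X
  | k + 1, X => iterTensor k (ModuleCat.of R (BimoduleTensor R M X))

/-- Iterated currying `Hom_R(M ⊗_R ⋯ ⊗_R M ⊗_R X, V) → Hom_R(X, Hom_R(M, ⋯ Hom_R(M, V)))`. -/
def iterCurry (V : ModuleCat.{u} R) : (k : ℕ) → (X : ModuleCat.{u} R) →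
    (iterTensor R M k X →ₗ[R] V) → (X →ₗ[R] iterLeftHom R M V k)
  | 0, _, g => g
  | k + 1, X, g => LeftHom.curry (iterCurry V k (ModuleCat.of R (BimoduleTensor R M X)) g)

variable {R M}

/-- The iterated transpose sends `x` to `m₁ ↦ ⋯ ↦ mₖ ↦ g (mₖ ⊗ ⋯ ⊗ m₁ ⊗ x)`, and an injective `g`
detects whether these tensors vanish. -/
lemma mem_vanishing_of_iterCurry_eq_zero (V : ModuleCat.{u} R) (k : ℕ) (X : ModuleCat.{u} R)
    (g : iterTensor R M k X →ₗ[R] V) (hg : Function.Injective g) (x : X)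
    (hx : iterCurry R M V k X g x = 0) : x ∈ vanishing R M k X := by
  induction k generalizing X with
  | zero => exact hg (hx.trans (map_zero g).symm)
  | succ k ih =>
    intro m
    refine ih (ModuleCat.of R (BimoduleTensor R M X)) g hg _ ?_
    exact congrArg (fun f : LeftHom R M (iterLeftHom R M V k) => f m) hx

/-- Sequences of elements of the iterates of `Hom_R(M, -)`. -/
abbrev LeftHomSeq (R : Type u) [Ring R] (M : Type u) [AddCommGroup M] [Module R M]
    [Module Rᵐᵒᵖ M] [SMulCommClass R Rᵐᵒᵖ M] (V : ModuleCat.{u} R) : Type u :=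
  ∀ k, iterLeftHom R M V k

namespace LeftHomSeq

variable {V : ModuleCat.{u} R}

variable (V) in
/-- The sequences which are eventually zero. -/
def eventuallyZero : Submodule ℤ (LeftHomSeq R M V) where
  carrier := {z | ∃ k, ∀ l, k ≤ l → z l = 0}
  zero_mem' := ⟨0, fun _ _ => rfl⟩
  add_mem' := by
    rintro z z' ⟨k, h⟩ ⟨k', h'⟩
    refine ⟨max k k', fun l hl => ?_⟩
    rw [Pi.add_apply, h l (le_of_max_le_left hl), h' l (le_of_max_le_right hl), add_zero]
  smul_mem' := by
    rintro a z ⟨k, h⟩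
    refine ⟨k, fun l hl => ?_⟩
    rw [Pi.smul_apply, h l hl, smul_zero]

variable (V) in
/-- The germs at infinity of sequences. -/
abbrev Germ : Type u := LeftHomSeq R M V ⧸ eventuallyZero (R := R) (M := M) V

/-- The action of an element of `R` on sequences. -/
def scalar (r : R) : LeftHomSeq R M V →ₗ[ℤ] LeftHomSeq R M V where
  toFun z := r • z
  map_add' := smul_add r
  map_smul' a z := smul_comm r a z

/-- The action of an element of `M` on sequences. -/
def eval (m : M) : LeftHomSeq R M V →ₗ[ℤ] LeftHomSeq R M V where
  toFun z k := (show LeftHom R M (iterLeftHom R M V k) from z (k + 1)) m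
  map_add' _ _ := rfl
  map_smul' _ _ := rfl

/-- The map `V → Hom_R(M, V)` given by an element `f` of `M^*`. -/
def coeval (f : LeftDual R M) {V : Type u} [AddCommGroup V] [Module R V] (z : V) :
    LeftHom R M V :=
  ({ toFun := fun m => f m • z
     map_add' := fun m m' => by rw [map_add, add_smul]
     map_smul' := fun r m => by
      rw [map_smul, smul_eq_mul, mul_smul, RingHom.id_apply] } : M →ₗ[R] V)

/-- The underlying function of `LeftHomSeq.dual`. -/
def dualFun (f : LeftDual R M) (z : LeftHomSeq R M V) : LeftHomSeq R M V
  -- No term precedes `z 0`, so zero is inserted. The relation `c = 1` can then fail at index `0`,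
  -- but nowhere else, which is why germs are used instead of sequences.
  | 0 => 0
  | k + 1 => coeval f (z k)

/-- The action of an element of `M^*` on sequences. -/
def dual (f : LeftDual R M) : LeftHomSeq R M V →ₗ[ℤ] LeftHomSeq R M V where
  toFun := dualFun f
  map_add' z z' := by
    funext k
    cases k with
    | zero => exact (add_zero _).symm
    | succ k => exact LeftHom.ext fun m => smul_add (f m) _ _
  map_smul' a z := by
    funext k
    cases k with
    | zero => exact (smul_zero a).symm
    | succ k => exact LeftHom.ext fun m => smul_comm (f m) a (z k)

lemma eventuallyZero_le_comap_scalar (r : R) :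
    eventuallyZero V ≤ (eventuallyZero V).comap (scalar (M := M) r) := by
  rintro z ⟨k, h⟩
  refine ⟨k, fun l hl => ?_⟩
  exact (congrArg (r • ·) (h l hl)).trans (smul_zero r)

lemma eventuallyZero_le_comap_eval (m : M) :
    eventuallyZero V ≤ (eventuallyZero V).comap (eval (R := R) m) := by
  rintro z ⟨k, h⟩
  refine ⟨k, fun l hl => ?_⟩
  exact congrArg (fun f : LeftHom R M (iterLeftHom R M V l) => f m) (h (l + 1) (by omega))

lemma eventuallyZero_le_comap_dual (f : LeftDual R M) :
    eventuallyZero V ≤ (eventuallyZero V).comap (dual f) := by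
  rintro z ⟨k, h⟩
  refine ⟨k + 1, fun l hl => ?_⟩
  obtain ⟨l, rfl⟩ : ∃ l', l = l' + 1 := ⟨l - 1, by omega⟩
  exact LeftHom.ext fun m => (congrArg (f m • ·) (h l (by omega))).trans (smul_zero _)

/-- An endomorphism of the group of sequences which preserves the eventually zero sequences
induces an endomorphism of the group of germs. -/
def germEnd (e : LeftHomSeq R M V →ₗ[ℤ] LeftHomSeq R M V)
    (he : eventuallyZero V ≤ (eventuallyZero V).comap e) :
    Module.End ℤ (Germ (R := R) (M := M) V) :=
  Submodule.mapQ _ _ e he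

lemma end_ext {f g : Module.End ℤ (Germ (R := R) (M := M) V)}
    (h : ∀ z : LeftHomSeq R M V, f (Submodule.Quotient.mk z) = g (Submodule.Quotient.mk z)) :
    f = g :=
  Submodule.linearMap_qext _ (LinearMap.ext h)

variable (V) in
/-- The action of the Leavitt ring on germs of sequences. -/
def germAction : LeavittRing R M →+* Module.End ℤ (Germ (R := R) (M := M) V) :=
  LeavittRing.lift
    { toFun := fun r => germEnd (scalar r) (eventuallyZero_le_comap_scalar r)
      map_one' := end_ext fun z => congrArg Submodule.Quotient.mk (one_smul R z)
      map_mul' := fun r s => end_ext fun z => congrArg Submodule.Quotient.mk (mul_smul r s z)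
      map_zero' := end_ext fun z => congrArg Submodule.Quotient.mk (zero_smul R z)
      map_add' := fun r s => end_ext fun z => congrArg Submodule.Quotient.mk (add_smul r s z) }
    (AddMonoidHom.mk' (fun m => germEnd (eval m) (eventuallyZero_le_comap_eval m))
      (fun m m' => end_ext fun z => congrArg Submodule.Quotient.mk (funext fun k =>
        map_add (show LeftHom R M (iterLeftHom R M V k) from z (k + 1)) m m')))
    (AddMonoidHom.mk' (fun f => germEnd (dual f) (eventuallyZero_le_comap_dual f))
      (fun f f' => end_ext fun z => congrArg Submodule.Quotient.mk (funext fun k => by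
        cases k with
        | zero => exact (add_zero _).symm
        | succ k => exact LeftHom.ext fun m => add_smul (f m) (f' m) (z k))))
    (fun r m => end_ext fun z => congrArg Submodule.Quotient.mk (funext fun k =>
      map_smul (show LeftHom R M (iterLeftHom R M V k) from z (k + 1)) r m))
    (fun r m => end_ext fun z => rfl)
    (fun r f => end_ext fun z => congrArg Submodule.Quotient.mk (funext fun k => by
      cases k with
      | zero => exact (smul_zero r).symm
      | succ k => rfl))
    (fun r f => end_ext fun z => congrArg Submodule.Quotient.mk (funext fun k => by
      cases k with
      | zero => rfl
      | succ k => exact LeftHom.ext fun m => mul_smul (f m) r (z k)))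
    (fun m f => end_ext fun z => rfl)
    (fun n α α' h => end_ext fun z => by
      rw [LinearMap.sum_apply]
      refine Eq.trans (b := Submodule.Quotient.mk (∑ j, dual (α' j) (eval (α j) z)))
        (map_sum (Submodule.mkQ (eventuallyZero V)) _ _).symm ?_
      -- From index `1` on, `∑ α_j^* (α_j z) = z` is the dual basis expansion of the argument `m`.
      refine (Submodule.Quotient.eq _).2 ⟨1, fun l hl => ?_⟩
      obtain ⟨l, rfl⟩ : ∃ l', l = l' + 1 := ⟨l - 1, by omega⟩
      rw [Pi.sub_apply, sub_eq_zero, Finset.sum_apply]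
      let w : LeftHom R M (iterLeftHom R M V l) := z (l + 1)
      change ∑ j, coeval (α' j) (w (α j)) = w
      refine LeftHom.ext fun m => ?_
      let ev : LeftHom R M (iterLeftHom R M V l) →+ iterLeftHom R M V l :=
        AddMonoidHom.mk' (fun f => f m) (fun _ _ => rfl)
      refine (map_sum ev _ _).trans ?_
      conv_rhs => rw [← h m, map_sum]
      exact Finset.sum_congr rfl fun j _ => (map_smul w (α' j m) (α j)).symm)

end LeftHomSeq

end Coinduced

section

variable {R : Type u} [Ring R] {M : Type u} [AddCommGroup M] [Module R M] [Module Rᵐᵒᵖ M]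
  [SMulCommClass R Rᵐᵒᵖ M]

/-- The kernel of the canonical map `X → L_R(M) ⊗_R X`. -/
lemma exists_mem_vanishing_of_ι_eq_zero {X : Type u} [AddCommGroup X] [Module R X] {x : X}
    (hx : ScalarExt.ι (LeavittRing.of R M) x = 0) : ∃ k, x ∈ vanishing R M k X := by
  -- One `V` has to serve for all `k`, since the exponent is not known beforehand; the product
  -- contains every iterate `M ⊗ ⋯ ⊗ M ⊗ X`.
  let V : ModuleCat.{u} R := ModuleCat.of R (∀ k, iterTensor R M k (ModuleCat.of R X))
  let : Module (LeavittRing R M) (LeftHomSeq.Germ (R := R) (M := M) V) :=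
    Module.compHom _ (LeftHomSeq.germAction (R := R) (M := M) V)
  let c : ∀ k, X →ₗ[R] iterLeftHom R M V k := fun k =>
    iterCurry R M V k (ModuleCat.of R X)
      (LinearMap.single R (fun k => iterTensor R M k (ModuleCat.of R X)) k)
  let g : X →ₛₗ[LeavittRing.of R M] LeftHomSeq.Germ (R := R) (M := M) V :=
    { toFun := fun x => Submodule.Quotient.mk (fun k => c k x)
      map_add' := fun x y => congrArg Submodule.Quotient.mk (funext fun k => map_add (c k) x y)
      map_smul' := fun r x => by
        change _ = LeftHomSeq.germAction (R := R) (M := M) V (LeavittRing.of R M r) _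
        rw [LeftHomSeq.germAction, LeavittRing.lift_of]
        exact congrArg Submodule.Quotient.mk (funext fun k => map_smul (c k) r x) }
  -- The semilinear map `g` factors through `ι`, so the sequence attached to `x` is eventually zero.
  have h : g x = 0 := by rw [← ScalarExt.lift_ι g x, hx, map_zero]
  obtain ⟨k, hk⟩ := (Submodule.Quotient.mk_eq_zero _).1 h
  refine ⟨k, mem_vanishing_of_iterCurry_eq_zero V k (ModuleCat.of R X) _ ?_ x (hk k le_rfl)⟩
  exact Pi.single_injective (M := fun k => iterTensor R M k (ModuleCat.of R X)) k

end

/-! ### Full faithfulness -/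

/-- This extracts one number of loops valid for a whole finitely generated module. Eventual
membership lets finitely many generators be treated together without monotonicity of `p`. -/
lemma Submodule.FG.exists_le_of_eventually_mem {R X : Type*} [Ring R] [AddCommGroup X]
    [Module R X] {N : Submodule R X} (hN : N.FG) (p : ℕ → Submodule R X)
    (h : ∀ x ∈ N, ∀ᶠ k in Filter.atTop, x ∈ p k) : ∃ k, N ≤ p k := by
  obtain ⟨s, rfl⟩ := hN
  have : ∀ᶠ k in Filter.atTop, ∀ x ∈ s, x ∈ p k :=
    (Filter.eventually_all_finset s).2 fun x hx => h x (Submodule.subset_span hx)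
  obtain ⟨k, hk⟩ := this.exists
  exact ⟨k, Submodule.span_le.2 hk⟩

namespace LeavittRing

variable {R : Type u} [Ring R] {M : Type u} [AddCommGroup M] [Module R M]
  [Module Rᵐᵒᵖ M] [SMulCommClass R Rᵐᵒᵖ M]

/-! ### Paths: products of elements of `M` in the Leavitt ring -/

section Paths

variable (R M)

/-- The image of `M` in the Leavitt ring. -/
def vecRange : Submodule ℤ (LeavittRing R M) := LinearMap.range (ofVec R M).toIntLinearMap

/-- The image of `R` in the Leavitt ring. -/
def baseRange : Submodule ℤ (LeavittRing R M) :=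
  LinearMap.range (of R M).toAddMonoidHom.toIntLinearMap

/-- The additive group generated by the elements `m₁ ⋯ mₖ r` of the Leavitt ring. -/
def paths (k : ℕ) : Submodule ℤ (LeavittRing R M) := vecRange R M ^ k * baseRange R M

lemma vecRange_mul_baseRange : vecRange R M * baseRange R M = vecRange R M := by
  refine le_antisymm (Submodule.mul_le.2 ?_) ?_
  · rintro _ ⟨m, rfl⟩ _ ⟨r, rfl⟩
    exact ⟨op r • m, ofVec_op_smul r m⟩
  · rintro _ ⟨m, rfl⟩
    rw [← mul_one ((ofVec R M).toIntLinearMap m)]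
    exact Submodule.mul_mem_mul ⟨m, rfl⟩ ⟨1, map_one (of R M)⟩

lemma baseRange_mul_vecRange : baseRange R M * vecRange R M = vecRange R M := by
  refine le_antisymm (Submodule.mul_le.2 ?_) ?_
  · rintro _ ⟨r, rfl⟩ _ ⟨m, rfl⟩
    exact ⟨r • m, ofVec_smul r m⟩
  · rintro _ ⟨m, rfl⟩
    rw [← one_mul ((ofVec R M).toIntLinearMap m)]
    exact Submodule.mul_mem_mul ⟨1, map_one (of R M)⟩ ⟨m, rfl⟩

lemma baseRange_mul_baseRange : baseRange R M * baseRange R M ≤ baseRange R M := by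
  refine Submodule.mul_le.2 ?_
  rintro _ ⟨r, rfl⟩ _ ⟨s, rfl⟩
  exact ⟨r * s, map_mul (of R M) r s⟩

lemma paths_zero : paths R M 0 = baseRange R M := by rw [paths, pow_zero, one_mul]

lemma paths_succ (k : ℕ) : paths R M (k + 1) = vecRange R M * paths R M k := by
  rw [paths, paths, pow_succ', mul_assoc]

/-- Scalars between vectors are absorbed by the bimodule structure of `M`, so paths can be prolonged
at either end. -/
lemma paths_succ' (k : ℕ) : paths R M (k + 1) = paths R M k * vecRange R M := by
  rw [paths, paths, pow_succ, mul_assoc, mul_assoc, vecRange_mul_baseRange,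
    baseRange_mul_vecRange]

variable {R M}

lemma ofVec_mem (m : M) : ofVec R M m ∈ vecRange R M := ⟨m, rfl⟩

lemma of_mem_paths (r : R) : of R M r ∈ paths R M 0 := by
  rw [paths_zero]
  exact ⟨r, rfl⟩

lemma one_mem_paths : (1 : LeavittRing R M) ∈ paths R M 0 := by
  rw [← map_one (of R M)]
  exact of_mem_paths 1

lemma mul_of_mem_paths {k : ℕ} {v : LeavittRing R M} (hv : v ∈ paths R M k) (r : R) :
    v * of R M r ∈ paths R M k := by
  have := Submodule.mul_mem_mul hv (show of R M r ∈ baseRange R M from ⟨r, rfl⟩)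
  rw [paths, mul_assoc] at this
  exact mul_le_mul' le_rfl (baseRange_mul_baseRange R M) this

lemma mul_ofVec_mem_paths {k : ℕ} {v : LeavittRing R M} (hv : v ∈ paths R M k) (m : M) :
    v * ofVec R M m ∈ paths R M (k + 1) := by
  rw [paths_succ']
  exact Submodule.mul_mem_mul hv (ofVec_mem m)

/-- A further vector on the left does not interfere with multiplication by `a` on the right, so any
bound on path lengths may be prolonged. -/
lemma paths_mul_mem_succ {k l : ℕ} {a : LeavittRing R M}
    (h : ∀ v ∈ paths R M k, v * a ∈ paths R M l) :
    ∀ v ∈ paths R M (k + 1), v * a ∈ paths R M (l + 1) := by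
  intro v hv
  rw [paths_succ] at hv ⊢
  induction hv using Submodule.mul_induction_on' with
  | mem_mul_mem m hm v hv =>
    rw [mul_assoc]
    exact Submodule.mul_mem_mul hm (h v hv)
  | add v _ w _ hv hw => rw [add_mul]; exact add_mem hv hw

lemma paths_mul_mem_add {k l : ℕ} {a : LeavittRing R M}
    (h : ∀ v ∈ paths R M k, v * a ∈ paths R M l) (j : ℕ) :
    ∀ v ∈ paths R M (k + j), v * a ∈ paths R M (l + j) := by
  induction j with
  | zero => exact h
  | succ j ih => exact paths_mul_mem_succ ih

/-- Left multiplication by long paths moves the homogeneous elements into paths. -/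
lemma exists_paths_mul_mem {i : ℤ} {a : LeavittRing R M} (ha : a ∈ component R M i) :
    ∃ k l : ℕ, (k : ℤ) = l + i ∧ ∀ v ∈ paths R M k, v * a ∈ paths R M l := by
  induction ha using AddSubgroup.closure_induction with
  | mem a ha =>
    induction ha with
    | of r => exact ⟨0, 0, by simp, fun v hv => mul_of_mem_paths hv r⟩
    | ofVec x => exact ⟨0, 1, by simp, fun v hv => mul_ofVec_mem_paths hv x⟩
    -- One vector cancels the functional, by `m f = f(m)`.
    | ofDual f =>
      refine ⟨1, 0, by simp, fun v hv => ?_⟩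
      rw [paths_succ, paths_zero, vecRange_mul_baseRange] at hv
      obtain ⟨m, rfl⟩ := hv
      change ofVec R M m * _ ∈ _
      rw [ofVec_mul_ofDual]
      exact of_mem_paths _
    | mul _ _ iha ihb =>
      obtain ⟨k, l, hkl, h⟩ := iha
      obtain ⟨k', l', hkl', h'⟩ := ihb
      -- The factor `a` is passed with prolongation `k'`, leaving paths of length `l + k'`; these
      -- pass `b` with prolongation `l`.
      refine ⟨k + k', l' + l, by push_cast; omega, fun v hv => ?_⟩
      rw [← mul_assoc]
      refine paths_mul_mem_add h' l _ ?_
      rw [add_comm]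
      exact paths_mul_mem_add h k' v hv
  -- Any naturals with difference `i` serve; the positive and negative parts of `i` are such a pair.
  | zero => exact ⟨i.toNat, (-i).toNat, by omega, fun v _ => by
      rw [mul_zero]; exact zero_mem _⟩
  | neg a _ ih =>
    obtain ⟨k, l, hkl, h⟩ := ih
    exact ⟨k, l, hkl, fun v hv => by rw [mul_neg]; exact neg_mem (h v hv)⟩
  | add a b _ _ iha ihb =>
    obtain ⟨k, l, hkl, h⟩ := iha
    obtain ⟨k', l', hkl', h'⟩ := ihb
    refine ⟨k + k', l + k', by push_cast; omega, fun v hv => ?_⟩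
    rw [mul_add]
    refine add_mem (paths_mul_mem_add h k' v hv) ?_
    have := paths_mul_mem_add h' k v (by rwa [add_comm])
    rwa [show l' + k = l + k' by omega] at this

end Paths

open ScalarExt

/-! ### Elements of `L_R(M) ⊗_R X` spanned by paths -/

section PathSpan

variable {X : Type u} [AddCommGroup X] [Module R X]

variable (M X) in
/-- The subgroup of `L_R(M) ⊗_R X` generated by the elements `m₁ ⋯ mₖ ⊗ x`. -/
def pathSpan (k : ℕ) : AddSubgroup (ScalarExt (of R M) X) :=
  AddSubgroup.closure {t | ∃ v ∈ paths R M k, ∃ x : X, t = v • ι (of R M) x}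

lemma mem_pathSpan_zero {t : ScalarExt (of R M) X} (ht : t ∈ pathSpan M X 0) :
    ∃ x, t = ι (of R M) x := by
  induction ht using AddSubgroup.closure_induction with
  | mem t ht =>
    obtain ⟨v, hv, x, rfl⟩ := ht
    rw [paths_zero] at hv
    obtain ⟨r, rfl⟩ := hv
    exact ⟨r • x, (map_smulₛₗ (ι (of R M)) r x).symm⟩
  | zero => exact ⟨0, (_root_.map_zero _).symm⟩
  | add s t _ _ hs ht =>
    obtain ⟨x, rfl⟩ := hs
    obtain ⟨y, rfl⟩ := ht
    exact ⟨x + y, (_root_.map_add _ _ _).symm⟩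
  | neg t _ ht =>
    obtain ⟨x, rfl⟩ := ht
    exact ⟨-x, (_root_.map_neg _ _).symm⟩

/-- Left multiplication by long paths moves the homogeneous elements into the span of paths. -/
lemma exists_paths_smul_mem {n i : ℤ} {t : ScalarExt (of R M) X}
    (ht : t ∈ ScalarExt.component (of R M) (component R M) n X i) :
    ∃ k l : ℕ, (k : ℤ) = l + (i + n) ∧
      ∀ j, ∀ v ∈ paths R M (k + j), v • t ∈ pathSpan M X (l + j) := by
  induction ht using AddSubgroup.closure_induction with
  | mem t ht =>
    obtain ⟨a, ha, x, rfl⟩ := ht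
    obtain ⟨k, l, hkl, h⟩ := exists_paths_mul_mem ha
    refine ⟨k, l, hkl, fun j v hv => ?_⟩
    rw [smul_smul]
    exact AddSubgroup.subset_closure ⟨_, paths_mul_mem_add h j v hv, x, rfl⟩
  | zero => exact ⟨(i + n).toNat, (-(i + n)).toNat, by omega, fun j v _ => by
      rw [smul_zero]; exact zero_mem _⟩
  | neg a _ ih =>
    obtain ⟨k, l, hkl, h⟩ := ih
    exact ⟨k, l, hkl, fun j v hv => by rw [smul_neg]; exact neg_mem (h j v hv)⟩
  | add a b _ _ iha ihb =>
    obtain ⟨k, l, hkl, h⟩ := iha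
    obtain ⟨k', l', hkl', h'⟩ := ihb
    refine ⟨k + k', l + k', by push_cast; omega, fun j v hv => ?_⟩
    rw [smul_add, add_assoc]
    refine add_mem (h (k' + j) v (by rwa [← add_assoc])) ?_
    have := h' (k + j) v (by rwa [← add_assoc, add_comm k'])
    rwa [show l' + (k + j) = l + (k' + j) by omega] at this

variable [Module.Finite R M] [Module.Projective R M]

/-- The last vector of a path moves into the module, `v m ⊗ x ↦ v ⊗ (m ⊗ x)`; each loop thus
shortens paths by one. -/
lemma absorb_symm_mem_pathSpan {k : ℕ} {t : ScalarExt (of R M) X}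
    (ht : t ∈ pathSpan M X (k + 1)) :
    (absorb R M X).symm t ∈ pathSpan M (BimoduleTensor R M X) k := by
  induction ht using AddSubgroup.closure_induction with
  | mem t ht =>
    obtain ⟨v, hv, x, rfl⟩ := ht
    rw [paths_succ'] at hv
    induction hv using Submodule.mul_induction_on' with
    | mem_mul_mem v hv m hm =>
      obtain ⟨m, rfl⟩ := hm
      change (absorb R M X).symm ((v * ofVec R M m) • _) ∈ _
      rw [mul_smul, ← absorb_ι, map_smul, LinearEquiv.symm_apply_apply]
      exact AddSubgroup.subset_closure ⟨v, hv, _, rfl⟩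
    | add v _ w _ hv hw => rw [add_smul, _root_.map_add]; exact add_mem hv hw
  | zero => rw [_root_.map_zero]; exact zero_mem _
  | add s t _ _ hs ht => rw [_root_.map_add]; exact add_mem hs ht
  | neg t _ ht => rw [_root_.map_neg]; exact neg_mem ht

/-- The easy half of the description of the kernel: under `absorb`, `m ι(x)` corresponds to `ι(m ⊗
x)`, and the elements `m ι(x)` determine `ι(x)`. -/
lemma ι_eq_zero_of_mem_vanishing {k : ℕ} {X : Type u} [AddCommGroup X] [Module R X] {x : X}
    (hx : x ∈ vanishing R M k X) : ι (of R M) x = 0 := by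
  induction k generalizing X with
  | zero => rw [mem_vanishing_zero.1 hx, _root_.map_zero]
  | succ k ih =>
    refine ext_ofVec_smul (R := R) (M := M) fun m => ?_
    rw [← absorb_ι, ih (mem_vanishing_succ.1 hx m), _root_.map_zero, smul_zero]

end PathSpan

section ToExt

variable {n m p : ℤ} {X Y Z : FPModuleCat R}

/-- The underlying linear map of a morphism between induced modules. -/
def toExt (φ : (ind R M n).obj X ⟶ (ind R M m).obj Y) :
    ScalarExt (of R M) X.obj →ₗ[LeavittRing R M] ScalarExt (of R M) Y.obj :=
  φ.hom.toLinearMap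

lemma toExt_map (f : X ⟶ Y) (x : X.obj) :
    toExt ((ind R M n).map f) (ι (of R M) x) = ι (of R M) (f.hom.hom x) :=
  functor_map_ι _ _ _ _ _

lemma toExt_ext {φ ψ : (ind R M n).obj X ⟶ (ind R M m).obj Y}
    (h : ∀ x, toExt φ (ι (of R M) x) = toExt ψ (ι (of R M) x)) : φ = ψ :=
  ObjectProperty.hom_ext _ (graded_hom_ext (hφ := of_mem_component) h)

lemma toExt_ι_mem (φ : (ind R M n).obj X ⟶ (ind R M m).obj Y) (x : X.obj) :
    toExt φ (ι (of R M) x) ∈ ScalarExt.component (of R M) (component R M) m Y.obj (-n) :=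
  φ.hom.map_mem (-n) _ (ι_mem_component x)

end ToExt

variable [Module.Finite R M] [Module.Projective R M]

/-- A loop replaces `f` and `g` by `M ⊗ f` and `M ⊗ g` and lowers `k` by one; at `k = 0` the
morphisms coincide. -/
lemma single_eq_of_sub_mem_vanishing (k : ℕ) (n : ℤ) {X Y : FPModuleCat R} (f g : X ⟶ Y)
    (h : ∀ x, f.hom.hom x - g.hom.hom x ∈ vanishing R M k Y.obj) :
    (Stabilization.single n f : (⟨X, n⟩ : Stabilization (tensorEndofunctor R M)) ⟶ ⟨Y, n⟩) =
      Stabilization.single n g := by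
  induction k generalizing n X Y with
  | zero =>
    congr 1
    ext x
    exact sub_eq_zero.1 (h x)
  | succ k ih =>
    rw [Stabilization.single_conj f n _ rfl, Stabilization.single_conj g n _ rfl]
    rw [ih (n + 1) ((tensorEndofunctor R M).map f) ((tensorEndofunctor R M).map g)]
    intro t
    change BimoduleTensor.map R M f.hom.hom t - BimoduleTensor.map R M g.hom.hom t ∈
      vanishing R M k (BimoduleTensor R M Y.obj)
    induction t using BimoduleTensor.induction with
    | h0 => simp
    | ht m x =>
      have := mem_vanishing_succ.1 (h x) m
      rwa [BimoduleTensor.map_tmul, BimoduleTensor.map_tmul, sub_eq_iff_eq_add.2]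
      rw [← BimoduleTensor.tmul_add, sub_add_cancel]
    | ha s t hs ht =>
      rw [_root_.map_add, _root_.map_add, add_sub_add_comm]
      exact add_mem hs ht

/-- Each difference `f x - g x` lies in the kernel of `ι`, and finite generation of `X` yields one
`k` for all `x`. -/
instance stabilizationInd_faithful : (stabilizationInd R M).Faithful := by
  refine Stabilization.lift_faithful fun n X Y f g h => ?_
  have := X.property
  have key : ∀ x, ι (of R M) ((f.hom.hom - g.hom.hom) x) = 0 := by
    intro x
    rw [LinearMap.sub_apply, _root_.map_sub, ← toExt_map (n := n), ← toExt_map (n := n), h,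
      sub_self]
  obtain ⟨k, hk⟩ := (Module.Finite.fg_top (R := R) (M := X.obj)).exists_le_of_eventually_mem
    (fun k => (vanishing R M k Y.obj).comap (f.hom.hom - g.hom.hom)) (fun x _ => by
      obtain ⟨k, hk⟩ := exists_mem_vanishing_of_ι_eq_zero (key x)
      exact Filter.eventually_atTop.2 ⟨k, fun l hl => vanishing_mono hl hk⟩)
  exact single_eq_of_sub_mem_vanishing k n f g fun x => hk (Submodule.mem_top (x := x))

/-- The conjugate of a morphism between induced modules by the loop isomorphisms. -/
noncomputable def conjLoop (n : ℤ) {X Y : FPModuleCat R}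
    (φ : (ind R M n).obj X ⟶ (ind R M n).obj Y) :
    (ind R M (n + 1)).obj ((tensorEndofunctor R M).obj X) ⟶
      (ind R M (n + 1)).obj ((tensorEndofunctor R M).obj Y) :=
  (indLoopIso R M n (n + 1) rfl).inv.app X ≫ φ ≫ (indLoopIso R M n (n + 1) rfl).hom.app Y

/-- The conjugate of a linear map between induced modules by the isomorphisms `absorb`. -/
noncomputable def conjExt {X Y : Type u} [AddCommGroup X] [Module R X] [AddCommGroup Y]
    [Module R Y] (φ : ScalarExt (of R M) X →ₗ[LeavittRing R M] ScalarExt (of R M) Y) :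
    ScalarExt (of R M) (BimoduleTensor R M X) →ₗ[LeavittRing R M]
      ScalarExt (of R M) (BimoduleTensor R M Y) :=
  (absorb R M Y).symm.toLinearMap ∘ₗ φ ∘ₗ (absorb R M X).toLinearMap

lemma conjExt_tmul {X Y : Type u} [AddCommGroup X] [Module R X] [AddCommGroup Y]
    [Module R Y] (φ : ScalarExt (of R M) X →ₗ[LeavittRing R M] ScalarExt (of R M) Y)
    (m : M) (x : X) :
    conjExt φ (ι (of R M) (BimoduleTensor.tmul R m x)) =
      (absorb R M Y).symm (ofVec R M m • φ (ι (of R M) x)) := by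
  rw [← map_smul, ← absorb_ι]
  rfl

lemma toExt_conjLoop {n : ℤ} {X Y : FPModuleCat R} (φ : (ind R M n).obj X ⟶ (ind R M n).obj Y) :
    toExt (conjLoop n φ) = conjExt (toExt φ) := rfl

/-- A morphism lifts as soon as its conjugate one loop further does; the inductions below trade
loops for a simpler morphism. -/
lemma exists_map_eq_of_conjLoop {n : ℤ} {X Y : FPModuleCat R}
    (φ : (ind R M n).obj X ⟶ (ind R M n).obj Y)
    (h : ∃ ψ : (⟨(tensorEndofunctor R M).obj X, n + 1⟩ : Stabilization (tensorEndofunctor R M)) ⟶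
      ⟨(tensorEndofunctor R M).obj Y, n + 1⟩, (stabilizationInd R M).map ψ = conjLoop n φ) :
    ∃ ψ : (⟨X, n⟩ : Stabilization (tensorEndofunctor R M)) ⟶ ⟨Y, n⟩,
      (stabilizationInd R M).map ψ = φ := by
  refine Stabilization.exists_lift_map_eq (F := ind R M) (θ := indLoopIso R M)
    (Stabilization.shiftIso X n _ rfl)
    (Stabilization.shiftIso Y n _ rfl) φ ?_
  rw [Stabilization.lift_map_shiftIso_hom, Stabilization.lift_map_shiftIso_inv]
  exact h

/-- Here `φ` comes from a map of `R`-modules defined only up to elements that vanish after `l`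
loops. Tensoring with `M` carries the ambiguity `vanishing (l + 1)` of `Y` into `vanishing l` of `M
⊗ Y`, so after `l` loops an honest morphism remains. -/
lemma exists_map_eq_of_quotient (l : ℕ) (n : ℤ) {X Y : FPModuleCat R}
    (φ : (ind R M n).obj X ⟶ (ind R M n).obj Y) (h : X.obj →ₗ[R] Y.obj ⧸ vanishing R M l Y.obj)
    (hh : ∀ x y, (vanishing R M l Y.obj).mkQ y = h x → toExt φ (ι (of R M) x) = ι (of R M) y) :
    ∃ ψ : (⟨X, n⟩ : Stabilization (tensorEndofunctor R M)) ⟶ ⟨Y, n⟩,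
      (stabilizationInd R M).map ψ = φ := by
  induction l generalizing n X Y with
  | zero =>
    let e := (vanishing R M 0 Y.obj).quotEquivOfEqBot rfl
    refine ⟨Stabilization.single n
      (ObjectProperty.homMk (ModuleCat.ofHom (e.toLinearMap ∘ₗ h))), ?_⟩
    rw [Stabilization.lift_map_single]
    refine toExt_ext fun x => ?_
    rw [toExt_map, hh x (e (h x))]
    · rfl
    · exact e.symm_apply_apply (h x)
  | succ l ih =>
    apply exists_map_eq_of_conjLoop
    let V := vanishing R M l (BimoduleTensor R M Y.obj)
    have key : ∀ (m : M) (y y' : Y.obj),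
        (vanishing R M (l + 1) Y.obj).mkQ y = (vanishing R M (l + 1) Y.obj).mkQ y' →
        V.mkQ (BimoduleTensor.tmul R m y) = V.mkQ (BimoduleTensor.tmul R m y') := by
      intro m y y' hy
      refine (Submodule.Quotient.eq _).2 ?_
      have := mem_vanishing_succ.1 ((Submodule.Quotient.eq _).1 hy) m
      rwa [sub_eq_iff_eq_add.2]
      rw [← BimoduleTensor.tmul_add, sub_add_cancel]
    -- By `key`, the class of `m ⊗ σ z` does not depend on the chosen representative of `z`, so an
    -- arbitrary section suffices.
    let σ := Function.surjInv (vanishing R M (l + 1) Y.obj).mkQ_surjective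
    have hσ : ∀ z, (vanishing R M (l + 1) Y.obj).mkQ (σ z) = z :=
      Function.surjInv_eq (vanishing R M (l + 1) Y.obj).mkQ_surjective
    let h' : BimoduleTensor R M X.obj →ₗ[R] BimoduleTensor R M Y.obj ⧸ V :=
      BimoduleTensor.lift
        { toFun := fun m => AddMonoidHom.mk'
            (fun x => V.mkQ (BimoduleTensor.tmul R m (σ (h x)))) (fun x x' => by
              rw [← _root_.map_add, ← BimoduleTensor.tmul_add]
              exact key _ _ _ (by simp only [_root_.map_add, hσ]))
          map_add' := fun m m' => by
            ext x
            simp only [AddMonoidHom.mk'_apply, AddMonoidHom.add_apply, BimoduleTensor.add_tmul,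
              _root_.map_add]
          map_smul' := fun r m => by
            ext x
            exact map_smul V.mkQ r (BimoduleTensor.tmul R m (σ (h x))) }
        (fun m r x => by
          change V.mkQ (BimoduleTensor.tmul R (op r • m) (σ (h x))) =
            V.mkQ (BimoduleTensor.tmul R m (σ (h (r • x))))
          rw [← BimoduleTensor.tmul_smul]
          exact key _ _ _ (by simp only [map_smul, hσ]))
    have lem : ∀ t, ∃ t', V.mkQ t' = h' t ∧
        conjExt (toExt φ) (ι (of R M) t) = ι (of R M) t' := by
      intro t
      induction t using BimoduleTensor.induction with
      | h0 => exact ⟨0, by simp, by simp⟩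
      | ht m x =>
        refine ⟨BimoduleTensor.tmul R m (σ (h x)), rfl, ?_⟩
        rw [conjExt_tmul, hh x (σ (h x)) (hσ _), ← absorb_ι, LinearEquiv.symm_apply_apply]
      | ha s t hs ht =>
        obtain ⟨s', hs, hs'⟩ := hs
        obtain ⟨t', ht, ht'⟩ := ht
        exact ⟨s' + t', by rw [_root_.map_add, hs, ht, _root_.map_add],
          by rw [_root_.map_add, _root_.map_add, hs', ht', _root_.map_add]⟩
    refine ih (n + 1) (conjLoop n φ) h' fun (t : BimoduleTensor R M X.obj)
      (t' : BimoduleTensor R M Y.obj) ht => ?_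
    change conjExt (toExt φ) (ι (of R M) t) = ι (of R M) t'
    -- The induction hypothesis asks about every lift of `h' t`; two lifts differ by an element of
    -- `V`, which `ι` kills.
    obtain ⟨t₀, ht₀, e⟩ := lem t
    refine e.trans (sub_eq_zero.1 ?_)
    rw [← _root_.map_sub]
    exact ι_eq_zero_of_mem_vanishing ((Submodule.Quotient.eq _).1 (ht₀.trans ht.symm))

/-- Lift `φ` on finitely many generators of `X`. The relations of `X` are finitely generated and
land in the kernel of `ι`, hence in `vanishing l` for a common `l`, so the lift descends to a map
from `X` to `Y` modulo `vanishing l`. -/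
lemma exists_map_eq_of_mem_range (n : ℤ) {X Y : FPModuleCat R}
    (φ : (ind R M n).obj X ⟶ (ind R M n).obj Y)
    (hφ : ∀ x, ∃ y, toExt φ (ι (of R M) x) = ι (of R M) y) :
    ∃ ψ : (⟨X, n⟩ : Stabilization (tensorEndofunctor R M)) ⟶ ⟨Y, n⟩,
      (stabilizationInd R M).map ψ = φ := by
  have := X.property
  obtain ⟨s, K, e, hK⟩ := Module.FinitePresentation.exists_fin R X.obj
  let π : (Fin s → R) →ₗ[R] X.obj := e.symm.toLinearMap ∘ₗ K.mkQ
  choose y hy using hφ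
  let g : (Fin s → R) →ₗ[R] Y.obj := Fintype.linearCombination R fun i => y (π (Pi.single i 1))
  have hg : ∀ v, toExt φ (ι (of R M) (π v)) = ι (of R M) (g v) := by
    intro v
    conv_lhs => rw [pi_eq_sum_univ' v]
    simp only [g, Fintype.linearCombination_apply, map_sum, map_smulₛₗ, RingHom.id_apply]
    refine Finset.sum_congr rfl fun i _ => ?_
    rw [← hy]
  obtain ⟨l, hl⟩ := hK.exists_le_of_eventually_mem
    (fun k => (vanishing R M k Y.obj).comap g) (fun v hv => by
      have : π v = 0 := by
        change e.symm (K.mkQ v) = 0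
        rw [Submodule.mkQ_apply, (Submodule.Quotient.mk_eq_zero K).2 hv, _root_.map_zero]
      obtain ⟨k, hk⟩ := exists_mem_vanishing_of_ι_eq_zero (M := M) (x := g v) (by
        rw [← hg, this, _root_.map_zero, _root_.map_zero])
      exact Filter.eventually_atTop.2 ⟨k, fun l hl => vanishing_mono hl hk⟩)
  refine exists_map_eq_of_quotient l n φ (K.mapQ _ g hl ∘ₗ e.toLinearMap) fun x z hz => ?_
  obtain ⟨v, hv⟩ := K.mkQ_surjective (e x)
  obtain rfl : π v = x := by
    change e.symm (K.mkQ v) = x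
    rw [hv, LinearEquiv.symm_apply_apply]
  rw [hg]
  refine sub_eq_zero.1 ?_
  rw [← _root_.map_sub]
  refine ι_eq_zero_of_mem_vanishing (k := l) ((Submodule.Quotient.eq _).1 ?_)
  rw [LinearMap.comp_apply, LinearEquiv.coe_coe, ← hv] at hz
  exact hz.symm

/-- Every loop uses up one vector of the paths; at `k = 0` the image of `X` is carried into the
image of `Y`. -/
lemma exists_map_eq_of_paths (k : ℕ) (n : ℤ) {X Y : FPModuleCat R}
    (φ : (ind R M n).obj X ⟶ (ind R M n).obj Y)
    (hφ : ∀ x, ∀ v ∈ paths R M k, v • toExt φ (ι (of R M) x) ∈ pathSpan M Y.obj k) :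
    ∃ ψ : (⟨X, n⟩ : Stabilization (tensorEndofunctor R M)) ⟶ ⟨Y, n⟩,
      (stabilizationInd R M).map ψ = φ := by
  induction k generalizing n X Y with
  | zero =>
    refine exists_map_eq_of_mem_range n φ fun x => mem_pathSpan_zero ?_
    have := hφ x 1 one_mem_paths
    rwa [one_smul] at this
  | succ k ih =>
    refine exists_map_eq_of_conjLoop φ (ih (n + 1) (conjLoop n φ) fun t v hv => ?_)
    rw [toExt_conjLoop]
    change v • conjExt (toExt φ) (ι (X := BimoduleTensor R M X.obj) (of R M) t) ∈
      pathSpan M (BimoduleTensor R M Y.obj) k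
    induction t using BimoduleTensor.induction with
    | h0 => rw [_root_.map_zero, _root_.map_zero, smul_zero]; exact zero_mem _
    | ht m x =>
      rw [conjExt_tmul, ← map_smul, smul_smul]
      exact absorb_symm_mem_pathSpan (hφ x _ (mul_ofVec_mem_paths hv m))
    | ha s t hs ht => rw [_root_.map_add, _root_.map_add, smul_add]; exact add_mem hs ht

/-- Long paths carry `φ (1 ⊗ x)` into the span of paths of equal length, and since `X` is finitely
generated one length serves all `x`. -/
instance stabilizationInd_full : (stabilizationInd R M).Full := by
  refine Stabilization.lift_full fun n X Y φ => ?_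
  have := X.property
  let p (k : ℕ) : Submodule R X.obj :=
    { carrier := {x | ∀ v ∈ paths R M k, v • toExt φ (ι (of R M) x) ∈ pathSpan M Y.obj k}
      zero_mem' := fun v _ => by
        rw [_root_.map_zero, _root_.map_zero, smul_zero]
        exact zero_mem _
      add_mem' := fun hx hy v hv => by
        rw [_root_.map_add, _root_.map_add, smul_add]
        exact add_mem (hx v hv) (hy v hv)
      smul_mem' := fun r x hx v hv => by
        rw [map_smulₛₗ, map_smul, smul_smul]
        exact hx _ (mul_of_mem_paths hv r) }
  obtain ⟨k, hk⟩ := (Module.Finite.fg_top (R := R) (M := X.obj)).exists_le_of_eventually_mem p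
    (fun x _ => by
      obtain ⟨k, l, hkl, h⟩ := exists_paths_smul_mem (toExt_ι_mem φ x)
      -- Source and target both carry the index `n`, so the coefficients have degree `-n + n = 0`
      -- and path lengths are preserved.
      obtain rfl : k = l := by omega
      refine Filter.eventually_atTop.2 ⟨k, fun l hl => ?_⟩
      obtain ⟨j, rfl⟩ := Nat.exists_eq_add_of_le hl
      exact h j)
  exact exists_map_eq_of_paths k n φ fun x => hk (Submodule.mem_top (x := x))

end LeavittRing

/-! ### Essential surjectivity -/

namespace LeavittRing

open ScalarExt

variable {R : Type u} [Ring R] {M : Type u} [AddCommGroup M] [Module R M]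
  [Module Rᵐᵒᵖ M] [SMulCommClass R Rᵐᵒᵖ M]

lemma mem_component_of_mem_paths {k : ℕ} {v : LeavittRing R M} (hv : v ∈ paths R M k) :
    v ∈ component R M (-k) := by
  induction k generalizing v with
  | zero =>
    rw [paths_zero] at hv
    obtain ⟨r, rfl⟩ := hv
    simpa using of_mem_component r
  | succ k ih =>
    rw [paths_succ'] at hv
    induction hv using Submodule.mul_induction_on' with
    | mem_mul_mem v hv m hm =>
      obtain ⟨m, rfl⟩ := hm
      have := SetLike.mul_mem_graded (ih hv) (IsMonomial.ofVec (R := R) m).mem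
      rwa [show -(k : ℤ) + -1 = -((k + 1 : ℕ) : ℤ) by push_cast; ring] at this
    | add v _ w _ hv hw => exact add_mem hv hw

section Hom

variable {n : ℤ} {X : FPModuleCat R} {Z : FPGradedModuleCat (component R M)}

/-- The underlying linear map of a morphism from an induced module. -/
def extHom (q : (ind R M n).obj X ⟶ Z) :
    ScalarExt (of R M) X.obj →ₗ[LeavittRing R M] Z.obj :=
  q.hom.toLinearMap

lemma extHom_mem (q : (ind R M n).obj X ⟶ Z) {i : ℤ} {t : ScalarExt (of R M) X.obj}
    (ht : t ∈ ScalarExt.component (of R M) (component R M) n X.obj i) :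
    extHom q t ∈ Z.obj.component i :=
  q.hom.map_mem i t ht

/-- The elements of the kernel which are spanned by paths of length `l`. -/
def kerPaths (q : (ind R M n).obj X ⟶ Z) (l : ℕ) : Set (ScalarExt (of R M) X.obj) :=
  {t | extHom q t = 0 ∧ t ∈ pathSpan M X.obj l}

end Hom

variable [Module.Finite R M] [Module.Projective R M]

/-- By `c = 1`, each `y` equals `∑ α_j^* (α_j y)`, so it is recovered from products with paths that
are longer by one. -/
lemma mem_span_paths_smul {N : Type*} [AddCommGroup N] [Module (LeavittRing R M) N] (z : N)
    (k : ℕ) : z ∈ Submodule.span (LeavittRing R M) {y | ∃ v ∈ paths R M k, y = v • z} := by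
  induction k with
  | zero => exact Submodule.subset_span ⟨1, one_mem_paths, (one_smul _ z).symm⟩
  | succ k ih =>
    refine Submodule.span_le.2 ?_ ih
    rintro _ ⟨v, hv, rfl⟩
    obtain ⟨n, α, α', hα⟩ := exists_dualBasis R M
    rw [← one_smul (LeavittRing R M) (v • z), ← sum_ofDual_mul_ofVec α α' hα, Finset.sum_smul]
    refine sum_mem fun j _ => ?_
    rw [mul_smul]
    refine Submodule.smul_mem _ _ (Submodule.subset_span ⟨ofVec R M (α j) * v, ?_, ?_⟩)
    · rw [paths_succ]
      exact Submodule.mul_mem_mul (ofVec_mem _) hv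
    · rw [mul_smul]

/-- A finitely generated graded module is generated by a single component. -/
lemma exists_span_component_eq_top (Z : GradedModuleCat (component R M))
    [Module.Finite (LeavittRing R M) Z] :
    ∃ n : ℤ, Submodule.span (LeavittRing R M) (Z.component (-n) : Set Z) = ⊤ := by
  obtain ⟨k, hk⟩ := (Module.Finite.fg_top (R := LeavittRing R M)
    (M := Z)).exists_le_of_eventually_mem
    (fun k => Submodule.span (LeavittRing R M) (Z.component (-(k : ℤ)) : Set Z)) (fun z _ => by
      induction z using GradedModuleCat.induction_homogeneous with
      | h0 => exact Filter.Eventually.of_forall fun k => zero_mem _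
      | hx i z hz =>
        -- A path of length `k + i` carries degree `i` to degree `-k`; the bound makes `k + i`
        -- nonnegative.
        refine Filter.eventually_atTop.2 ⟨(-i).toNat, fun k hk => ?_⟩
        refine Submodule.span_mono ?_ (mem_span_paths_smul (R := R) (M := M) z (k + i).toNat)
        rintro _ ⟨v, hv, rfl⟩
        have := Z.smul_mem (mem_component_of_mem_paths hv) hz
        rwa [show -(((k : ℤ) + i).toNat : ℤ) + i = -(k : ℤ) by omega] at this
      | ha x y hx hy =>
        filter_upwards [hx trivial, hy trivial] with k hx hy using add_mem hx hy)
  exact ⟨k, top_le_iff.1 hk⟩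

/-- Every finitely presented graded module is a quotient of an induced free module. -/
lemma exists_surjective (Z : FPGradedModuleCat (component R M)) :
    ∃ (n : ℤ) (X : FPModuleCat R) (q : (ind R M n).obj X ⟶ Z),
      isProjectiveModule R X ∧ Function.Surjective (extHom q) := by
  have := Z.property
  obtain ⟨n, hn⟩ := exists_span_component_eq_top Z.obj
  -- Finitely many generators can be chosen inside the component of degree `-n`, which makes the map
  -- from the induced free module degree-preserving.
  obtain ⟨s, hs, hs'⟩ := (Submodule.fg_span_iff_fg_span_finset_subset _).1
    (hn ▸ (Module.Finite.fg_top (R := LeavittRing R M) (M := Z.obj)))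
  rw [hn] at hs'
  let X : FPModuleCat R := ⟨ModuleCat.of R (s → R), inferInstanceAs
    (Module.FinitePresentation R (s → R))⟩
  let g : (s → R) →ₛₗ[of R M] Z.obj :=
    { toFun := fun v => ∑ z : s, of R M (v z) • (z : Z.obj)
      map_add' := fun v w => by simp [add_smul, Finset.sum_add_distrib]
      map_smul' := fun r v => by simp [mul_smul, Finset.smul_sum] }
  have hg : ∀ v, g v ∈ Z.obj.component (-n) := fun v => sum_mem fun z _ => by
    have := Z.obj.smul_mem (of_mem_component (M := M) (v z)) (hs z.2)
    rwa [zero_add] at this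
  let q : (ind R M n).obj X ⟶ Z := ObjectProperty.homMk
    (gradedLift (X := s → R) of_mem_component g hg)
  refine ⟨n, X, q, inferInstanceAs (Module.Projective R (s → R)), ?_⟩
  rw [← LinearMap.range_eq_top, ← top_le_iff, hs', Submodule.span_le]
  intro z hz
  classical
  refine ⟨ι (of R M) (Pi.single (⟨z, hz⟩ : s) (1 : R)), ?_⟩
  refine (lift_ι g _).trans ?_
  change ∑ y : s, of R M ((Pi.single (⟨z, hz⟩ : s) (1 : R) : s → R) y) • (y : Z.obj) = z
  rw [Finset.sum_eq_single ⟨z, hz⟩]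
  · simp
  · intro y _ hy
    simp [Pi.single_eq_of_ne hy]
  · simp

/-- The kernel is graded and finitely generated. Long paths carry a homogeneous kernel element to
kernel elements in the span of paths, and these generate it back by `mem_span_paths_smul`. -/
lemma exists_ker_le_span_kerPaths {n : ℤ} {X : FPModuleCat R}
    {Z : FPGradedModuleCat (component R M)} (q : (ind R M n).obj X ⟶ Z)
    (hq : Function.Surjective (extHom q)) :
    ∃ l, LinearMap.ker (extHom q) ≤ Submodule.span (LeavittRing R M) (kerPaths q l) := by
  have := X.property
  have := Z.property
  have hfg := Module.FinitePresentation.fg_ker (extHom q) hq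
  refine hfg.exists_le_of_eventually_mem
    (fun l => Submodule.span (LeavittRing R M) (kerPaths q l)) fun t ht => ?_
  let P := graded (component R M) of_mem_component n X.obj
  obtain ⟨s, hs⟩ := P.sum_proj t
  have key : ∀ i, ∀ᶠ l in Filter.atTop,
      P.proj i t ∈ Submodule.span (LeavittRing R M) (kerPaths q l) := by
    intro i
    have h0 : extHom q (P.proj i t) = 0 := by
      refine (GradedModuleCat.map_proj q.hom i t).trans ?_
      exact (congrArg (Z.obj.proj i) (LinearMap.mem_ker.1 ht)).trans (_root_.map_zero _)
    obtain ⟨k, l, -, h⟩ := exists_paths_smul_mem (P.proj_mem i t)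
    refine Filter.eventually_atTop.2 ⟨l, fun l' hl => ?_⟩
    obtain ⟨j, rfl⟩ := Nat.exists_eq_add_of_le hl
    refine Submodule.span_mono ?_ (mem_span_paths_smul (R := R) (M := M) (P.proj i t) (k + j))
    rintro _ ⟨v, hv, rfl⟩
    exact ⟨(map_smul (extHom q) v _).trans ((congrArg (v • ·) h0).trans (smul_zero v)),
      h j v hv⟩
  filter_upwards [(Filter.eventually_all_finset s).2 fun i _ => key i] with l hl
  rw [← hs]
  exact sum_mem hl

/-- Loops shorten the paths in the relations until `l = 0`. The relations then have the form `1 ⊗ x`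
and can be imposed on `X` itself, giving `Z ≅ L ⊗_R (X / K)`. -/
lemma exists_iso_of_ker_le_span (l : ℕ) {n : ℤ} {X : FPModuleCat R}
    {Z : FPGradedModuleCat (component R M)} (q : (ind R M n).obj X ⟶ Z)
    (hq : Function.Surjective (extHom q))
    (hl : LinearMap.ker (extHom q) ≤ Submodule.span (LeavittRing R M) (kerPaths q l)) :
    ∃ (m : ℤ) (Y : FPModuleCat R), Nonempty ((ind R M m).obj Y ≅ Z) := by
  induction l generalizing n X with
  | zero =>
    have := X.property
    have := Z.property
    have hfg := Module.FinitePresentation.fg_ker (extHom q) hq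
    have hker : LinearMap.ker (extHom q) = Submodule.span (LeavittRing R M) (kerPaths q 0) :=
      le_antisymm hl (Submodule.span_le.2 fun t ht => ht.1)
    rw [hker] at hfg
    obtain ⟨s, hs, hs'⟩ := (Submodule.fg_span_iff_fg_span_finset_subset _).1 hfg
    have hx : ∀ t : s, ∃ x, (t : ScalarExt (of R M) X.obj) = ι (of R M) x :=
      fun t => mem_pathSpan_zero (hs t.2).2
    choose x hx using hx
    -- Only finitely many relations are imposed, which keeps the quotient finitely presented.
    let K : Submodule R X.obj := Submodule.span R (Set.range x)
    have hK : K.FG := Submodule.fg_span (Set.finite_range x)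
    let Y : FPModuleCat R := ⟨ModuleCat.of R (X.obj ⧸ K),
      Module.finitePresentation_of_surjective K.mkQ K.mkQ_surjective (by rwa [K.ker_mkQ])⟩
    let g : X.obj →ₛₗ[of R M] Z.obj := (extHom q).comp (ι (of R M))
    have hg : K ≤ LinearMap.ker g := by
      refine Submodule.span_le.2 ?_
      rintro _ ⟨t, rfl⟩
      change extHom q (ι (of R M) (x t)) = 0
      rw [← hx]
      exact (hs t.2).1
    have hmem : ∀ y, K.liftQ g hg y ∈ Z.obj.component (-n) := by
      intro y
      obtain ⟨y, rfl⟩ := K.mkQ_surjective y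
      exact extHom_mem q (ι_mem_component y)
    let f : (ind R M n).obj Y ⟶ Z := ObjectProperty.homMk
      (gradedLift (X := X.obj ⧸ K) of_mem_component (K.liftQ g hg) hmem)
    have hf : ∀ t, ScalarExt.lift (K.liftQ g hg) (ScalarExt.map (of R M) K.mkQ t) =
        extHom q t := by
      intro t
      refine LinearMap.congr_fun (f := ScalarExt.lift (K.liftQ g hg) ∘ₗ
        ScalarExt.map (of R M) K.mkQ) (ScalarExt.hom_ext fun y => ?_) t
      rw [LinearMap.comp_apply, map_ι, lift_ι]
      rfl
    have hbij : Function.Bijective f.hom.toLinearMap := by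
      change Function.Bijective (ScalarExt.lift (K.liftQ g hg))
      constructor
      · rw [← LinearMap.ker_eq_bot, ← le_bot_iff]
        intro w hw
        obtain ⟨t, rfl⟩ := ScalarExt.map_surjective (φ := of R M) K.mkQ_surjective w
        rw [LinearMap.mem_ker, hf] at hw
        -- The kernel of `extHom q` is spanned by elements `ι (x t)` with `x t ∈ K`, and these
        -- already die in the module induced from `X / K`.
        have ht : t ∈ Submodule.span (LeavittRing R M) (s : Set (ScalarExt (of R M) X.obj)) := by
          rw [← hs', ← hker]
          exact hw
        refine Submodule.span_le (p := LinearMap.ker (ScalarExt.map (of R M) K.mkQ)).2 ?_ ht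
        intro t ht
        rw [SetLike.mem_coe, LinearMap.mem_ker, show t = _ from hx ⟨t, ht⟩, map_ι,
          show K.mkQ (x ⟨t, ht⟩) = 0 from
            (Submodule.Quotient.mk_eq_zero K).2 (Submodule.subset_span ⟨_, rfl⟩), _root_.map_zero]
      · intro z
        obtain ⟨t, rfl⟩ := hq z
        exact ⟨_, hf t⟩
    exact ⟨n, Y, ⟨ObjectProperty.isoMk _ (GradedModuleCat.isoOfBijective f.hom hbij)⟩⟩
  | succ l ih =>
    let q' := (indLoopIso R M n (n + 1) rfl).inv.app X ≫ q
    have hq' : ∀ t : ScalarExt (of R M) (BimoduleTensor R M X.obj),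
      extHom q' t = extHom q (absorb R M X.obj t) := fun t => rfl
    refine ih q' (hq.comp (absorb R M X.obj).surjective) fun
      (t : ScalarExt (of R M) (BimoduleTensor R M X.obj)) ht => ?_
    have h := hl (show absorb R M X.obj t ∈ LinearMap.ker (extHom q) from ht)
    have h' := Submodule.mem_map_of_mem (f := (absorb R M X.obj).symm.toLinearMap) h
    rw [Submodule.map_span, LinearEquiv.coe_coe, LinearEquiv.symm_apply_apply] at h'
    refine Submodule.span_mono ?_ h'
    rintro _ ⟨u, ⟨hu, hu'⟩, rfl⟩
    refine ⟨?_, absorb_symm_mem_pathSpan hu'⟩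
    refine (hq' _).trans ?_
    rw [LinearEquiv.apply_symm_apply, hu]

instance stabilizationInd_essSurj : (stabilizationInd R M).EssSurj where
  mem_essImage Z := by
    obtain ⟨n, X, q, -, hq⟩ := exists_surjective Z
    obtain ⟨l, hl⟩ := exists_ker_le_span_kerPaths q hq
    obtain ⟨m, Y, ⟨e⟩⟩ := exists_iso_of_ker_le_span l q hq hl
    exact ⟨⟨Y, m⟩, ⟨e⟩⟩

instance : (stabilizationInd R M).IsEquivalence where

end LeavittRing

/-! ### Passage to factor categories -/

namespace Stabilization

section Comparison

variable {C : Type*} [Category* C] {Ω : C ⥤ C} {D : Type*} [Category* D]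
  {C' : Type*} [Category* C'] {Δ : C' ⥤ C'} {D' : Type*} [Category* D']
  (F : ℤ → C ⥤ D) (θ : ∀ n p : ℤ, n + 1 = p → (F n ≅ Ω ⋙ F p))
  (F' : ℤ → C' ⥤ D') (θ' : ∀ n p : ℤ, n + 1 = p → (F' n ≅ Δ ⋙ F' p))
  (G : C ⥤ C') (δ : Ω ⋙ G ≅ G ⋙ Δ) (K : D ⥤ D') (κ : ∀ n, F n ⋙ K ≅ G ⋙ F' n)

variable {F θ F' θ' G δ K κ} in
-- The squares `h` are stacked, one for each loop; naturality of `θ'` moves the accumulated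
-- `iterIso` past the next square.
lemma iterLoopIso_comparison
    (h : ∀ (n p : ℤ) (e : n + 1 = p) (X : C),
      (κ n).hom.app X ≫ (θ' n p e).hom.app (G.obj X) =
        K.map ((θ n p e).hom.app X) ≫ (κ p).hom.app (Ω.obj X) ≫ (F' p).map (δ.hom.app X))
    (a : ℕ) (n p : ℤ) (e : n + a = p) (X : C) :
    (κ n).hom.app X ≫ (iterLoopIso F' θ' a n p e (G.obj X)).hom =
      K.map (iterLoopIso F θ a n p e X).hom ≫ (κ p).hom.app ((iterFunctor Ω a).obj X) ≫
        (F' p).map (iterIso G δ a X).hom := by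
  induction a generalizing p with
  | zero =>
    obtain rfl : n = p := by simpa using e
    change _ ≫ 𝟙 _ = K.map (𝟙 _) ≫ (κ n).hom.app X ≫ (F' n).map (𝟙 _)
    simp
  | succ a ih =>
    have e' : n + a + 1 = p := by rw [← e]; push_cast; ring
    rw [iterLoopIso_succ F θ a n (n + a) p rfl e e', iterLoopIso_succ F' θ' a n (n + a) p rfl e e']
    have nat := (θ' (n + a) p e').hom.naturality (iterIso G δ a X).hom
    calc (κ n).hom.app X ≫ (iterLoopIso F' θ' a n (n + a) rfl (G.obj X)).hom ≫
          (θ' (n + a) p e').hom.app ((iterFunctor Δ a).obj (G.obj X))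
        = K.map (iterLoopIso F θ a n (n + a) rfl X).hom ≫
            (κ (n + a)).hom.app ((iterFunctor Ω a).obj X) ≫
            (F' (n + a)).map (iterIso G δ a X).hom ≫
            (θ' (n + a) p e').hom.app ((iterFunctor Δ a).obj (G.obj X)) := by
          rw [← Category.assoc, ih _ rfl]
          simp only [Category.assoc]
      _ = K.map (iterLoopIso F θ a n (n + a) rfl X).hom ≫
            ((κ (n + a)).hom.app ((iterFunctor Ω a).obj X) ≫
            (θ' (n + a) p e').hom.app (G.obj ((iterFunctor Ω a).obj X))) ≫
            (F' p).map (Δ.map (iterIso G δ a X).hom) := by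
          rw [nat]
          simp only [Category.assoc, Functor.comp_map]
      _ = K.map ((iterLoopIso F θ a n (n + a) rfl X).hom ≫
              (θ (n + a) p e').hom.app ((iterFunctor Ω a).obj X)) ≫
            (κ p).hom.app (Ω.obj ((iterFunctor Ω a).obj X)) ≫
            (F' p).map (δ.hom.app ((iterFunctor Ω a).obj X) ≫
              Δ.map (iterIso G δ a X).hom) := by
          rw [h]
          simp only [Category.assoc, Functor.map_comp]

/-- Compatible functors on two looped categories induce compatible functors on the
stabilizations. -/
def liftComparison
    (h : ∀ (n p : ℤ) (e : n + 1 = p) (X : C),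
      (κ n).hom.app X ≫ (θ' n p e).hom.app (G.obj X) =
        K.map ((θ n p e).hom.app X) ≫ (κ p).hom.app (Ω.obj X) ≫ (F' p).map (δ.hom.app X)) :
    lift F θ ⋙ K ≅ mapFunctor G δ ⋙ lift F' θ' :=
  NatIso.ofComponents (fun A => (κ A.deg).app A.obj) (by
    rintro A B ⟨r⟩
    change K.map (liftRep F θ r _ rfl) ≫ (κ B.deg).hom.app B.obj =
      (κ A.deg).hom.app A.obj ≫ liftRep F' θ' (r.map G δ) (A.deg + r.a) rfl
    have hb : B.deg + r.b = A.deg + r.a := r.deg_eq.symm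
    have h1 := iterLoopIso_comparison h r.a A.deg _ rfl A.obj
    have h2 := iterLoopIso_comparison h r.b B.deg _ hb B.obj
    have nat := (κ (A.deg + r.a)).hom.naturality r.f
    dsimp only [Functor.comp_map, Functor.comp_obj] at nat
    -- Once the isomorphism at the target is cancelled, only `h1`, `h2` and naturality of `κ` at
    -- `r.f` are needed.
    rw [← cancel_mono (iterLoopIso F' θ' r.b B.deg _ hb (G.obj B.obj)).hom, Category.assoc, h2,
      Category.assoc]
    dsimp only [liftRep, Rep.map]
    rw [Category.assoc, Category.assoc, Iso.inv_hom_id, Category.comp_id]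
    rw [reassoc_of% h1]
    simp only [Functor.map_comp, Category.assoc]
    rw [← Functor.map_comp_assoc (F' _) (iterIso G δ r.a A.obj).hom, Iso.hom_inv_id]
    rw [← Functor.map_comp_assoc K (iterLoopIso F θ r.b B.deg _ hb B.obj).inv, Iso.inv_hom_id]
    simp only [CategoryTheory.Functor.map_id, Category.id_comp]
    rw [reassoc_of% nat])

end Comparison

end Stabilization

/-! ### Factorizations in the stabilization -/

namespace Stabilization

variable {C : Type u} [Category.{v} C] {P : ObjectProperty C} {Ω : C ⥤ C}

lemma iterFunctor_obj_prop (hΩ : ∀ X, P X → P (Ω.obj X)) {X : C} (hX : P X) (k : ℕ) :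
    P ((iterFunctor Ω k).obj X) := by
  induction k with
  | zero => exact hX
  | succ k ih => exact hΩ _ ih

/-- If a morphism factors through an object with the property `P`, then so does a
representative of it. -/
lemma exists_shift_factors (hΩ : ∀ X, P X → P (Ω.obj X)) {A B E : Stabilization Ω}
    (hE : P E.obj) (r : Rep A B) (x : A ⟶ E) (y : E ⟶ B) (h : (show A ⟶ B from Hom.mk r) = x ≫ y) :
    ∃ k, ∃ (Z : C) (_ : P Z) (c : _ ⟶ Z) (d : Z ⟶ _), (r.shift k).f = c ≫ d := by
  obtain ⟨s⟩ := x
  obtain ⟨t⟩ := y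
  have e : (s.shift t.a).b = (t.shift s.b).a := by simp [add_comm]
  have h' : Hom.mk r = Hom.mk ((s.shift t.a).comp (t.shift s.b) e) := by
    refine h.trans ?_
    rw [← Hom.mk_comp_mk, Hom.mk_shift, Hom.mk_shift]
    rfl
  -- Equality in the colimit is equality after finitely many loops, and the loops of `E.obj` still
  -- have the property `P`.
  obtain ⟨k, l, hkl⟩ := Hom.exists_shift_eq h'
  rw [Rep.comp_shift] at hkl
  refine ⟨k, ?_⟩
  rw [hkl]
  exact ⟨_, iterFunctor_obj_prop hΩ hE _, _, _, rfl⟩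

end Stabilization

/-! ### Functors between factor categories -/

section FactorMap

variable {C : Type*} [Category* C] [Preadditive C] {P : ObjectProperty C}
  {D : Type*} [Category* D] [Preadditive D] {Q : ObjectProperty D}

/-- An additive functor which sends `P` into `Q` induces a functor between the factor
categories. -/
def factorMap (G : C ⥤ D) [G.Additive] (hG : ∀ X, P X → Q (G.obj X)) :
    FactorCategory P ⥤ FactorCategory Q :=
  CategoryTheory.Quotient.lift (factorRel P) (G ⋙ toFactor Q) (by
    rintro X Y f g ⟨Z, hZ, b, a, h⟩
    refine CategoryTheory.Quotient.sound (factorRel Q) ⟨G.obj Z, hG Z hZ, G.map b, G.map a, ?_⟩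
    rw [← Functor.map_sub, h, Functor.map_comp])

variable {Ω : C ⥤ C} [Ω.Additive] (hΩ : ∀ X, P X → P (Ω.obj X))

/-- The isomorphism between functors on factor categories induced by `F ≅ Ω ⋙ G`. -/
def factorMapLoopIso (F G : C ⥤ D) [F.Additive] [G.Additive] (hF : ∀ X, P X → Q (F.obj X))
    (hG : ∀ X, P X → Q (G.obj X)) (θ : F ≅ Ω ⋙ G) :
    factorMap F hF ≅ factorEndofunctor Ω hΩ ⋙ factorMap G hG :=
  NatIso.ofComponents (fun X => (toFactor Q).mapIso (θ.app X.as)) (by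
    rintro ⟨X⟩ ⟨Y⟩ f
    obtain ⟨f, rfl⟩ := (toFactor P).map_surjective (X := X) (Y := Y) f
    exact congrArg (toFactor Q).map (θ.hom.naturality f))

end FactorMap

namespace Stabilization

variable {C : Type u} [Category.{v} C] [Preadditive C] {P : ObjectProperty C}
  {D : Type u'} [Category.{v'} D] [Preadditive D] {Q : ObjectProperty D}
  {Ω : C ⥤ C} [Ω.Additive] (hΩ : ∀ X, P X → P (Ω.obj X))
  (F : ℤ → C ⥤ D) [∀ n, (F n).Additive] (hF : ∀ n X, P X → Q ((F n).obj X))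
  (θ : ∀ n p : ℤ, n + 1 = p → (F n ≅ Ω ⋙ F p))

/-- The functor from the stabilization of the factor category induced by functors `F n` with
`F n ≅ F (n + 1) Ω`. -/
def factorLift : Stabilization (factorEndofunctor Ω hΩ) ⥤ FactorCategory Q :=
  lift (fun n => factorMap (F n) (hF n))
    (fun n p h => factorMapLoopIso hΩ (F n) (F p) (hF n) (hF p) (θ n p h))

/-- The canonical functor from the stabilization to the stabilization of the factor category. -/
abbrev toFactorStabilization : Stabilization Ω ⥤ Stabilization (factorEndofunctor Ω hΩ) :=
  mapFunctor (toFactor P) (factorLoopIso Ω hΩ)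

/-- `factorLift` is induced by `lift`. -/
def factorLiftIso :
    lift F θ ⋙ toFactor Q ≅ toFactorStabilization hΩ ⋙ factorLift hΩ F hF θ :=
  -- Passing to the factor categories changes no objects, so the comparison isomorphisms are
  -- identities.
  liftComparison F θ _ _ (toFactor P) (factorLoopIso Ω hΩ) (toFactor Q) (fun _ => Iso.refl _)
    (fun n p e X => by
      change 𝟙 _ ≫ (toFactor Q).map ((θ n p e).hom.app X) =
        (toFactor Q).map ((θ n p e).hom.app X) ≫
          𝟙 ((toFactor Q).obj ((F p).obj (Ω.obj X))) ≫
            (factorMap (F p) (hF p)).map ((toFactor P).map (𝟙 (Ω.obj X)))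
      have h : (factorMap (F p) (hF p)).map ((toFactor P).map (𝟙 (Ω.obj X))) =
          𝟙 ((toFactor Q).obj ((F p).obj (Ω.obj X))) :=
        congrArg (toFactor Q).map (CategoryTheory.Functor.map_id (F p) (Ω.obj X))
      refine (Category.id_comp _).trans (Eq.symm ?_)
      refine (congrArg (_ ≫ ·) ((Category.id_comp _).trans h)).trans ?_
      exact Category.comp_id _)

lemma factorLift_map_toFactorStabilization {A B : Stabilization Ω} (ψ : A ⟶ B) :
    (factorLift hΩ F hF θ).map ((toFactorStabilization hΩ).map ψ) =
      (toFactor Q).map ((lift F θ).map ψ) := by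
  have := (factorLiftIso hΩ F hF θ).hom.naturality ψ
  exact (Category.id_comp _).symm.trans (this.symm.trans (Category.comp_id _))

lemma toFactorStabilization_map_single (n : ℤ) {X Y : C} (f : X ⟶ Y) :
    (toFactorStabilization (P := P) hΩ).map (single n f) = single n ((toFactor P).map f) := by
  refine congrArg (fun g => (Hom.mk (Rep.mk 0 0 rfl g) : Hom (Ω := factorEndofunctor Ω hΩ)
    ⟨(toFactor P).obj X, n⟩ ⟨(toFactor P).obj Y, n⟩)) ?_
  change 𝟙 _ ≫ (toFactor P).map f ≫ 𝟙 _ = _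
  simp

/-- `Ω` is additive, so the loops of `f` and `g` have as difference the loop of `f - g`, and they
become equal in the factor category once this factors. The representative `r` is separate from `f -
g` so that the induction can pass to `r.succ`. -/
lemma toFactorStabilization_map_eq_of_shift (k : ℕ) {A B : Stabilization Ω} (a b : ℕ)
    (h : A.deg + a = B.deg + b) (f g : (iterFunctor Ω a).obj A.obj ⟶ (iterFunctor Ω b).obj B.obj)
    (r : Rep A B) (hr : r = ⟨a, b, h, f - g⟩)
    (hk : ∃ (Z : C) (_ : P Z) (c : _ ⟶ Z) (d : Z ⟶ _), (r.shift k).f = c ≫ d) :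
    Hom.mk (Rep.map (toFactor P) (factorLoopIso Ω hΩ) ⟨a, b, h, f⟩) =
      Hom.mk (Rep.map (toFactor P) (factorLoopIso Ω hΩ) ⟨a, b, h, g⟩) := by
  induction k generalizing a b r with
  | zero =>
    subst hr
    have : (toFactor P).map f = (toFactor P).map g := CategoryTheory.Quotient.sound _ hk
    dsimp only [Rep.map]
    rw [this]
  | succ k ih =>
    have := ih (a + 1) (b + 1) (by push_cast; omega) (Ω.map f) (Ω.map g) r.succ
      (by subst hr; exact congrArg (Rep.mk _ _ _) (Functor.map_sub Ω)) (by rwa [Rep.succ_shift])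
    rw [← Hom.mk_succ, ← Rep.map_succ, ← Hom.mk_succ (Rep.map _ _ ⟨a, b, h, g⟩), ← Rep.map_succ]
    exact this

variable {F θ}

/-- The object `Z` through which the difference factors is a retract of some value `(lift F θ).obj
E`, so it may be replaced by that value. Full faithfulness brings the factorization back to the
stabilization, where `exists_shift_factors` makes it one in `C`. -/
lemma toFactorStabilization_map_eq [(lift F θ).Full] [(lift F θ).Faithful]
    (hQ : ∀ Z, Q Z → ∃ E : Stabilization Ω, P E.obj ∧
      ∃ (s : Z ⟶ (lift F θ).obj E) (q : (lift F θ).obj E ⟶ Z), s ≫ q = 𝟙 Z)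
    {A B : Stabilization Ω} (ψ ψ' : A ⟶ B)
    (h : factorRel Q ((lift F θ).map ψ) ((lift F θ).map ψ')) :
    (toFactorStabilization (P := P) hΩ).map ψ = (toFactorStabilization hΩ).map ψ' := by
  obtain ⟨r⟩ := ψ
  obtain ⟨r'⟩ := ψ'
  change factorRel Q ((lift F θ).map (show A ⟶ B from Hom.mk r))
    ((lift F θ).map (show A ⟶ B from Hom.mk r')) at h
  change (toFactorStabilization (P := P) hΩ).map (show A ⟶ B from Hom.mk r) =
    (toFactorStabilization (P := P) hΩ).map (show A ⟶ B from Hom.mk r')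
  rw [← Hom.mk_shift r r'.a, ← Hom.mk_shift r' r.a] at h ⊢
  have ha : (r.shift r'.a).a = (r'.shift r.a).a := by simp [add_comm]
  have hb : (r.shift r'.a).b = (r'.shift r.a).b := by
    have h1 := (r.shift r'.a).deg_eq
    have h2 := (r'.shift r.a).deg_eq
    rw [ha] at h1
    omega
  revert h
  generalize r.shift r'.a = s at *
  generalize r'.shift r.a = s' at *
  intro h
  obtain ⟨a, b, h1, f⟩ := s
  obtain ⟨c, d, h2, g⟩ := s'
  obtain rfl : a = c := ha
  obtain rfl : b = d := hb
  obtain ⟨Z, hZ, x, y, hxy⟩ := h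
  obtain ⟨E, hE, s, q, hsq⟩ := hQ Z hZ
  -- The difference is formed on representatives of the same level; no additive structure on the
  -- stabilization is used.
  have key : (lift F θ).map (show A ⟶ B from Hom.mk ⟨a, b, h1, f - g⟩) = (x ≫ s) ≫ q ≫ y := by
    rw [Category.assoc, reassoc_of% hsq, ← hxy, lift_map_mk F θ _ _ rfl,
      lift_map_mk F θ _ _ rfl, lift_map_mk F θ _ _ rfl]
    dsimp only [liftRep]
    rw [Functor.map_sub, Preadditive.sub_comp, Preadditive.comp_sub]
    rfl
  obtain ⟨x', hx'⟩ := (lift F θ).map_surjective (x ≫ s)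
  obtain ⟨y', hy'⟩ := (lift F θ).map_surjective (q ≫ y)
  rw [← hx', ← hy', ← Functor.map_comp] at key
  obtain ⟨k, hk⟩ := exists_shift_factors hΩ hE _ x' y' ((lift F θ).map_injective key)
  exact toFactorStabilization_map_eq_of_shift hΩ k a b h1 f g _ rfl hk

/-- Equality in the factor category is the equivalence relation generated by the compositional
closure of `factorRel`. Fullness lifts the intermediate morphisms of a chain, so single steps
suffice. -/
lemma toFactorStabilization_map_eq_of_eqvGen [(lift F θ).Full] [(lift F θ).Faithful]
    (hQ : ∀ Z, Q Z → ∃ E : Stabilization Ω, P E.obj ∧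
      ∃ (s : Z ⟶ (lift F θ).obj E) (q : (lift F θ).obj E ⟶ Z), s ≫ q = 𝟙 Z)
    {A B : Stabilization Ω} {x y : (lift F θ).obj A ⟶ (lift F θ).obj B}
    (h : Relation.EqvGen (@HomRel.CompClosure D _ (factorRel Q) ((lift F θ).obj A)
      ((lift F θ).obj B)) x y) (ψ ψ' : A ⟶ B)
    (hx : (lift F θ).map ψ = x) (hy : (lift F θ).map ψ' = y) :
    (toFactorStabilization (P := P) hΩ).map ψ = (toFactorStabilization hΩ).map ψ' := by
  induction h generalizing ψ ψ' with
  | rel x y h =>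
    refine toFactorStabilization_map_eq hΩ hQ ψ ψ' ?_
    rw [hx, hy]
    obtain ⟨_, _, f, m₁, m₂, g, Z, hZ, b, a, h⟩ := h
    refine ⟨Z, hZ, f ≫ b, a ≫ g, ?_⟩
    rw [← Preadditive.comp_sub, ← Preadditive.sub_comp, h]
    simp
  | refl x => rw [(lift F θ).map_injective (hx.trans hy.symm)]
  | symm x y _ ih => exact (ih ψ' ψ hy hx).symm
  | trans x y z _ _ ih ih' =>
    obtain ⟨ψ'', h⟩ := (lift F θ).map_surjective y
    exact (ih ψ ψ'' hx h).trans (ih' ψ'' ψ' h hy)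

/-- If `lift F θ` is an equivalence, then so is the induced functor on the factor categories. -/
lemma factorLift_isEquivalence [(lift F θ).IsEquivalence]
    (hQ : ∀ Z, Q Z → ∃ E : Stabilization Ω, P E.obj ∧
      ∃ (s : Z ⟶ (lift F θ).obj E) (q : (lift F θ).obj E ⟶ Z), s ≫ q = 𝟙 Z) :
    (factorLift hΩ F hF θ).IsEquivalence where
  faithful := lift_faithful (by
    rintro n ⟨X⟩ ⟨Y⟩ f g h
    obtain ⟨f, rfl⟩ := (toFactor P).map_surjective (X := X) (Y := Y) f
    obtain ⟨g, rfl⟩ := (toFactor P).map_surjective (X := X) (Y := Y) g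
    have h' : (toFactor Q).map ((F n).map f) = (toFactor Q).map ((F n).map g) := h
    have := toFactorStabilization_map_eq_of_eqvGen hΩ (F := F) (θ := θ) hQ (A := ⟨X, n⟩)
      (B := ⟨Y, n⟩) (Quot.eqvGen_exact h') (single n f) (single n g)
      (lift_map_single F θ n f) (lift_map_single F θ n g)
    rwa [toFactorStabilization_map_single, toFactorStabilization_map_single] at this)
  full := lift_full (by
    rintro n ⟨X⟩ ⟨Y⟩ φ
    obtain ⟨φ, rfl⟩ := (toFactor Q).map_surjective (X := (F n).obj X) (Y := (F n).obj Y) φ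
    obtain ⟨ψ, rfl⟩ := (lift F θ).map_surjective (X := (⟨X, n⟩ : Stabilization Ω))
      (Y := (⟨Y, n⟩ : Stabilization Ω)) φ
    exact ⟨(toFactorStabilization hΩ).map ψ,
      factorLift_map_toFactorStabilization hΩ F hF θ ψ⟩)
  essSurj :=
    { mem_essImage := fun Z =>
        ⟨(toFactorStabilization hΩ).obj ((lift F θ).objPreimage Z.as),
          ⟨(toFactor Q).mapIso ((lift F θ).objObjPreimageIso Z.as)⟩⟩ }

end Stabilization

/-! ### Projective graded modules and the conclusion -/

namespace LeavittRing

variable {R : Type u} [Ring R] {M : Type u} [AddCommGroup M] [Module R M]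
  [Module Rᵐᵒᵖ M] [SMulCommClass R Rᵐᵒᵖ M] [Module.Finite R M] [Module.Projective R M]

/-- Every projective graded module is a direct summand of an induced projective module. -/
lemma exists_retract (Z : FPGradedModuleCat (component R M))
    (hZ : isProjectiveGradedModule (component R M) Z) :
    ∃ E : Stabilization (tensorEndofunctor R M), isProjectiveModule R E.obj ∧
      ∃ (s : Z ⟶ (stabilizationInd R M).obj E) (q : (stabilizationInd R M).obj E ⟶ Z),
        s ≫ q = 𝟙 Z := by
  obtain ⟨n, X, q, hX, hq⟩ := exists_surjective Z
  have : Module.Projective (LeavittRing R M) Z.obj := hZ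
  obtain ⟨s, hs⟩ := GradedModuleCat.exists_section q.hom hq
  exact ⟨⟨X, n⟩, hX, ObjectProperty.homMk s, q, ObjectProperty.hom_ext _ hs⟩

end LeavittRing

theorem mainTheorem3 (R : Type u) [Ring R] (M : Type u) [AddCommGroup M] [Module R M]
    [Module Rᵐᵒᵖ M] [SMulCommClass R Rᵐᵒᵖ M] [Module.Finite R M] [Module.Projective R M] :
    ∃ (E : Stabilization (tensorEndofunctor R M) ≌
          FPGradedModuleCat (LeavittRing.component R M))
      (E' : Stabilization (stableTensorEndofunctor R M) ≌
          StableGradedModuleCat (LeavittRing.component R M)),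
      Nonempty (E.functor ⋙ toFactor (isProjectiveGradedModule (LeavittRing.component R M)) ≅
        stabilizationToStable R M ⋙ E'.functor) := by
  have hF : ∀ (n : ℤ) (X : FPModuleCat R), isProjectiveModule R X →
      isProjectiveGradedModule (LeavittRing.component R M) ((LeavittRing.ind R M n).obj X) :=
    fun n => ScalarExt.functor_projective _ _ n
  have := Stabilization.factorLift_isEquivalence (tensorEndofunctor_projective R M) hF
    (F := LeavittRing.ind R M) (θ := LeavittRing.indLoopIso R M) LeavittRing.exists_retract
  exact ⟨(LeavittRing.stabilizationInd R M).asEquivalence,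
    (Stabilization.factorLift (tensorEndofunctor_projective R M) (LeavittRing.ind R M) hF
      (LeavittRing.indLoopIso R M)).asEquivalence,
    ⟨Stabilization.factorLiftIso (tensorEndofunctor_projective R M) (LeavittRing.ind R M) hF
      (LeavittRing.indLoopIso R M)⟩⟩
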